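/- **Setting.** Let $n\ge 2$ and $N=2n+2$. Consider $N$ identical point vortices $v_1,\dots,v_N$ on the unit sphere $S^2\subset\mathbb R^3$, with equations of motion $$\dot v_j=\sum_{i\ne j}\frac{v_i\times v_j}{|v_j-v_i|^2},\qquad j=1,\dots,N,\tag{1}$$ and energy $H(v)=-\tfrac12\sum_{i<j}\ln|v_j-v_i|^2$. Solutions and equilibria of (1) are understood to be free of collisions ($v_i\neq v_j$ for $i\ne j$). Let $\mathbb D_n<\mathrm{SO}(3)$ be the dihedral group of order $2n$ generated by the rotation by $2\pi/n$ about the third axis and the rotation by $\pi$ about the first axis. Fix any ordering $(g_1,\dots,g_{2n})$ of $\mathbb D_n$ and any ordering $(f_1,f_2)$ of the two poles $(0,0,\pm1)$, and for $u\in S^2$ put $$\rho(u)=(g_1u,\dots,g_{2n}u,f_1,f_2).$$ By a *1-parameter family of periodic solutions over an interval $I$ of energies* we mean a family $v_h(t)=\rho(u_h(t))$, $h\in I$, $t\in\mathbb R$, jointly continuous in $(h,t)$, such that each $v_h$ is a solution of (1) with $H(v_h(t))=h$ for all $t$ and is periodic with minimal period $T_h>0$. (In particular two vortices stay fixed at the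 poles, and the loops traversed by the other vortices, with the position of the vortices on them at each instant, are obtained from a single one by the action of $\mathbb D_n$.) We say that a vortex *travels once around* $p\in S^2$ if in one period $T_h$ its path is a closed loop avoiding $\pm p$ whose winding number about the axis of $p$ is $\pm1$. **(i) Anti-prism with poles.** Let $n\ge3$. The polynomial $$\hat{\mathcal P}_a(\lambda)=(3n+1)T_{2n}(\lambda)-nU_{2n}(\lambda)+2n+1,$$ with $T_k,U_k$ the Chebyshev polynomials of the first and second kind, has exactly one root $\hat\lambda_a>1$. Let $\hat z_a\in(0,1)$ be given by $\hat z_a^2=1-1/\hat\lambda_a^2$, and let $u_0$ be any of the $4n$ points $$\Big(\sqrt{1-\hat z_a^2}\cos\tfrac{(2j-1)\pi}{2n},\ \sqrt{1-\hat z_a^2}\sin\tfrac{(2j-1)\pi}{2n},\ \pm\hat z_a\Big),\qquad j=1,\dots,2n.$$ Then $v_0=\rho(u_0)$ is an equilibrium of (1) whose first $2n$ vortices occupy the vertices of an $n$-gon anti-prism of height $2\hat z_a$ inscribed in $S^2$, the other two being at the poles. The points of $v_0$ are the vertices of a cube if $n=3$ and of a regular icosahedron if $n=5$. There are $h_1>H(v_0)$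 and a 1-parameter family of periodic solutions over $(H(v_0),h_1)$ such that $v_h(t)\to v_0$ uniformly in $t$ as $h\to H(v_0)^+$; for each $h$, and each $j\le 2n$, the $j$-th vortex travels once around the vertex $g_ju_0$ of the anti-prism. **(ii) Polar collision.** Let $u_0$ be one of the poles; in $\rho(u_0)$ each pole is occupied by $n$ of the first $2n$ vortices. There are $h_1\in\mathbb R$ and a 1-parameter family of periodic solutions over $(h_1,\infty)$ such that, as $h\to\infty$, $v_h(t)\to\rho(u_0)$ uniformly in $t$ and $T_h\to0$. For each $h$, the $n$ vortices $j\le 2n$ with $g_ju_0$ equal to the north pole all travel along one and the same closed loop, and those with $g_ju_0$ equal to the south pole all travel along one and the same closed loop; the winding number of the former vortices about the oriented axis $(0,0,1)$ over one period is $\varepsilon\in\{1,-1\}$, and that of the latter is $-\varepsilon$ (opposite directions). **(iii) Polygonal collisions with poles.** Let $u_0=(\cos\frac{l\pi}{n},\sin\frac{l\pi}{n},0)$ with $0\le l<2n$. The first $2n$ vortices of $\rho(u_0)$ occupy the vertices $(\cos\frac{(l+2k)\pi}{n},\sin\frac{(l+2k)\pi}{n},0)$, $0\le k<n$, of a regular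 $n$-gon on the equator, exactly two at each vertex. There are $h_1\in\mathbb R$ and a 1-parameter family of periodic solutions over $(h_1,\infty)$ such that, as $h\to\infty$, $v_h(t)\to\rho(u_0)$ uniformly in $t$ and $T_h\to0$. For each $h$ and each vertex of the $n$-gon, the two vortices attached to that vertex travel along one and the same closed loop, and each of them travels once around that vertex. -/

import Mathlib

open Filter Topology Set
open scoped Matrix

/-- Euclidean three-space. -/
abbrev E3 : Type := EuclideanSpace ℝ (Fin 3)

/-- The rotation group `SO(3)`. -/
abbrev SO3 : Type := Matrix.specialOrthogonalGroup (Fin 3) ℝ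

/-- The action of a rotation on a vector. -/
noncomputable def rot (g : SO3) (u : E3) : E3 :=
  WithLp.toLp 2 ((g : Matrix (Fin 3) (Fin 3) ℝ) *ᵥ u.ofLp)

/-- The vector product on Euclidean three-space. -/
noncomputable def cross3 (u v : E3) : E3 :=
  WithLp.toLp 2 (crossProduct u.ofLp v.ofLp)

/-! ### Identical point vortices on the unit sphere -/

/-- The Hamiltonian `H(v) = -(1/2) ∑_{i<j} ln |v_j - v_i|²`. -/
noncomputable def vortexEnergy {N : ℕ} (v : Fin N → E3) : ℝ :=
  -(1 / 2) * ∑ i, ∑ j ∈ Finset.Ioi i, Real.log (‖v j - v i‖ ^ 2)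

/-- The `j`-th component `∑_{i≠j} (v_i × v_j) / |v_j - v_i|²` of the vortex vector field. -/
noncomputable def vortexField {N : ℕ} (v : Fin N → E3) (j : Fin N) : E3 :=
  ∑ i ∈ Finset.univ.erase j, (‖v j - v i‖ ^ 2)⁻¹ • cross3 (v i) (v j)

/-- Configurations of `N` vortices on the unit sphere without collisions. -/
def IsCollisionFree {N : ℕ} (v : Fin N → E3) : Prop :=
  (∀ j, ‖v j‖ = 1) ∧ Function.Injective v

/-- Global, collision-free solutions of the vortex equations of motion on the sphere. -/
def IsVortexSolution {N : ℕ} (v : ℝ → Fin N → E3) : Prop :=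
  (∀ t, IsCollisionFree (v t)) ∧
    ∀ t j, HasDerivAt (fun s => v s j) (vortexField (v t) j) t

/-- Collision-free equilibria of the vortex equations of motion. -/
def IsVortexEquilibrium {N : ℕ} (v : Fin N → E3) : Prop :=
  IsCollisionFree v ∧ ∀ j, vortexField v j = 0

/-- `T` is the minimal (positive) period of `v`; in particular `v` is periodic and not constant. -/
def IsMinimalPeriod {X : Type*} (v : ℝ → X) (T : ℝ) : Prop :=
  0 < T ∧ Function.Periodic v T ∧ ∀ S, 0 < S → Function.Periodic v S → T ≤ S

/-! ### Symmetric configurations -/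

/-- The configuration `(g₁ u, …, g_m u, f₁, …, f_k)` attached to a point `u`, an ordering `g` of a
group `K` of rotations and an ordering `f` of a set `F`. -/
noncomputable def symConfig {m k : ℕ} {K : Subgroup SO3} {F : Set E3}
    (g : Fin m ≃ K) (f : Fin k ≃ F) (u : E3) : Fin (m + k) → E3 :=
  Fin.append (fun j => rot (g j) u) (fun j => (f j : E3))

/-- `v` is a family of periodic solutions of the vortex equations with one parameter ranging over
the set `I`: the parameter `h` is the energy, `T h` is the minimal period of `v h`, and `v h t`
depends continuously on `(h, t)`. -/
structure IsPeriodicFamily {N : ℕ} (I : Set ℝ) (v : ℝ → ℝ → Fin N → E3) (T : ℝ → ℝ) : Prop where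
  solution : ∀ h ∈ I, IsVortexSolution (v h)
  energy : ∀ h ∈ I, ∀ t, vortexEnergy (v h t) = h
  period : ∀ h ∈ I, IsMinimalPeriod (v h) (T h)
  continuous : ContinuousOn (fun p : ℝ × ℝ => v p.1 p.2) (I ×ˢ Set.univ)

/-- Over the time interval `[0, T]` the closed curve `c` winds `k` times, in the positive sense,
around the oriented axis spanned by the unit vector `p`: in a positively oriented orthonormal frame
`(e₁, e₂, p)` the projection of `c` to the plane of `e₁, e₂` avoids the origin, and its polar angle
increases by `2πk`. -/
def WindsAround (p : E3) (c : ℝ → E3) (T : ℝ) (k : ℤ) : Prop :=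
  ∃ e₁ e₂ : E3, ‖e₁‖ = 1 ∧ ‖e₂‖ = 1 ∧ inner ℝ e₁ e₂ = 0 ∧ cross3 e₁ e₂ = p ∧
    c T = c 0 ∧
    ∃ r φ : ℝ → ℝ, Continuous φ ∧
      (∀ t, 0 < r t ∧ inner ℝ e₁ (c t) = r t * Real.cos (φ t) ∧
        inner ℝ e₂ (c t) = r t * Real.sin (φ t)) ∧
      φ T - φ 0 = 2 * Real.pi * k

/-! ### The dihedral group and the poles -/

theorem rotZ_mem (θ : ℝ) :
    (!![Real.cos θ, -Real.sin θ, 0; Real.sin θ, Real.cos θ, 0; 0, 0, 1] :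
      Matrix (Fin 3) (Fin 3) ℝ) ∈ Matrix.specialOrthogonalGroup (Fin 3) ℝ := by
  rw [Matrix.mem_specialOrthogonalGroup_iff, Matrix.mem_orthogonalGroup_iff]
  have h := Real.sin_sq_add_cos_sq θ
  constructor
  · ext i j
    fin_cases i <;> fin_cases j <;>
      simp [Matrix.mul_apply, Fin.sum_univ_three] <;> nlinarith
  · simp [Matrix.det_fin_three]; nlinarith

theorem flipX_mem :
    (!![1, 0, 0; 0, -1, 0; 0, 0, -1] : Matrix (Fin 3) (Fin 3) ℝ) ∈
      Matrix.specialOrthogonalGroup (Fin 3) ℝ := by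
  rw [Matrix.mem_specialOrthogonalGroup_iff, Matrix.mem_orthogonalGroup_iff]
  constructor
  · ext i j
    fin_cases i <;> fin_cases j <;>
      simp [Matrix.mul_apply, Fin.sum_univ_three]
  · simp [Matrix.det_fin_three]

/-- The rotation by the angle `θ` around the third axis. -/
noncomputable def rotZ (θ : ℝ) : SO3 :=
  ⟨!![Real.cos θ, -Real.sin θ, 0; Real.sin θ, Real.cos θ, 0; 0, 0, 1], rotZ_mem θ⟩

/-- The rotation by the angle `π` around the first axis. -/
def flipX : SO3 := ⟨!![1, 0, 0; 0, -1, 0; 0, 0, -1], flipX_mem⟩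

/-- The dihedral group `𝔻ₙ < SO(3)`. -/
noncomputable def dihedral (n : ℕ) : Subgroup SO3 :=
  Subgroup.closure {rotZ (2 * Real.pi / n), flipX}

theorem rotZ_mul (a b : ℝ) : rotZ a * rotZ b = rotZ (a + b) := by
  apply Subtype.ext
  ext i j
  fin_cases i <;> fin_cases j <;>
    simp [rotZ, Real.cos_add, Real.sin_add] <;> ring

theorem rotZ_zero : rotZ 0 = 1 := by
  apply Subtype.ext
  ext i j
  fin_cases i <;> fin_cases j <;> simp [rotZ]

theorem rotZ_pow (a : ℝ) (k : ℕ) : rotZ a ^ k = rotZ (k * a) := by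
  induction k with
  | zero => simp [rotZ_zero]
  | succ k ih => rw [pow_succ, ih, rotZ_mul]; congr 1; push_cast; ring

theorem rotZ_two_pi : rotZ (2 * Real.pi) = 1 := by
  apply Subtype.ext
  ext i j
  fin_cases i <;> fin_cases j <;> simp [rotZ]

theorem flipX_mul_flipX : flipX * flipX = 1 := by
  apply Subtype.ext
  ext i j
  fin_cases i <;> fin_cases j <;> simp [flipX]

theorem rotZ_mul_flipX (a : ℝ) : rotZ a * flipX = flipX * (rotZ a)⁻¹ := by
  have h : rotZ a * flipX * rotZ a = flipX := by
    apply Subtype.ext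
    ext i j
    have := Real.sin_sq_add_cos_sq a
    fin_cases i <;> fin_cases j <;>
      simp [rotZ, flipX] <;> nlinarith
  exact eq_mul_inv_of_mul_eq h

/-- Every element of the dihedral group is `Aᵏ` or `B Aᵏ` with `k < n`. -/
theorem mem_dihedral_iff {n : ℕ} (hn : 0 < n) (x : SO3) :
    x ∈ dihedral n ↔ ∃ k < n, x = rotZ (2 * Real.pi / n) ^ k ∨
      x = flipX * rotZ (2 * Real.pi / n) ^ k := by
  set A : SO3 := rotZ (2 * Real.pi / n) with hA
  have hAn : A ^ n = 1 := by
    rw [hA, rotZ_pow, mul_div_cancel₀ _ (by positivity), rotZ_two_pi]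
  have hpow : ∀ m : ℤ, ∃ k < n, A ^ m = A ^ k := by
    intro m
    have hn' : (n : ℤ) ≠ 0 := by positivity
    refine ⟨(m % n).toNat, ?_, ?_⟩
    · have := Int.emod_lt_of_pos m (by positivity : (0 : ℤ) < n)
      have := Int.emod_nonneg m hn'
      omega
    · rw [← zpow_natCast, Int.toNat_of_nonneg (Int.emod_nonneg m hn')]
      conv_lhs => rw [← Int.mul_ediv_add_emod m n, zpow_add, zpow_mul, zpow_natCast, hAn, one_zpow,
        one_mul]
  have hconj : flipX * A * flipX⁻¹ = A⁻¹ := by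
    have h := rotZ_mul_flipX (2 * Real.pi / n)
    rw [← hA] at h
    have h2 : flipX⁻¹ = flipX := inv_eq_of_mul_eq_one_right flipX_mul_flipX
    rw [h2, mul_assoc, h, ← mul_assoc, flipX_mul_flipX, one_mul]
  have hcomm : ∀ m : ℤ, A ^ m * flipX = flipX * A ^ (-m) := by
    intro m
    have h3 : flipX * A ^ (-m) * flipX⁻¹ = A ^ m := by
      rw [← conj_zpow, hconj, inv_zpow, zpow_neg, inv_inv]
    rw [← h3]; group
  have key : ∀ y : SO3, y ∈ dihedral n ↔ ∃ m : ℤ, y = A ^ m ∨ y = flipX * A ^ m := by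
    intro y
    constructor
    · intro hy
      refine Subgroup.closure_induction (p := fun y _ => ∃ m : ℤ, y = A ^ m ∨ y = flipX * A ^ m)
        ?_ ?_ ?_ ?_ hy
      · rintro y (rfl | rfl)
        · exact ⟨1, Or.inl (by simp [hA])⟩
        · exact ⟨0, Or.inr (by simp)⟩
      · exact ⟨0, Or.inl (by simp)⟩
      · rintro y z _ _ ⟨m, rfl | rfl⟩ ⟨k, rfl | rfl⟩
        · exact ⟨m + k, Or.inl (zpow_add _ _ _).symm⟩
        · exact ⟨-m + k, Or.inr (by rw [← mul_assoc, hcomm, mul_assoc, zpow_add])⟩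
        · exact ⟨m + k, Or.inr (by rw [mul_assoc, zpow_add])⟩
        · refine ⟨-m + k, Or.inl ?_⟩
          rw [mul_assoc, ← mul_assoc (A ^ m), hcomm, ← mul_assoc, ← mul_assoc, flipX_mul_flipX,
            one_mul, zpow_add]
      · rintro y _ ⟨m, rfl | rfl⟩
        · exact ⟨-m, Or.inl (zpow_neg _ _).symm⟩
        · refine ⟨m, Or.inr ?_⟩
          rw [mul_inv_rev, ← zpow_neg, inv_eq_of_mul_eq_one_right flipX_mul_flipX, hcomm, neg_neg]
    · have hAm : A ∈ dihedral n := Subgroup.subset_closure (by simp [hA])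
      have hBm : flipX ∈ dihedral n := Subgroup.subset_closure (by simp)
      rintro ⟨m, rfl | rfl⟩
      · exact Subgroup.zpow_mem _ hAm m
      · exact Subgroup.mul_mem _ hBm (Subgroup.zpow_mem _ hAm m)
  rw [key]
  constructor
  · rintro ⟨m, h⟩
    obtain ⟨k, hk, hmk⟩ := hpow m
    exact ⟨k, hk, by rwa [hmk] at h⟩
  · rintro ⟨k, _, h⟩
    exact ⟨k, by simpa using h⟩

/-- The dihedral group `𝔻ₙ` has order `2n`, so it has orderings indexed by `Fin (2 * n)`. -/
theorem nonempty_dihedral_ordering {n : ℕ} (hn : 0 < n) :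
    Nonempty (Fin (2 * n) ≃ dihedral n) := by
  set A : SO3 := rotZ (2 * Real.pi / n) with hA
  have hinj : ∀ i < n, ∀ j < n, i ≤ j → A ^ i = A ^ j → i = j := by
    intro i hi j hj hij h
    have h1 : A ^ (j - i) = 1 := by
      have h3 : A ^ i * A ^ (j - i) = A ^ i * 1 := by
        rw [← pow_add, Nat.add_sub_cancel' hij, mul_one, h]
      exact mul_left_cancel h3
    have h2 : Real.cos (((j - i : ℕ) : ℝ) * (2 * Real.pi / n)) = 1 := by
      rw [hA, rotZ_pow] at h1
      have := congrArg (fun M : SO3 => (M : Matrix (Fin 3) (Fin 3) ℝ) 0 0) h1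
      simpa [rotZ] using this
    obtain ⟨m, hm⟩ := (Real.cos_eq_one_iff _).1 h2
    have hn0 : (n : ℝ) ≠ 0 := by positivity
    have h4 : (m : ℝ) * n = ((j - i : ℕ) : ℝ) := by
      have hpi := Real.pi_pos.ne'
      field_simp at hm
      linarith
    have h5 : m * n = ((j - i : ℕ) : ℤ) := by exact_mod_cast h4
    have h6 : (n : ℕ) ∣ (j - i) := by
      have : (n : ℤ) ∣ ((j - i : ℕ) : ℤ) := ⟨m, by rw [← h5]; ring⟩
      exact_mod_cast this
    have h7 := Nat.eq_zero_of_dvd_of_lt h6 (by omega)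
    omega
  have hinj' : ∀ i < n, ∀ j < n, A ^ i = A ^ j → i = j := by
    intro i hi j hj h
    rcases le_total i j with hij | hij
    · exact hinj i hi j hj hij h
    · exact (hinj j hj i hi hij h.symm).symm
  have hne : ∀ i j : ℕ, A ^ i ≠ flipX * A ^ j := by
    intro i j h
    rw [hA, rotZ_pow, rotZ_pow] at h
    have := congrArg (fun M : SO3 => (M : Matrix (Fin 3) (Fin 3) ℝ) 2 2) h
    simp [rotZ, flipX] at this
    linarith
  have hmem : ∀ p : Fin n ⊕ Fin n,
      Sum.elim (fun i : Fin n => A ^ (i : ℕ)) (fun i : Fin n => flipX * A ^ (i : ℕ)) p ∈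
        dihedral n := by
    rintro (i | i)
    · exact (mem_dihedral_iff hn _).2 ⟨i, i.2, Or.inl rfl⟩
    · exact (mem_dihedral_iff hn _).2 ⟨i, i.2, Or.inr rfl⟩
  have hbij : Function.Bijective (fun p : Fin n ⊕ Fin n => (⟨_, hmem p⟩ : dihedral n)) := by
    constructor
    · rintro (i | i) (j | j) h <;> simp only [Subtype.mk.injEq, Sum.elim_inl, Sum.elim_inr] at h
      · rw [Fin.ext (hinj' i i.2 j j.2 h)]
      · exact (hne _ _ h).elim
      · exact (hne _ _ h.symm).elim
      · rw [Fin.ext (hinj' i i.2 j j.2 (mul_left_cancel h))]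
    · rintro ⟨x, hx⟩
      obtain ⟨k, hk, h | h⟩ := (mem_dihedral_iff hn _).1 hx
      · exact ⟨Sum.inl ⟨k, hk⟩, Subtype.ext h.symm⟩
      · exact ⟨Sum.inr ⟨k, hk⟩, Subtype.ext h.symm⟩
  exact ⟨(finCongr (by omega)).trans (finSumFinEquiv.symm.trans (Equiv.ofBijective _ hbij))⟩

/-- The north pole `(0, 0, 1)`. -/
noncomputable def northPole : E3 := !₂[0, 0, 1]

/-- The set consisting of the two poles `(0, 0, ±1)`. -/
def poles : Set E3 := {northPole, -northPole}

/-- There are two poles, so they have orderings indexed by `Fin 2`. -/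
theorem nonempty_poles_ordering : Nonempty (Fin 2 ≃ poles) := by
  have hne : northPole ≠ -northPole := by
    intro h
    have := congrArg (fun x : E3 => x 2) h
    simp [northPole] at this
    linarith
  have h : Nat.card poles = 2 := by
    rw [Nat.card_coe_set_eq, poles, Set.ncard_pair hne]
  have : Finite poles := Nat.finite_of_card_ne_zero (by omega)
  exact ⟨(Finite.equivFinOfCardEq h).symm⟩

/-! ### Anti-prisms, equatorial polygons, cubes and icosahedra -/

/-- The polynomial `(3n+1) T_{2n} - n U_{2n} + 2n + 1`, where `T` and `U` are the Chebyshev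
polynomials of the first and second kind. -/
noncomputable def antiprismPoly (n : ℕ) : Polynomial ℝ :=
  Polynomial.C (3 * n + 1 : ℝ) * Polynomial.Chebyshev.T ℝ (2 * n : ℤ)
    - Polynomial.C (n : ℝ) * Polynomial.Chebyshev.U ℝ (2 * n : ℤ)
    + Polynomial.C (2 * n + 1 : ℝ)

/-- The point of the unit sphere at height `s z` and at longitude `(2k+1)π/(2n)`. -/
noncomputable def antiprismPoint (n : ℕ) (z s : ℝ) (k : ℕ) : E3 :=
  !₂[√(1 - z ^ 2) * Real.cos ((2 * k + 1) * Real.pi / (2 * n)),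
    √(1 - z ^ 2) * Real.sin ((2 * k + 1) * Real.pi / (2 * n)), s * z]

/-- The vertices of one of the two (according to the sign `s`) `n`-gon anti-prisms of height `2z`
inscribed in the sphere with vertices at the longitudes `(2k+1)π/(2n)`. -/
def antiprismVertices (n : ℕ) (z s : ℝ) : Set E3 :=
  {x | ∃ k : ℕ, k < 2 * n ∧ x = antiprismPoint n z (s * (-1) ^ k) k}

/-- The point of the equator at longitude `lπ/n`. -/
noncomputable def equatorPoint (n : ℕ) (l : ℕ) : E3 :=
  !₂[Real.cos (l * Real.pi / n), Real.sin (l * Real.pi / n), 0]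

/-- `S` is the vertex set of a cube inscribed in the unit sphere. -/
def IsCube (S : Set E3) : Prop :=
  ∃ b : OrthonormalBasis (Fin 3) ℝ E3, S = {x | ∀ i, |inner ℝ (b i) x| = 1 / √3}

/-- `S` is the vertex set of a regular icosahedron inscribed in the unit sphere: in some orthonormal
frame, `S` consists of the points whose coordinates are, up to a cyclic permutation,
`(0, ±1, ±φ) / √(1 + φ²)`, where `φ` is the golden ratio. -/
def IsIcosahedron (S : Set E3) : Prop :=
  ∃ b : OrthonormalBasis (Fin 3) ℝ E3, S = {x | ∃ i : Fin 3,
    inner ℝ (b i) x = 0 ∧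
    |inner ℝ (b (i + 1)) x| = 1 / √(1 + Real.goldenRatio ^ 2) ∧
    |inner ℝ (b (i + 2)) x| = Real.goldenRatio / √(1 + Real.goldenRatio ^ 2)}

/-! Reduction. The vortex equations are equivariant under rotations, so on configurations generated
by one point `u` the field at the `j`-th vortex is `g j` applied to a single tangent vector
`symField n u`, and the field at the poles vanishes by symmetry (`vortexField_symConfig_castAdd`,
`vortexField_symConfig_natAdd`). The problem becomes a planar system for `u` with the energy as
first integral. In Mercator coordinates (θ, s) the product formula `prod_cosh_sub_cos` evaluates all
sums over the group: the velocity is given by `lonSpeed` and `latSpeed` (`symField_merc`), and the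
energy is a decreasing affine function of log(D / cosh s ^ (4n+2)) with D = cosh 2ns − cos 2nθ
(`vortexEnergy_symConfig_merc`).

Local extrema. The quotient D / cosh s ^ (4n+2) has a local maximum at the anti-prism vertices and
tends to 0 at the equatorial collision points and at the poles. Explicit coordinates replace a Morse
lemma. Near a longitude θ₀ with cos 2nθ₀ = κ = ±1, put b = sin(n(θ − θ₀)) / cosh s ^ (2n+1); the
quotient becomes 2κb² + 2Q(s), where the variables are separated, and closedness of the level curves
reduces to a sign condition on the derivative of Q (`IsCell.isVortexChart`). Near the pole the
coordinates θ and r = exp(−s) suffice, because the radial derivative of the quotient is a positive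
multiple of the longitudinal velocity, which is positive there (`isVortexChart_northPole`).

Periodic motion. In both cases the level curves are graphs r = R(φ) over the circle of angles and
the angular velocity Ω is positive. The motion is then found by a quadrature: time is ∫ dφ / Ω, and
its inverse is continuous in the level (`IsPolarSystem.exists_periodic_motion`). The period is
minimal because the chart is injective modulo 2π in the angle, and it tends to 0 where Ω tends to
infinity, that is, at collisions (`IsVortexChart.exists_family`). Winding numbers follow from
comparing the projected curve with a direction that turns along with the chart angle
(`windsAround_of_pos`).

Anti-prism. For κ = −1 the critical latitudes off the equator solve n tanh(ns) = (2n+1) tanh s. As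
tanh(ns)/tanh s is strictly decreasing for s > 0, there is at most one positive solution, and one
exists for n ≥ 3 because n² > 2n+1. An identity for Chebyshev polynomials at cosh s turns this
equation into that of the polynomial (`antiprismPoly_eval_cosh`). For n = 3 and n = 5 the heights
are 1/3 and 1/√5; the points are checked to lie among the vertices of a cube or an icosahedron, and
counting gives equality. -/

set_option linter.unusedSimpArgs false

/-! ### Periodic orbits along star-shaped level curves -/

/-- At points on either side of the zero `g p₀` the function `F p₀` has strict signs; these persist
for nearby `p`, and monotonicity traps `g p` between the two points. It serves twice: for the radius
of a level curve and for the inverse of the time function. -/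
theorem continuousWithinAt_of_strictMonoOn_zero {P : Type*} [TopologicalSpace P] {s : Set P} {p₀ : P}
    (hp₀ : p₀ ∈ s) {I : Set ℝ} (hI : IsOpen I) {F : P → ℝ → ℝ} {g : P → ℝ}
    (hgI : ∀ p ∈ s, g p ∈ I) (hg : ∀ p ∈ s, F p (g p) = 0)
    (hmono : ∀ p ∈ s, StrictMonoOn (F p) I)
    (hc : ∀ y ∈ I, ContinuousWithinAt (fun p => F p y) s p₀) : ContinuousWithinAt g s p₀ := by
  have hnhds : I ∈ 𝓝 (g p₀) := hI.mem_nhds (hgI p₀ hp₀)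
  refine tendsto_order.2 ⟨fun a ha => ?_, fun a ha => ?_⟩
  · have h1 : ∀ᶠ y in 𝓝[<] (g p₀), y ∈ I ∧ a < y ∧ y < g p₀ := by
      filter_upwards [nhdsWithin_le_nhds hnhds, nhdsWithin_le_nhds (lt_mem_nhds ha),
        self_mem_nhdsWithin] with y h1 h2 h3 using ⟨h1, h2, h3⟩
    obtain ⟨y, hyI, hay, hy⟩ := h1.exists
    have h2 : F p₀ y < 0 := by
      rw [← hg p₀ hp₀]; exact hmono p₀ hp₀ hyI (hgI p₀ hp₀) hy
    filter_upwards [(hc y hyI).eventually (gt_mem_nhds h2), self_mem_nhdsWithin] with p hp hps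
    rw [← hg p hps] at hp
    exact hay.trans (((hmono p hps).lt_iff_lt hyI (hgI p hps)).1 hp)
  · have h1 : ∀ᶠ y in 𝓝[>] (g p₀), y ∈ I ∧ y < a ∧ g p₀ < y := by
      filter_upwards [nhdsWithin_le_nhds hnhds, nhdsWithin_le_nhds (gt_mem_nhds ha),
        self_mem_nhdsWithin] with y h1 h2 h3 using ⟨h1, h2, h3⟩
    obtain ⟨y, hyI, hay, hy⟩ := h1.exists
    have h2 : 0 < F p₀ y := by
      rw [← hg p₀ hp₀]; exact hmono p₀ hp₀ (hgI p₀ hp₀) hyI hy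
    filter_upwards [(hc y hyI).eventually (lt_mem_nhds h2), self_mem_nhdsWithin] with p hp hps
    rw [← hg p hps] at hp
    exact (((hmono p hps).lt_iff_lt (hgI p hps) hyI).1 hp).trans hay

/-- A positive function `K φ ρ` in polar coordinates on a punctured disc of radius `δ`, increasing
in the radius and vanishing at the centre, with its partial derivatives, and a positive angular
velocity `Ω`. -/
structure IsPolarSystem (δ : ℝ) (K Kφ Kρ Ω : ℝ → ℝ → ℝ) : Prop where
  radius_pos : 0 < δ
  hasFDerivAt : ∀ a, ∀ r ∈ Ioo 0 δ, HasFDerivAt (fun p : ℝ × ℝ => K p.1 p.2)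
    (Kφ a r • ContinuousLinearMap.fst ℝ ℝ ℝ + Kρ a r • ContinuousLinearMap.snd ℝ ℝ ℝ) (a, r)
  radial_pos : ∀ a, ∀ r ∈ Ioo 0 δ, 0 < Kρ a r
  pos : ∀ a, ∀ r ∈ Ioo 0 δ, 0 < K a r
  small : ∀ ε > 0, ∃ r ∈ Ioo 0 δ, ∀ a, K a r < ε
  periodic : ∀ a r, K (a + 2 * Real.pi) r = K a r
  speed_cont : ContinuousOn (fun p : ℝ × ℝ => Ω p.1 p.2) (univ ×ˢ Ioo 0 δ)
  speed_pos : ∀ a, ∀ r ∈ Ioo 0 δ, 0 < Ω a r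
  speed_periodic : ∀ a r, Ω (a + 2 * Real.pi) r = Ω a r

namespace IsPolarSystem

variable {δ : ℝ} {K Kφ Kρ Ω : ℝ → ℝ → ℝ}

theorem continuousAt (hK : IsPolarSystem δ K Kφ Kρ Ω) (a : ℝ) {r : ℝ} (hr : r ∈ Ioo 0 δ) :
    ContinuousAt (fun p : ℝ × ℝ => K p.1 p.2) (a, r) :=
  (hK.hasFDerivAt a r hr).continuousAt

theorem hasDerivAt_radius (hK : IsPolarSystem δ K Kφ Kρ Ω) (a : ℝ) {r : ℝ} (hr : r ∈ Ioo 0 δ) :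
    HasDerivAt (fun r => K a r) (Kρ a r) r := by
  have h := (hK.hasFDerivAt a r hr).comp_hasDerivAt r
    ((hasDerivAt_const r a).prodMk (hasDerivAt_id r))
  simpa [Function.comp_def] using h

theorem strictMonoOn (hK : IsPolarSystem δ K Kφ Kρ Ω) (a : ℝ) :
    StrictMonoOn (fun r => K a r) (Ioo 0 δ) := by
  refine strictMonoOn_of_deriv_pos (convex_Ioo _ _)
    (fun r hr => (hK.hasDerivAt_radius a hr).continuousAt.continuousWithinAt) fun r hr => ?_
  rw [interior_Ioo] at hr
  rw [(hK.hasDerivAt_radius a hr).deriv]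
  exact hK.radial_pos a r hr

/-- Compactness of the circle of angles makes the bound uniform: levels below `κ` are met inside
radius `r` in every direction. -/
theorem exists_lower_bound (hK : IsPolarSystem δ K Kφ Kρ Ω) {r : ℝ} (hr : r ∈ Ioo 0 δ) :
    ∃ κ > 0, ∀ a, κ ≤ K a r := by
  have hc : Continuous fun a => K a r := continuous_iff_continuousAt.2 fun a =>
    ContinuousAt.comp (f := fun a : ℝ => (a, r)) (hK.continuousAt a hr) (by fun_prop)
  obtain ⟨a₀, -, ha₀⟩ := isCompact_Icc.exists_isMinOn
    (nonempty_Icc.2 (by positivity : (0 : ℝ) ≤ 2 * Real.pi)) hc.continuousOn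
  refine ⟨K a₀ r, hK.pos a₀ r hr, fun a => ?_⟩
  obtain ⟨b, hb, hab⟩ := Function.Periodic.exists_mem_Ico₀ (f := fun a => K a r)
    (fun a => hK.periodic a r) Real.two_pi_pos a
  have h := ha₀ (Ico_subset_Icc_self hb)
  simp only [mem_ofPred_eq] at h
  rw [show K a r = K b r from hab]
  exact h

theorem exists_levelRadius (hK : IsPolarSystem δ K Kφ Kρ Ω) :
    ∃ k₁ > 0, ∃ R : ℝ → ℝ → ℝ,
      (∀ a, ∀ k ∈ Ioo 0 k₁, R a k ∈ Ioo 0 δ ∧ K a (R a k) = k) ∧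
      (∀ ε > 0, ∃ k₂ > 0, ∀ a, ∀ k ∈ Ioo 0 k₁, k < k₂ → R a k < ε) := by
  have hδ := hK.radius_pos
  have hmem : δ / 2 ∈ Ioo 0 δ := ⟨by linarith, by linarith⟩
  obtain ⟨k₁, hk₁, hlow⟩ := hK.exists_lower_bound hmem
  have hex : ∀ a, ∀ k ∈ Ioo 0 k₁, ∃ r ∈ Ioo 0 δ, K a r = k := by
    intro a k hk
    obtain ⟨r₀, hr₀, hr₀k⟩ := hK.small k hk.1
    have hcont : ContinuousOn (fun r => K a r) (Ioo 0 δ) := fun r hr =>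
      (hK.hasDerivAt_radius a hr).continuousAt.continuousWithinAt
    have himg := isPreconnected_Ioo.intermediate_value hr₀ hmem hcont
    exact himg ⟨(hr₀k a).le, hk.2.le.trans (hlow a)⟩
  choose! R hR using hex
  refine ⟨k₁, hk₁, R, fun a k hk => hR a k hk, fun ε hε => ?_⟩
  have hm : min (δ / 2) ε ∈ Ioo 0 δ :=
    ⟨lt_min hmem.1 hε, (min_le_left _ _).trans_lt hmem.2⟩
  obtain ⟨k₂, hk₂, hlow₂⟩ := hK.exists_lower_bound hm
  refine ⟨k₂, hk₂, fun a k hk hkk => ?_⟩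
  have h1 : K a (R a k) < K a (min (δ / 2) ε) := by
    rw [(hR a k hk).2]; exact hkk.trans_le (hlow₂ a)
  exact (((hK.strictMonoOn a).lt_iff_lt (hR a k hk).1 hm).1 h1).trans_le (min_le_right _ _)

theorem eq_of_level (hK : IsPolarSystem δ K Kφ Kρ Ω) {a r r' : ℝ} (hr : r ∈ Ioo 0 δ)
    (hr' : r' ∈ Ioo 0 δ) (h : K a r = K a r') : r = r' :=
  (hK.strictMonoOn a).injOn hr hr' h

/-- Implicit differentiation of `K a (R a) = k`. Since `K` is only assumed Fréchet differentiable at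
each point, not C¹, the derivative is extracted from the first-order expansion of `K` together with
the continuity of `R`. -/
theorem hasDerivAt_levelRadius (hK : IsPolarSystem δ K Kφ Kρ Ω) {k : ℝ} {R : ℝ → ℝ}
    (hR : ∀ a, R a ∈ Ioo 0 δ) (hRk : ∀ a, K a (R a) = k) (hc : Continuous R) (a : ℝ) :
    HasDerivAt R (-(Kφ a (R a) / Kρ a (R a))) a := by
  have hpos := (hK.radial_pos a (R a) (hR a)).ne'
  set p := Kφ a (R a)
  set q := Kρ a (R a)
  have hF := hK.hasFDerivAt a (R a) (hR a)
  have hlittle := (hasFDerivAt_iff_isLittleO_nhds_zero.1 hF)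
  have hinner : Tendsto (fun x => (x, R (a + x) - R a)) (𝓝 0) (𝓝 (0 : ℝ × ℝ)) := by
    have : ContinuousAt (fun x => (x, R (a + x) - R a)) (0 : ℝ) := by fun_prop
    rw [show (0 : ℝ × ℝ) = (0, R (a + 0) - R a) by simp [Prod.zero_eq_mk]]
    exact this.tendsto
  have h1 := hlittle.comp_tendsto hinner
  have h2 : (fun x => p * x + q * (R (a + x) - R a)) =o[𝓝 0]
      (fun x => (x, R (a + x) - R a)) := by
    refine (h1.neg_left).congr_left fun x => ?_
    simp only [Function.comp, Prod.mk_add_mk, add_sub_cancel, hRk]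
    simp [p, q]
  rw [hasDerivAt_iff_isLittleO_nhds_zero]
  set d := fun x => R (a + x) - R a + p / q * x
  have h3 : d =o[𝓝 0] (fun x => (x, R (a + x) - R a)) := by
    refine (h2.const_mul_left q⁻¹).congr_left fun x => ?_
    simp only [d]; field_simp; ring
  have h4 : (fun x => ((x, R (a + x) - R a) : ℝ × ℝ)) =O[𝓝 0] (fun x : ℝ => (x, d x)) := by
    refine Asymptotics.IsBigO.prod_left Asymptotics.isBigO_fst_prod ?_
    have : (fun x => R (a + x) - R a) = fun x => d x - p / q * x := by
      funext x; simp [d]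
    rw [this]
    exact Asymptotics.isBigO_snd_prod.sub
      (Asymptotics.isBigO_fst_prod (f' := fun x : ℝ => x) |>.const_mul_left _)
  have h5 : d =o[𝓝 0] (fun x : ℝ => (x, d x)) := h3.trans_isBigO h4
  -- The remainder `d` is small relative to the pair `(x, d x)`; with the constant 1/2 this forces
  -- `‖d x‖ ≤ ‖x‖`, so the pair is controlled by `x` alone.
  have h6 : (fun x : ℝ => (x, d x)) =O[𝓝 0] (fun x : ℝ => x) := by
    refine Asymptotics.IsBigO.of_bound 1 ?_
    filter_upwards [h5.bound (by norm_num : (0 : ℝ) < 1 / 2)] with x hx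
    rw [Prod.norm_mk] at hx ⊢
    rcases le_total ‖x‖ ‖d x‖ with h | h
    · rw [max_eq_right h] at hx ⊢
      have := norm_nonneg (d x)
      have := norm_nonneg x
      linarith
    · rw [max_eq_left h, one_mul]
  refine (h5.trans_isBigO h6).congr_left fun x => ?_
  simp only [d, smul_eq_mul]; ring

/-- The level curves of a polar system carry periodic motions of angular velocity `Ω`, depending
continuously on the level, which sweep out the whole level curve. -/
theorem exists_periodic_motion (hK : IsPolarSystem δ K Kφ Kρ Ω) :
    ∃ k₁ > 0, ∃ (φ ρ : ℝ → ℝ → ℝ) (T : ℝ → ℝ),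
      (∀ k ∈ Ioo 0 k₁, 0 < T k ∧ StrictMono (φ k) ∧ (∀ t, φ k (t + T k) = φ k t + 2 * Real.pi) ∧
        (∀ t, ρ k (t + T k) = ρ k t) ∧
        (∀ t, ρ k t ∈ Ioo 0 δ ∧ K (φ k t) (ρ k t) = k ∧ HasDerivAt (φ k) (Ω (φ k t) (ρ k t)) t ∧
          HasDerivAt (ρ k)
            (-(Kφ (φ k t) (ρ k t) / Kρ (φ k t) (ρ k t)) * Ω (φ k t) (ρ k t)) t) ∧
        (∀ a, ∀ r ∈ Ioo 0 δ, K a r = k → ∃ t, φ k t = a ∧ ρ k t = r)) ∧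
      ContinuousOn (fun p : ℝ × ℝ => φ p.1 p.2) (Ioo 0 k₁ ×ˢ univ) ∧
      ContinuousOn (fun p : ℝ × ℝ => ρ p.1 p.2) (Ioo 0 k₁ ×ˢ univ) ∧
      (∀ ε > 0, ∃ k₂ > 0, ∀ k ∈ Ioo 0 k₁, k < k₂ → ∀ t, ρ k t < ε) ∧
      ((∀ M > 0, ∃ ε > 0, ∀ a, ∀ r ∈ Ioo 0 δ, r < ε → M ≤ Ω a r) → Tendsto T (𝓝[>] 0) (𝓝 0)) := by
  obtain ⟨k₁, hk₁, R, hR, hsmall⟩ := hK.exists_levelRadius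
  have hRc : ContinuousOn (fun p : ℝ × ℝ => R p.1 p.2) (univ ×ˢ Ioo 0 k₁) := by
    intro p₀ hp₀
    refine continuousWithinAt_of_strictMonoOn_zero (I := Ioo 0 δ)
      (F := fun p y => K p.1 y - p.2) hp₀ isOpen_Ioo (fun p hp => (hR p.1 p.2 hp.2).1)
      (fun p hp => by simp [(hR p.1 p.2 hp.2).2]) (fun p hp => ?_) fun y hy => ?_
    · exact fun x hx y hy hxy => sub_lt_sub_right (hK.strictMonoOn p.1 hx hy hxy) _
    · refine ContinuousAt.continuousWithinAt (ContinuousAt.sub ?_ continuousAt_snd)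
      exact ContinuousAt.comp (f := fun p : ℝ × ℝ => (p.1, y)) (hK.continuousAt p₀.1 hy)
        (by fun_prop)
  let X := Ioo (0 : ℝ) k₁
  have hRX : Continuous fun p : X × ℝ => R p.2 p.1 := by
    have := hRc.comp_continuous (f := fun p : X × ℝ => (p.2, (p.1 : ℝ))) (by fun_prop)
      (fun p => ⟨mem_univ _, p.1.2⟩)
    exact this
  let W : X → ℝ → ℝ := fun k a => Ω a (R a k)
  have hW : Continuous (Function.uncurry W) :=
    hK.speed_cont.comp_continuous (f := fun p : X × ℝ => (p.2, R p.2 p.1))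
      (continuous_snd.prodMk hRX)
      (fun p => ⟨mem_univ _, (hR p.2 p.1 p.1.2).1⟩)
  have hWpos : ∀ k a, 0 < W k a := fun k a => hK.speed_pos _ _ (hR a k k.2).1
  have hRper : ∀ (k : X) a, R (a + 2 * Real.pi) k = R a k := fun k a =>
    hK.eq_of_level (hR _ k k.2).1 (hR a k k.2).1 (by
      rw [← hK.periodic a, (hR _ k k.2).2, (hR _ k k.2).2])
  have hWper : ∀ k, Function.Periodic (fun a => (W k a)⁻¹) (2 * Real.pi) := fun k a => by
    simp only [W, hRper, hK.speed_periodic]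
  let f : X → ℝ → ℝ := fun k a => (W k a)⁻¹
  have hf : Continuous (Function.uncurry f) := hW.inv₀ fun p => (hWpos p.1 p.2).ne'
  have hfk : ∀ k, Continuous (f k) := fun k => hf.comp (by fun_prop : Continuous fun a => (k, a))
  have hWk : ∀ k, Continuous (W k) := fun k => hW.comp (by fun_prop : Continuous fun a => (k, a))
  -- `τ k a` is the time taken to go from angle 0 to angle `a` along level `k`. Its inverse `Φ k` is
  -- the angle as a function of time, and `τ k (2π)` is the period.
  let τ : X → ℝ → ℝ := fun k a => ∫ x in (0 : ℝ)..a, f k x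
  have hτ : Continuous fun p : X × ℝ => τ p.1 p.2 :=
    intervalIntegral.continuous_parametric_intervalIntegral_of_continuous
      (f := fun (p : X × ℝ) x => f p.1 x) (s := fun p : X × ℝ => p.2)
      (hf.comp (by fun_prop : Continuous fun q : (X × ℝ) × ℝ => (q.1.1, q.2))) continuous_snd
  have hτd : ∀ k a, HasDerivAt (τ k) (W k a)⁻¹ a := fun k a =>
    ((hfk k).integral_hasStrictDerivAt 0 a).hasDerivAt
  have hτmono : ∀ k, StrictMono (τ k) := fun k => strictMono_of_deriv_pos fun a => by
    rw [(hτd k a).deriv]; exact inv_pos.2 (hWpos k a)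
  have hτk : ∀ k, Continuous (τ k) := fun k =>
    hτ.comp (by fun_prop : Continuous fun a => (k, a))
  have hint : ∀ k a b, IntervalIntegrable (f k) MeasureTheory.volume a b := fun k a b =>
    (hfk k).intervalIntegrable a b
  have hτsurj : ∀ k, Function.Surjective (τ k) := fun k => by
    refine (hτk k).surjective ?_ ?_
    · exact (hWper k).tendsto_atTop_intervalIntegral_of_pos' (hint k _ _)
        (fun a => inv_pos.2 (hWpos k a)) Real.two_pi_pos
    · exact (hWper k).tendsto_atBot_intervalIntegral_of_pos' (hint k _ _)
        (fun a => inv_pos.2 (hWpos k a)) Real.two_pi_pos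
  have hτper : ∀ k a, τ k (a + 2 * Real.pi) = τ k a + τ k (2 * Real.pi) := fun k a => by
    have h1 := (hWper k).intervalIntegral_add_eq a 0
    have h2 := intervalIntegral.integral_add_adjacent_intervals (hint k 0 a)
      (hint k a (a + 2 * Real.pi))
    simp only [zero_add] at h1
    simp only [τ]
    rw [← h2, ← h1]
  have hτ0 : ∀ k, τ k 0 = 0 := fun k => intervalIntegral.integral_same
  choose Φ hΦ using hτsurj
  have hΦτ : ∀ k a, Φ k (τ k a) = a := fun k a => (hτmono k).injective (hΦ k _)
  have hΦc : Continuous fun p : X × ℝ => Φ p.1 p.2 := by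
    rw [← continuousOn_univ]
    intro p₀ hp₀
    refine continuousWithinAt_of_strictMonoOn_zero (I := univ)
      (F := fun p y => τ p.1 y - p.2) hp₀ isOpen_univ (fun p hp => mem_univ _)
      (fun p hp => by simp [hΦ]) (fun p hp => ?_) fun y hy => ?_
    · exact fun x hx y hy hxy => sub_lt_sub_right (hτmono p.1 hxy) _
    · refine Continuous.continuousWithinAt (Continuous.sub ?_ continuous_snd)
      exact hτ.comp (by fun_prop : Continuous fun p : X × ℝ => (p.1, y))
  have hΦk : ∀ k, Continuous (Φ k) := fun k =>
    hΦc.comp (by fun_prop : Continuous fun a => (k, a))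
  have hΦmono : ∀ k, StrictMono (Φ k) := fun k a b hab => by
    rw [← (hτmono k).lt_iff_lt, hΦ, hΦ]; exact hab
  have hΦd : ∀ k t, HasDerivAt (Φ k) (W k (Φ k t)) t := fun k t => by
    have := HasDerivAt.of_local_left_inverse (hΦk k).continuousAt (hτd k (Φ k t))
      (inv_pos.2 (hWpos k _)).ne' (Eventually.of_forall fun y => hΦ k y)
    rwa [inv_inv] at this
  have hΦper : ∀ k t, Φ k (t + τ k (2 * Real.pi)) = Φ k t + 2 * Real.pi := fun k t =>
    (hτmono k).injective (by rw [hΦ, hτper, hΦ])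
  classical
  -- Outside `(0, k₁)` the value 0 is a mere default; all assertions concern levels in `(0, k₁)`.
  let φ : ℝ → ℝ → ℝ := fun k t => if h : k ∈ X then Φ ⟨k, h⟩ t else 0
  let T : ℝ → ℝ := fun k => if h : k ∈ X then τ ⟨k, h⟩ (2 * Real.pi) else 0
  let ρ : ℝ → ℝ → ℝ := fun k t => R (φ k t) k
  have hφ : ∀ (k) (h : k ∈ X), φ k = Φ ⟨k, h⟩ := fun k h => by funext t; simp only [φ, dif_pos h]
  have hT : ∀ (k) (h : k ∈ X), T k = τ ⟨k, h⟩ (2 * Real.pi) := fun k h => by simp only [T, dif_pos h]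
  have hφc : ContinuousOn (fun p : ℝ × ℝ => φ p.1 p.2) (Ioo 0 k₁ ×ˢ univ) := by
    rw [continuousOn_iff_continuous_domRestrict]
    have : (Ioo 0 k₁ ×ˢ univ).domRestrict (fun p : ℝ × ℝ => φ p.1 p.2) =
        fun p : (Ioo (0 : ℝ) k₁ ×ˢ (univ : Set ℝ) : Set (ℝ × ℝ)) =>
          Φ ⟨p.1.1, p.2.1⟩ p.1.2 := by
      funext p; rw [Set.domRestrict_apply, hφ p.1.1 p.2.1]
    rw [this]
    exact hΦc.comp (f := fun p : (Ioo (0 : ℝ) k₁ ×ˢ (univ : Set ℝ) : Set (ℝ × ℝ)) =>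
      ((⟨p.1.1, p.2.1⟩ : X), p.1.2)) (by fun_prop)
  refine ⟨k₁, hk₁, φ, ρ, T, fun k hk => ?_, hφc, ?_, fun ε hε => ?_, fun hΩ => ?_⟩
  · have hRk : ∀ a, R a k ∈ Ioo 0 δ := fun a => (hR a k hk).1
    refine ⟨?_, ?_, ?_, ?_, fun t => ⟨hRk _, (hR _ k hk).2, ?_, ?_⟩, ?_⟩
    · rw [hT k hk, ← hτ0 ⟨k, hk⟩]; exact hτmono _ Real.two_pi_pos
    · rw [hφ k hk]; exact hΦmono _
    · intro t; rw [hφ k hk, hT k hk]; exact hΦper _ t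
    · intro t
      simp only [ρ]
      rw [hφ k hk, hT k hk, hΦper, hRper ⟨k, hk⟩]
    · simp only [ρ]; rw [hφ k hk]; exact hΦd ⟨k, hk⟩ t
    · have h1 := hK.hasDerivAt_levelRadius (R := fun a => R a k) hRk (fun a => (hR a k hk).2)
        (hRX.comp (by fun_prop : Continuous fun a => ((⟨k, hk⟩ : X), a))) (φ k t)
      have h2 : HasDerivAt (φ k) (Ω (φ k t) (ρ k t)) t := by
        simp only [ρ]; rw [hφ k hk]; exact hΦd ⟨k, hk⟩ t
      exact h1.comp t h2
    · intro a r hr har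
      refine ⟨τ ⟨k, hk⟩ a, ?_, ?_⟩
      · rw [hφ k hk, hΦτ]
      · simp only [ρ]
        rw [hφ k hk, hΦτ]
        exact hK.eq_of_level (hRk a) hr (by rw [(hR a k hk).2, har])
  · exact hRc.comp (f := fun p : ℝ × ℝ => (φ p.1 p.2, p.1)) (hφc.prodMk continuousOn_fst)
      fun p hp => ⟨mem_univ _, hp.1⟩
  · obtain ⟨k₂, hk₂, h⟩ := hsmall ε hε
    exact ⟨k₂, hk₂, fun k hk hkk t => h _ k hk hkk⟩
  · rw [Metric.tendsto_nhds]
    intro ε hε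
    -- An angular velocity of at least 4π/ε gives a period of at most 2π · ε/(4π) = ε/2.
    obtain ⟨ε', hε', hM⟩ := hΩ (4 * Real.pi / ε) (by positivity)
    obtain ⟨k₂, hk₂, hk⟩ := hsmall ε' hε'
    filter_upwards [Ioo_mem_nhdsGT (lt_min hk₁ hk₂)] with k hkk
    have hkX : k ∈ X := ⟨hkk.1, hkk.2.trans_le (min_le_left _ _)⟩
    have hT0 : 0 < T k := by
      rw [hT k hkX, ← hτ0 ⟨k, hkX⟩]; exact hτmono _ Real.two_pi_pos
    have hT1 : T k ≤ ε / 2 := by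
      rw [hT k hkX]
      have hle : ∀ x ∈ Icc 0 (2 * Real.pi), f ⟨k, hkX⟩ x ≤ ε / (4 * Real.pi) := fun x _ => by
        have h1 := hM x (R x k) (hR x k hkX).1
          (hk x k hkX (hkk.2.trans_le (min_le_right _ _)))
        have h2 := inv_anti₀ (by positivity) h1
        rwa [inv_div] at h2
      have h3 := intervalIntegral.integral_mono_on Real.two_pi_pos.le (hint ⟨k, hkX⟩ _ _)
        (intervalIntegrable_const (μ := MeasureTheory.volume)) hle
      refine h3.trans (le_of_eq ?_)
      rw [intervalIntegral.integral_const]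
      have := Real.pi_pos
      simp only [sub_zero, smul_eq_mul]; field_simp; ring
    rw [Real.dist_eq, sub_zero, abs_of_pos hT0]
    linarith

end IsPolarSystem

/-! ### Rotations -/

/-- The action of a rotation, as a linear map. -/
noncomputable def rotLin (g : SO3) : E3 →L[ℝ] E3 :=
  LinearMap.toContinuousLinearMap
    { toFun := rot g
      map_add' := fun u v => by ext i; simp [rot, Matrix.mulVec_add]
      map_smul' := fun c u => by ext i; simp [rot, Matrix.mulVec_smul] }

@[simp] theorem rotLin_apply (g : SO3) (u : E3) : rotLin g u = rot g u := rfl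

theorem rot_mul (g h : SO3) (u : E3) : rot (g * h) u = rot g (rot h u) := by
  ext i; simp [rot, Matrix.mulVec_mulVec]

theorem rot_one (u : E3) : rot 1 u = u := by
  ext i; simp [rot]

theorem rot_inv_rot (g : SO3) (u : E3) : rot g⁻¹ (rot g u) = u := by
  rw [← rot_mul, inv_mul_cancel, rot_one]

theorem rot_injective (g : SO3) : Function.Injective (rot g) := fun u v h => by
  rw [← rot_inv_rot g u, h, rot_inv_rot]

theorem inner_rot (g : SO3) (u v : E3) : inner ℝ (rot g u) (rot g v) = inner ℝ u v := by
  have hg := g.2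
  rw [Matrix.mem_specialOrthogonalGroup_iff, Matrix.mem_orthogonalGroup_iff'] at hg
  simp only [EuclideanSpace.inner_eq_star_dotProduct, rot, star_trivial]
  rw [Matrix.dotProduct_mulVec, Matrix.vecMul_mulVec, ← Matrix.dotProduct_mulVec]
  have h1 := hg.1
  rw [h1, Matrix.one_mulVec]

theorem norm_rot (g : SO3) (u : E3) : ‖rot g u‖ = ‖u‖ := by
  rw [@norm_eq_sqrt_real_inner _ _ _ (rot g u), inner_rot, ← norm_eq_sqrt_real_inner]

theorem norm_rot_sub (g : SO3) (u v : E3) : ‖rot g u - rot g v‖ = ‖u - v‖ := by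
  rw [← rotLin_apply, ← rotLin_apply, ← map_sub, rotLin_apply, norm_rot]

/-- For an orthogonal matrix of determinant 1 the adjugate, the inverse and the transpose agree.
Entrywise, every entry equals its own cofactor, which is what equivariance of the vector product
needs. -/
theorem adjugate_rot (g : SO3) : (g : Matrix (Fin 3) (Fin 3) ℝ).adjugate =
    (g : Matrix (Fin 3) (Fin 3) ℝ)ᵀ := by
  have hg := g.2
  rw [Matrix.mem_specialOrthogonalGroup_iff, Matrix.mem_orthogonalGroup_iff'] at hg
  obtain ⟨h1, h2⟩ := hg
  have h3 := Matrix.mul_adjugate (g : Matrix (Fin 3) (Fin 3) ℝ)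
  rw [h2, one_smul] at h3
  calc (g : Matrix (Fin 3) (Fin 3) ℝ).adjugate
      = ((g : Matrix (Fin 3) (Fin 3) ℝ)ᵀ * g) * (g : Matrix (Fin 3) (Fin 3) ℝ).adjugate := by
        rw [h1, one_mul]
    _ = _ := by rw [Matrix.mul_assoc, h3, mul_one]

theorem cross3_rot (g : SO3) (u v : E3) : cross3 (rot g u) (rot g v) = rot g (cross3 u v) := by
  have h := adjugate_rot g
  rw [Matrix.adjugate_fin_three] at h
  have e := fun i j => congrFun (congrFun h i) j
  have e00 := e 0 0
  have e01 := e 0 1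
  have e02 := e 0 2
  have e10 := e 1 0
  have e11 := e 1 1
  have e12 := e 1 2
  have e20 := e 2 0
  have e21 := e 2 1
  have e22 := e 2 2
  simp [Matrix.transpose_apply] at e00 e01 e02 e10 e11 e12 e20 e21 e22
  ext i
  fin_cases i <;>
    simp [cross3, rot, crossProduct, Matrix.mulVec, dotProduct, Fin.sum_univ_three]
  · linear_combination (u 1 * v 2 - u 2 * v 1) * e00 + (u 2 * v 0 - u 0 * v 2) * e10 +
      (u 0 * v 1 - u 1 * v 0) * e20
  · linear_combination (u 1 * v 2 - u 2 * v 1) * e01 + (u 2 * v 0 - u 0 * v 2) * e11 +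
      (u 0 * v 1 - u 1 * v 0) * e21
  · linear_combination (u 1 * v 2 - u 2 * v 1) * e02 + (u 2 * v 0 - u 0 * v 2) * e12 +
      (u 0 * v 1 - u 1 * v 0) * e22

/-! ### Mercator coordinates -/

/-- The point of the sphere with longitude `θ` and Mercator latitude `s`. -/
noncomputable def merc (θ s : ℝ) : E3 :=
  !₂[Real.cos θ / Real.cosh s, Real.sin θ / Real.cosh s, Real.sinh s / Real.cosh s]

theorem rot_rotZ_merc (a θ s : ℝ) : rot (rotZ a) (merc θ s) = merc (θ + a) s := by
  ext i
  fin_cases i <;>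
    simp [rot, rotZ, merc, Matrix.mulVec, dotProduct, Fin.sum_univ_three, Real.cos_add,
      Real.sin_add] <;> ring

theorem rot_flipX_merc (θ s : ℝ) : rot flipX (merc θ s) = merc (-θ) (-s) := by
  ext i
  fin_cases i <;>
    simp [rot, flipX, merc, Matrix.mulVec, dotProduct, Fin.sum_univ_three] <;> ring

theorem rot_rotZ_northPole (a : ℝ) : rot (rotZ a) northPole = northPole := by
  ext i
  fin_cases i <;>
    simp [rot, rotZ, northPole, Matrix.mulVec, dotProduct, Fin.sum_univ_three]

theorem rot_flipX_northPole : rot flipX northPole = -northPole := by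
  ext i
  fin_cases i <;>
    simp [rot, flipX, northPole, Matrix.mulVec, dotProduct, Fin.sum_univ_three]

theorem norm_sq_eq_sum (u : E3) : ‖u‖ ^ 2 = u 0 ^ 2 + u 1 ^ 2 + u 2 ^ 2 := by
  rw [EuclideanSpace.norm_sq_eq, Fin.sum_univ_three]
  simp [sq_abs]

/-- This factorization is the reason for Mercator coordinates: products of squared distances over a
rotation orbit become products of `cosh - cos`, which `prod_cosh_sub_cos` evaluates. -/
theorem norm_merc_sub_sq (θ s θ' s' : ℝ) : ‖merc θ s - merc θ' s'‖ ^ 2 =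
    2 * (Real.cosh (s - s') - Real.cos (θ - θ')) / (Real.cosh s * Real.cosh s') := by
  have h1 := Real.cosh_pos s
  have h2 := Real.cosh_pos s'
  rw [norm_sq_eq_sum]
  simp only [merc, PiLp.sub_apply, Matrix.cons_val, Matrix.cons_val_zero, Matrix.cons_val_one]
  rw [Real.cosh_sub, Real.cos_sub]
  field_simp
  have e1 := Real.sin_sq_add_cos_sq θ
  have e2 := Real.sin_sq_add_cos_sq θ'
  have e3 := Real.cosh_sq s
  have e4 := Real.cosh_sq s'
  linear_combination (Real.cosh s') ^ 2 * e1 + (Real.cosh s) ^ 2 * e2 -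
    (Real.cosh s') ^ 2 * e3 - Real.cosh s ^ 2 * e4

theorem norm_merc (θ s : ℝ) : ‖merc θ s‖ = 1 := by
  have h1 := Real.cosh_pos s
  have h : ‖merc θ s‖ ^ 2 = 1 := by
    rw [norm_sq_eq_sum]
    simp only [merc, Matrix.cons_val, Matrix.cons_val_zero, Matrix.cons_val_one]
    field_simp
    linear_combination Real.sin_sq_add_cos_sq θ - Real.cosh_sq s
  nlinarith [norm_nonneg (merc θ s)]

theorem norm_merc_sub_northPole_sq (θ s : ℝ) :
    ‖merc θ s - northPole‖ ^ 2 = 2 * (Real.cosh s - Real.sinh s) / Real.cosh s := by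
  have h1 := Real.cosh_pos s
  rw [norm_sq_eq_sum]
  simp only [merc, northPole, PiLp.sub_apply, Matrix.cons_val, Matrix.cons_val_zero,
    Matrix.cons_val_one]
  field_simp
  linear_combination Real.sin_sq_add_cos_sq θ - Real.cosh_sq s

theorem norm_merc_add_northPole_sq (θ s : ℝ) :
    ‖merc θ s + northPole‖ ^ 2 = 2 * (Real.cosh s + Real.sinh s) / Real.cosh s := by
  have h1 := Real.cosh_pos s
  rw [norm_sq_eq_sum]
  simp only [merc, northPole, PiLp.add_apply, Matrix.cons_val, Matrix.cons_val_zero,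
    Matrix.cons_val_one]
  field_simp
  linear_combination Real.sin_sq_add_cos_sq θ - Real.cosh_sq s

theorem merc_ne_northPole (θ s : ℝ) : merc θ s ≠ northPole := by
  intro h
  have h0 : merc θ s 0 = northPole 0 := by rw [h]
  have h1 : merc θ s 1 = northPole 1 := by rw [h]
  have hc := (Real.cosh_pos s).ne'
  simp [merc, northPole, hc] at h0 h1
  have := Real.sin_sq_add_cos_sq θ
  rw [h0, h1] at this
  norm_num at this

theorem merc_ne_neg_northPole (θ s : ℝ) : merc θ s ≠ -northPole := by
  rw [← rot_flipX_northPole, ← neg_neg θ, ← neg_neg s, ← rot_flipX_merc]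
  exact fun h => merc_ne_northPole _ _ (rot_injective _ h)

theorem northPole_ne_neg : northPole ≠ -northPole := by
  intro h
  have := congrArg (fun x : E3 => x 2) h
  simp [northPole] at this
  linarith

theorem norm_northPole : ‖northPole‖ = 1 := by
  have h : ‖northPole‖ ^ 2 = 1 := by
    rw [norm_sq_eq_sum]; simp [northPole]
  nlinarith [norm_nonneg northPole]

/-! ### Enumeration of the dihedral group -/

theorem rotZ_ne_flipX_mul (a b : ℝ) : rotZ a ≠ flipX * rotZ b := by
  intro h
  have := congrArg (fun M : SO3 => (M : Matrix (Fin 3) (Fin 3) ℝ) 2 2) h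
  simp [rotZ, flipX] at this
  linarith

theorem cos_mul_two_pi_div_eq_one {n : ℕ} (hn : 0 < n) {m : ℤ}
    (h : Real.cos (m * (2 * Real.pi / n)) = 1) : (n : ℤ) ∣ m := by
  obtain ⟨j, hj⟩ := (Real.cos_eq_one_iff _).1 h
  have hn0 : (n : ℝ) ≠ 0 := by positivity
  have h4 : (j : ℝ) * n = m := by
    have hpi := Real.pi_pos.ne'
    field_simp at hj
    linarith
  exact ⟨j, by rw [mul_comm]; exact_mod_cast h4.symm⟩

theorem eq_of_cos_eq_one {n : ℕ} (i j : Fin n)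
    (h : Real.cos ((i : ℝ) * (2 * Real.pi / n) - j * (2 * Real.pi / n)) = 1) : i = j := by
  have hn : 0 < n := i.pos
  have h1 : Real.cos ((((i : ℕ) : ℤ) - ((j : ℕ) : ℤ) : ℤ) * (2 * Real.pi / n)) = 1 := by
    rw [← h]; congr 1; push_cast; ring
  have h2 := cos_mul_two_pi_div_eq_one hn h1
  have h3 := Int.eq_zero_of_abs_lt_dvd h2 (by
    rw [abs_lt]; have := i.2; have := j.2; constructor <;> omega)
  ext; omega

theorem eq_of_rotZ_eq {n : ℕ} (i j : Fin n)
    (h : rotZ ((i : ℝ) * (2 * Real.pi / n)) = rotZ (j * (2 * Real.pi / n))) : i = j := by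
  apply eq_of_cos_eq_one
  have h0 := congrArg (fun M : SO3 => (M : Matrix (Fin 3) (Fin 3) ℝ) 0 0) h
  have h1 := congrArg (fun M : SO3 => (M : Matrix (Fin 3) (Fin 3) ℝ) 1 0) h
  simp only [rotZ, Matrix.of_apply, Matrix.cons_val', Matrix.cons_val_zero,
    Matrix.cons_val_one, Matrix.cons_val_fin_one] at h0 h1
  rw [Real.cos_sub, h0, h1]
  linear_combination Real.sin_sq_add_cos_sq ((j : ℝ) * (2 * Real.pi / n))

theorem exists_dihedralEquiv {n : ℕ} (hn : 0 < n) : ∃ e : Fin n ⊕ Fin n ≃ dihedral n,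
    (∀ k, (e (Sum.inl k) : SO3) = rotZ (k * (2 * Real.pi / n))) ∧
    (∀ k, (e (Sum.inr k) : SO3) = flipX * rotZ (k * (2 * Real.pi / n))) := by
  have hmem : ∀ p : Fin n ⊕ Fin n, Sum.elim (fun i : Fin n => rotZ (i * (2 * Real.pi / n)))
      (fun i : Fin n => flipX * rotZ (i * (2 * Real.pi / n))) p ∈ dihedral n := by
    rintro (i | i)
    · exact (mem_dihedral_iff hn _).2 ⟨i, i.2, Or.inl (rotZ_pow _ _).symm⟩
    · exact (mem_dihedral_iff hn _).2 ⟨i, i.2, Or.inr (by rw [rotZ_pow]; rfl)⟩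
  refine ⟨Equiv.ofBijective (fun p => ⟨_, hmem p⟩) ⟨?_, ?_⟩, fun k => rfl, fun k => rfl⟩
  · rintro (i | i) (j | j) h <;> simp only [Subtype.mk.injEq, Sum.elim_inl, Sum.elim_inr] at h
    · rw [eq_of_rotZ_eq i j h]
    · exact (rotZ_ne_flipX_mul _ _ h).elim
    · exact (rotZ_ne_flipX_mul _ _ h.symm).elim
    · rw [eq_of_rotZ_eq i j (mul_left_cancel h)]
  · rintro ⟨x, hx⟩
    obtain ⟨k, hk, h | h⟩ := (mem_dihedral_iff hn _).1 hx
    · exact ⟨Sum.inl ⟨k, hk⟩, Subtype.ext ((h.trans (rotZ_pow _ _)).symm)⟩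
    · exact ⟨Sum.inr ⟨k, hk⟩, Subtype.ext
        ((h.trans (congrArg (flipX * ·) (rotZ_pow _ _))).symm)⟩

theorem dihedral_cases {n : ℕ} (hn : 0 < n) (x : dihedral n) :
    (∃ k : Fin n, (x : SO3) = rotZ (k * (2 * Real.pi / n))) ∨
      ∃ k : Fin n, (x : SO3) = flipX * rotZ (k * (2 * Real.pi / n)) := by
  obtain ⟨e, h1, h2⟩ := exists_dihedralEquiv hn
  obtain ⟨p, rfl⟩ := e.surjective x
  rcases p with k | k
  · exact Or.inl ⟨k, h1 k⟩
  · exact Or.inr ⟨k, h2 k⟩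

/-- Removes the arbitrary ordering `g`: sums over the group become sums over explicit rotations and
half-turns. -/
theorem sum_dihedral {n : ℕ} (hn : 0 < n) (g : Fin (2 * n) ≃ dihedral n) {M : Type*}
    [AddCommMonoid M] (Φ : SO3 → M) : ∑ b, Φ (g b) =
      ∑ k : Fin n, Φ (rotZ (k * (2 * Real.pi / n))) +
        ∑ k : Fin n, Φ (flipX * rotZ (k * (2 * Real.pi / n))) := by
  obtain ⟨e, h1, h2⟩ := exists_dihedralEquiv hn
  rw [← Equiv.sum_comp (e.trans g.symm), Fintype.sum_sum_type]
  simp [h1, h2]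

theorem sum_dihedral_translate {n : ℕ} (g : Fin (2 * n) ≃ dihedral n) {M : Type*}
    [AddCommMonoid M] (Φ : SO3 → M) (a : Fin (2 * n)) :
    ∑ b, Φ ((g a : SO3)⁻¹ * g b) = ∑ b, Φ (g b) := by
  rw [← Equiv.sum_comp ((g.trans (Equiv.mulLeft (g a)⁻¹)).trans g.symm) (fun b => Φ (g b))]
  simp

theorem rot_mem_poles {n : ℕ} (hn : 0 < n) (x : dihedral n) :
    (rot x northPole = northPole ∧ ∃ k : Fin n, (x : SO3) = rotZ (k * (2 * Real.pi / n))) ∨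
      (rot x northPole = -northPole ∧
        ∃ k : Fin n, (x : SO3) = flipX * rotZ (k * (2 * Real.pi / n))) := by
  rcases dihedral_cases hn x with ⟨k, hk⟩ | ⟨k, hk⟩
  · exact Or.inl ⟨by rw [hk, rot_rotZ_northPole], k, hk⟩
  · exact Or.inr ⟨by rw [hk, rot_mul, rot_rotZ_northPole, rot_flipX_northPole], k, hk⟩

theorem sum_poles (f : Fin 2 ≃ poles) {M : Type*} [AddCommMonoid M] (Φ : E3 → M) :
    ∑ b, Φ (f b) = Φ northPole + Φ (-northPole) := by
  have hN : northPole ∈ poles := Or.inl rfl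
  have hS : -northPole ∈ poles := Or.inr rfl
  have hne : f.symm ⟨_, hN⟩ ≠ f.symm ⟨_, hS⟩ := fun h => northPole_ne_neg
    (congrArg Subtype.val (f.symm.injective h))
  have huniv : (Finset.univ : Finset (Fin 2)) = {f.symm ⟨_, hN⟩, f.symm ⟨_, hS⟩} := by
    symm
    rw [Finset.eq_univ_iff_forall]
    intro b
    obtain ⟨⟨x, hx⟩, rfl⟩ := f.symm.surjective b
    rcases hx with rfl | rfl <;> simp
  rw [huniv, Finset.sum_pair hne]
  simp

/-! ### Trigonometric sums over equidistant angles -/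

/-- Take squared moduli in zⁿ − wⁿ = ∏ (z − ζᵏ w) with z = exp x, w = exp(iy) and ζ a primitive n-th
root of unity, using |exp a − exp(ib)|² = exp a · (2 cosh a − 2 cos b); the factors exp x cancel. -/
theorem prod_cosh_sub_cos {n : ℕ} (hn : 0 < n) (x y : ℝ) :
    ∏ k : Fin n, (2 * Real.cosh x - 2 * Real.cos (y + k * (2 * Real.pi / n))) =
      2 * Real.cosh (n * x) - 2 * Real.cos (n * y) := by
  have hnC : (n : ℂ) ≠ 0 := by exact_mod_cast hn.ne'
  have hζ := Complex.isPrimitiveRoot_exp n hn.ne'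
  set ζ := Complex.exp (2 * Real.pi * Complex.I / n) with hζdef
  have hset : Polynomial.nthRootsFinset n (1 : ℂ) = (Finset.range n).image (fun k => ζ ^ k) := by
    symm
    refine Finset.eq_of_subset_of_card_le ?_ ?_
    · intro z hz
      obtain ⟨k, -, rfl⟩ := Finset.mem_image.1 hz
      rw [Polynomial.mem_nthRootsFinset hn, ← pow_mul, mul_comm, pow_mul, hζ.pow_eq_one, one_pow]
    · rw [hζ.card_nthRootsFinset, Finset.card_image_of_injOn, Finset.card_range]
      intro i hi j hj h
      exact hζ.pow_inj (Finset.mem_range.1 hi) (Finset.mem_range.1 hj) h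
  have key := hζ.pow_sub_pow_eq_prod_sub_mul (Complex.exp x) (Complex.exp (y * Complex.I)) hn
  rw [hset, Finset.prod_image (fun i hi j hj h =>
    hζ.pow_inj (Finset.mem_range.1 hi) (Finset.mem_range.1 hj) h)] at key
  have hns : ∀ a b : ℝ, Complex.normSq (Complex.exp a - Complex.exp (b * Complex.I)) =
      Real.exp a * (2 * Real.cosh a - 2 * Real.cos b) := by
    intro a b
    rw [Complex.normSq_apply]
    simp only [Complex.sub_re, Complex.sub_im, Complex.exp_re, Complex.exp_im, Complex.ofReal_re,
      Complex.ofReal_im, Complex.re_ofReal_mul, Complex.im_ofReal_mul, Complex.I_re, Complex.I_im,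
      Real.cos_zero, Real.sin_zero, mul_zero, Real.exp_zero, mul_one, one_mul, zero_sub]
    have h1 := Real.sin_sq_add_cos_sq b
    have h2 : Real.exp a * Real.exp (-a) = 1 := by rw [← Real.exp_add]; simp
    rw [Real.cosh_eq]
    linear_combination h1 - h2
  have h2 := congrArg Complex.normSq key
  rw [map_prod] at h2
  have e1 : Complex.exp x ^ n = Complex.exp ((n * x : ℝ) : ℂ) := by
    rw [← Complex.exp_nat_mul]; push_cast; rfl
  have e2 : Complex.exp (y * Complex.I) ^ n = Complex.exp ((n * y : ℝ) * Complex.I) := by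
    rw [← Complex.exp_nat_mul]; push_cast; ring_nf
  have e3 : ∀ k : ℕ, ζ ^ k * Complex.exp (y * Complex.I) =
      Complex.exp ((y + k * (2 * Real.pi / n) : ℝ) * Complex.I) := by
    intro k
    rw [hζdef, ← Complex.exp_nat_mul, ← Complex.exp_add]
    congr 1
    push_cast
    ring
  rw [e1, e2, hns] at h2
  simp only [e3, hns] at h2
  rw [Finset.prod_mul_distrib, Finset.prod_const, Finset.card_range, ← Real.exp_nat_mul] at h2
  have h3 := mul_left_cancel₀ (Real.exp_pos _).ne' h2
  rw [h3, Finset.prod_range]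

/-- A nonzero product has nonzero factors, so one inequality excludes a collision with any of the
half-turned copies. -/
theorem cosh_sub_cos_ne_zero {n : ℕ} {x y : ℝ} (h : 0 < Real.cosh (n * x) - Real.cos (n * y))
    (k : Fin n) : 2 * Real.cosh x - 2 * Real.cos (y + k * (2 * Real.pi / n)) ≠ 0 := by
  have h1 := prod_cosh_sub_cos k.pos x y
  have h2 : ∏ k : Fin n, (2 * Real.cosh x - 2 * Real.cos (y + k * (2 * Real.pi / n))) ≠ 0 := by
    rw [h1]; linarith
  exact Finset.prod_ne_zero_iff.1 h2 k (Finset.mem_univ k)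

theorem sum_log_cosh_sub_cos {n : ℕ} (hn : 0 < n) {x y : ℝ}
    (h : 0 < Real.cosh (n * x) - Real.cos (n * y)) :
    ∑ k : Fin n, Real.log (2 * Real.cosh x - 2 * Real.cos (y + k * (2 * Real.pi / n))) =
      Real.log (2 * Real.cosh (n * x) - 2 * Real.cos (n * y)) := by
  rw [← prod_cosh_sub_cos hn, Real.log_prod fun k _ => cosh_sub_cos_ne_zero h k]

/-- Logarithmic derivative of the product formula with respect to `x`; positivity is an open
condition, so the logarithmic identity may be differentiated. The derivative with respect to `y`
gives the companion sum of sines. -/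
theorem sinh_mul_sum_inv_cosh_sub_cos {n : ℕ} (hn : 0 < n) {x y : ℝ}
    (h : 0 < Real.cosh (n * x) - Real.cos (n * y)) :
    Real.sinh x * ∑ k : Fin n, (Real.cosh x - Real.cos (y + k * (2 * Real.pi / n)))⁻¹ =
      n * Real.sinh (n * x) / (Real.cosh (n * x) - Real.cos (n * y)) := by
  have hev : ∀ᶠ x' in 𝓝 x, 0 < Real.cosh (n * x') - Real.cos (n * y) :=
    (ContinuousAt.tendsto (f := fun x' => Real.cosh (n * x') - Real.cos (n * y))
      (by fun_prop)).eventually (lt_mem_nhds h)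
  have heq : (fun x' => ∑ k : Fin n,
      Real.log (2 * Real.cosh x' - 2 * Real.cos (y + k * (2 * Real.pi / n)))) =ᶠ[𝓝 x]
      fun x' => Real.log (2 * Real.cosh (n * x') - 2 * Real.cos (n * y)) :=
    hev.mono fun x' hx' => sum_log_cosh_sub_cos hn hx'
  have d1 : HasDerivAt (fun x' => ∑ k : Fin n,
      Real.log (2 * Real.cosh x' - 2 * Real.cos (y + k * (2 * Real.pi / n))))
      (∑ k : Fin n, 2 * Real.sinh x / (2 * Real.cosh x - 2 * Real.cos (y + k * (2 * Real.pi / n))))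
      x :=
    HasDerivAt.fun_sum fun k _ => HasDerivAt.log
      (((Real.hasDerivAt_cosh x).const_mul 2).sub_const _) (cosh_sub_cos_ne_zero h k)
  have d2 : HasDerivAt (fun x' => Real.log (2 * Real.cosh (n * x') - 2 * Real.cos (n * y)))
      (2 * (Real.sinh (n * x) * (n * 1)) / (2 * Real.cosh (n * x) - 2 * Real.cos (n * y))) x :=
    HasDerivAt.log ((((hasDerivAt_id' x).const_mul (n : ℝ)).cosh.const_mul 2).sub_const _)
      (by linarith)
  have h3 := (d1.congr_of_eventuallyEq heq.symm).unique d2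
  rw [Finset.mul_sum]
  calc _ = ∑ k : Fin n,
        2 * Real.sinh x / (2 * Real.cosh x - 2 * Real.cos (y + k * (2 * Real.pi / n))) := by
        refine Finset.sum_congr rfl fun k _ => ?_
        rw [← mul_sub, mul_div_mul_left _ _ two_ne_zero, ← div_eq_mul_inv]
    _ = _ := by
        rw [h3, ← mul_sub, mul_div_mul_left _ _ two_ne_zero]; ring

theorem sum_sin_div_cosh_sub_cos {n : ℕ} (hn : 0 < n) {x y : ℝ}
    (h : 0 < Real.cosh (n * x) - Real.cos (n * y)) :
    ∑ k : Fin n, Real.sin (y + k * (2 * Real.pi / n)) *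
        (Real.cosh x - Real.cos (y + k * (2 * Real.pi / n)))⁻¹ =
      n * Real.sin (n * y) / (Real.cosh (n * x) - Real.cos (n * y)) := by
  have hev : ∀ᶠ y' in 𝓝 y, 0 < Real.cosh (n * x) - Real.cos (n * y') :=
    (ContinuousAt.tendsto (f := fun y' => Real.cosh (n * x) - Real.cos (n * y'))
      (by fun_prop)).eventually (lt_mem_nhds h)
  have heq : (fun y' => ∑ k : Fin n,
      Real.log (2 * Real.cosh x - 2 * Real.cos (y' + k * (2 * Real.pi / n)))) =ᶠ[𝓝 y]
      fun y' => Real.log (2 * Real.cosh (n * x) - 2 * Real.cos (n * y')) :=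
    hev.mono fun y' hy' => sum_log_cosh_sub_cos hn hy'
  have d1 : HasDerivAt (fun y' => ∑ k : Fin n,
      Real.log (2 * Real.cosh x - 2 * Real.cos (y' + k * (2 * Real.pi / n))))
      (∑ k : Fin n, -(2 * (-Real.sin (y + k * (2 * Real.pi / n)) * 1)) /
        (2 * Real.cosh x - 2 * Real.cos (y + k * (2 * Real.pi / n)))) y :=
    HasDerivAt.fun_sum fun k _ => HasDerivAt.log
      ((((hasDerivAt_id' y).add_const _).cos.const_mul 2).const_sub _) (cosh_sub_cos_ne_zero h k)
  have d2 : HasDerivAt (fun y' => Real.log (2 * Real.cosh (n * x) - 2 * Real.cos (n * y')))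
      (-(2 * (-Real.sin (n * y) * (n * 1))) / (2 * Real.cosh (n * x) - 2 * Real.cos (n * y))) y :=
    HasDerivAt.log ((((hasDerivAt_id' y).const_mul (n : ℝ)).cos.const_mul 2).const_sub _)
      (by linarith)
  have h3 := (d1.congr_of_eventuallyEq heq.symm).unique d2
  calc _ = ∑ k : Fin n, -(2 * (-Real.sin (y + k * (2 * Real.pi / n)) * 1)) /
        (2 * Real.cosh x - 2 * Real.cos (y + k * (2 * Real.pi / n))) := by
        refine Finset.sum_congr rfl fun k _ => ?_
        rw [← mul_sub, mul_one, mul_neg, neg_neg, mul_div_mul_left _ _ two_ne_zero,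
          ← div_eq_mul_inv]
    _ = _ := by
        rw [h3, ← mul_sub, ← mul_neg, mul_div_mul_left _ _ two_ne_zero]; ring

/-- The terms of index `k` and `n - k` cancel; the term of index 0 is zero by itself. -/
theorem sum_eq_zero_of_reflect {n : ℕ} {F : ℝ → ℝ} (h0 : F 0 = 0) (hodd : ∀ x, F (-x) = -F x)
    (hper : ∀ x, F (2 * Real.pi - x) = F (-x)) :
    ∑ k : Fin n, F (k * (2 * Real.pi / n)) = 0 := by
  rcases n with _ | m
  · simp
  rw [Fin.sum_univ_eq_sum_range (fun k => F (k * (2 * Real.pi / (m + 1 : ℕ)))) (m + 1),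
    Finset.sum_range_succ']
  have hrefl := Finset.sum_range_reflect
    (fun k => F ((k + 1 : ℕ) * (2 * Real.pi / (m + 1 : ℕ)))) m
  have hneg : ∑ j ∈ Finset.range m, F ((m - 1 - j + 1 : ℕ) * (2 * Real.pi / (m + 1 : ℕ))) =
      -∑ j ∈ Finset.range m, F ((j + 1 : ℕ) * (2 * Real.pi / (m + 1 : ℕ))) := by
    rw [← Finset.sum_neg_distrib]
    refine Finset.sum_congr rfl fun j hj => ?_
    have hj' := Finset.mem_range.1 hj
    rw [← hodd, ← hper]
    congr 1
    rw [show m - 1 - j + 1 = m - j by omega, Nat.cast_sub hj'.le]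
    push_cast
    field_simp
    ring
  have hz : ∑ j ∈ Finset.range m, F ((j + 1 : ℕ) * (2 * Real.pi / (m + 1 : ℕ))) = 0 := by
    linarith
  rw [hz]
  simp [h0]

theorem sum_sin_two_pi_div (n : ℕ) :
    ∑ k : Fin n, Real.sin (k * (2 * Real.pi / n)) *
      (1 - Real.cos (k * (2 * Real.pi / n)))⁻¹ = 0 :=
  sum_eq_zero_of_reflect (F := fun x => Real.sin x * (1 - Real.cos x)⁻¹) (by simp)
    (fun x => by simp) (fun x => by simp [Real.sin_two_pi_sub, Real.cos_two_pi_sub])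

/-- The term `k = 0` is `0 * 0⁻¹ = 0`, the others are 1. The product is kept unsimplified so that
one formula covers the self-interaction term as well. -/
theorem sum_one_sub_cos_two_pi_div {n : ℕ} (hn : 0 < n) :
    ∑ k : Fin n, (1 - Real.cos (k * (2 * Real.pi / n))) *
      (1 - Real.cos (k * (2 * Real.pi / n)))⁻¹ = n - 1 := by
  have h1 : ∀ k : Fin n, (1 - Real.cos (k * (2 * Real.pi / n))) *
      (1 - Real.cos (k * (2 * Real.pi / n)))⁻¹ = 1 - if k = ⟨0, hn⟩ then 1 else 0 := by
    intro k
    split_ifs with hk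
    · simp [hk]
    · rw [mul_inv_cancel₀, sub_zero]
      intro h
      apply hk
      apply eq_of_cos_eq_one
      simp; linarith
  rw [Finset.sum_congr rfl fun k _ => h1 k, Finset.sum_sub_distrib]
  simp

/-! ### Energy and vector field of a dihedrally symmetric configuration -/

/-- The diagonal term may be included, as its coefficient is `0⁻¹ = 0`. -/
theorem vortexField_eq_sum {N : ℕ} (v : Fin N → E3) (j : Fin N) :
    vortexField v j = ∑ i, (‖v j - v i‖ ^ 2)⁻¹ • cross3 (v i) (v j) := by
  rw [vortexField, ← Finset.add_sum_erase _ _ (Finset.mem_univ j)]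
  simp

/-- Each pair is counted twice, whence 1/4, and the diagonal contributes `Real.log 0 = 0`. -/
theorem vortexEnergy_eq_sum {N : ℕ} (v : Fin N → E3) :
    vortexEnergy v = -(1 / 4) * ∑ i, ∑ j, Real.log (‖v j - v i‖ ^ 2) := by
  have h : ∑ i, ∑ j, Real.log (‖v j - v i‖ ^ 2) =
      2 * ∑ i, ∑ j ∈ Finset.Ioi i, Real.log (‖v j - v i‖ ^ 2) := by
    have h1 : ∀ i, ∑ j, Real.log (‖v j - v i‖ ^ 2) =
        ∑ j ∈ Finset.Ioi i, Real.log (‖v j - v i‖ ^ 2) +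
          ∑ j ∈ Finset.Iio i, Real.log (‖v j - v i‖ ^ 2) := by
      intro i
      have hu : (Finset.univ : Finset (Fin N)) = insert i (Finset.Ioi i ∪ Finset.Iio i) := by
        ext j; simpa using (lt_trichotomy j i).elim (fun h => Or.inr (Or.inr h))
          fun h => h.elim Or.inl fun h => Or.inr (Or.inl h)
      rw [hu, Finset.sum_insert (by simp), Finset.sum_union]
      · simp
      · rw [Finset.disjoint_left]; intro j; simp; exact fun h => h.le
    simp_rw [h1, Finset.sum_add_distrib]
    rw [two_mul]
    congr 1
    rw [Finset.sum_sigma', Finset.sum_sigma']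
    refine Finset.sum_nbij' (fun p => ⟨p.2, p.1⟩) (fun p => ⟨p.2, p.1⟩) ?_ ?_ ?_ ?_ ?_
    · intro p; simp
    · intro p; simp
    · intro p _; rfl
    · intro p _; rfl
    · intro p _; simp only; rw [norm_sub_rev]
  rw [vortexEnergy, h]; ring

/-! ### Equivariance of the field and the energy under the dihedral group. -/

section Symmetric

variable {n : ℕ} (g : Fin (2 * n) ≃ dihedral n) (f : Fin 2 ≃ poles)

@[simp] theorem symConfig_castAdd (u : E3) (j : Fin (2 * n)) :
    symConfig g f u (Fin.castAdd 2 j) = rot (g j) u := by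
  simp [symConfig]

@[simp] theorem symConfig_natAdd (u : E3) (j : Fin 2) :
    symConfig g f u (Fin.natAdd (2 * n) j) = f j := by
  simp [symConfig]

theorem rot_mul_inv_rot (x y : SO3) (u : E3) : rot x (rot (x⁻¹ * y) u) = rot y u := by
  rw [← rot_mul, mul_inv_cancel_left]

theorem sum_rot_poles (hn : 0 < n) (x : dihedral n) {M : Type*} [AddCommMonoid M] (Φ : E3 → M) :
    Φ (rot x northPole) + Φ (rot x (-northPole)) = Φ northPole + Φ (-northPole) := by
  have hneg : rot x (-northPole) = -rot x northPole := by
    rw [← rotLin_apply, map_neg, rotLin_apply]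
  rcases rot_mem_poles hn x with ⟨h, -⟩ | ⟨h, -⟩
  · rw [hneg, h]
  · rw [hneg, h, neg_neg, add_comm]

/-- The velocity of the vortex at `u` in the configuration generated by `u`. -/
noncomputable def symField (n : ℕ) (u : E3) : E3 :=
  ∑ k : Fin n, (‖u - rot (rotZ (k * (2 * Real.pi / n))) u‖ ^ 2)⁻¹ •
      cross3 (rot (rotZ (k * (2 * Real.pi / n))) u) u +
    ∑ k : Fin n, (‖u - rot (flipX * rotZ (k * (2 * Real.pi / n))) u‖ ^ 2)⁻¹ •
      cross3 (rot (flipX * rotZ (k * (2 * Real.pi / n))) u) u +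
    ((‖u - northPole‖ ^ 2)⁻¹ • cross3 northPole u +
      (‖u - -northPole‖ ^ 2)⁻¹ • cross3 (-northPole) u)

/-- Left translation by `g j` permutes the group and preserves the pair of poles, while rotations
preserve distances and vector products; so the velocity at `g j u` is the rotated velocity at `u`.
-/
theorem vortexField_symConfig_castAdd (hn : 0 < n) (u : E3) (j : Fin (2 * n)) :
    vortexField (symConfig g f u) (Fin.castAdd 2 j) = rot (g j) (symField n u) := by
  rw [vortexField_eq_sum, Fin.sum_univ_add]
  simp only [symConfig_castAdd, symConfig_natAdd]
  rw [sum_poles f (fun p => (‖rot (g j) u - p‖ ^ 2)⁻¹ • cross3 p (rot (g j) u)),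
    ← sum_rot_poles hn (g j) (fun p => (‖rot (g j) u - p‖ ^ 2)⁻¹ • cross3 p (rot (g j) u)),
    symField, ← sum_dihedral hn g (fun x => (‖u - rot x u‖ ^ 2)⁻¹ • cross3 (rot x u) u),
    ← sum_dihedral_translate g (fun x => (‖u - rot x u‖ ^ 2)⁻¹ • cross3 (rot x u) u) j]
  simp only [← rotLin_apply, map_add, map_sum, map_smul]
  simp only [rotLin_apply, ← cross3_rot, rot_mul_inv_rot, norm_rot_sub]
  congr 1
  refine Finset.sum_congr rfl fun b _ => ?_
  rw [← norm_rot_sub (g j) u, rot_mul_inv_rot]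

theorem eq_zero_of_rot_rotZ_eq (hn : 2 ≤ n) {V : E3} (h : rot (rotZ (2 * Real.pi / n)) V = V)
    (h2 : V 2 = 0) : V = 0 := by
  have h0 : Real.cos (2 * Real.pi / n) ≠ 1 := by
    intro hc
    have := cos_mul_two_pi_div_eq_one (n := n) (by omega) (m := 1) (by simpa using hc)
    have := Int.le_of_dvd one_pos this
    omega
  have e0 : rot (rotZ (2 * Real.pi / n)) V 0 = V 0 := by rw [h]
  have e1 : rot (rotZ (2 * Real.pi / n)) V 1 = V 1 := by rw [h]
  simp [rot, rotZ, Matrix.vecHead, Matrix.vecTail] at e0 e1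
  generalize 2 * Real.pi / n = a at *
  have hs := Real.sin_sq_add_cos_sq a
  have hp : 2 - 2 * Real.cos a ≠ 0 := fun hh => h0 (by linarith)
  ext i
  fin_cases i
  · have : (2 - 2 * Real.cos a) * V 0 = 0 := by
      linear_combination (Real.cos a - 1) * e0 + Real.sin a * e1 - V 0 * hs
    simpa [hp] using this
  · have : (2 - 2 * Real.cos a) * V 1 = 0 := by
      linear_combination (Real.cos a - 1) * e1 - Real.sin a * e0 - V 1 * hs
    simpa [hp] using this
  · simpa using h2

/-- The field at a pole is horizontal and invariant under the rotation by 2π/n, which for n ≥ 2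
fixes no nonzero horizontal vector. -/
theorem vortexField_symConfig_natAdd (hn : 2 ≤ n) (u : E3) (j : Fin 2) :
    vortexField (symConfig g f u) (Fin.natAdd (2 * n) j) = 0 := by
  rw [vortexField_eq_sum, Fin.sum_univ_add]
  simp only [symConfig_castAdd, symConfig_natAdd]
  rw [sum_poles f (fun p => (‖(f j : E3) - p‖ ^ 2)⁻¹ • cross3 p (f j))]
  have hpole : (f j : E3) = northPole ∨ (f j : E3) = -northPole := (f j).2
  generalize (f j : E3) = p at hpole
  have hp0 : p 0 = 0 := by rcases hpole with rfl | rfl <;> simp [northPole]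
  have hp1 : p 1 = 0 := by rcases hpole with rfl | rfl <;> simp [northPole]
  have hcross : ∀ q : E3, q 0 = 0 → q 1 = 0 → cross3 q p = 0 := by
    intro q h0 h1
    ext i; fin_cases i <;> simp [cross3, cross_apply, hp0, hp1, h0, h1]
  rw [hcross northPole (by simp [northPole]) (by simp [northPole]),
    hcross (-northPole) (by simp [northPole]) (by simp [northPole])]
  simp only [smul_zero, add_zero]
  have hfix : ∀ a, rot (rotZ a) p = p := by
    intro a
    rcases hpole with rfl | rfl
    · exact rot_rotZ_northPole a
    · rw [← rotLin_apply, map_neg, rotLin_apply, rot_rotZ_northPole]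
  have hmem : (rotZ (2 * Real.pi / n))⁻¹ ∈ dihedral n :=
    inv_mem (Subgroup.subset_closure (by simp))
  -- Translating the summation index by the inverse of this element, that is by the rotation by
  -- 2π/n, exhibits the invariance of the sum.
  obtain ⟨a, ha⟩ := g.surjective ⟨_, hmem⟩
  refine eq_zero_of_rot_rotZ_eq hn ?_ ?_
  · conv_rhs =>
      rw [← sum_dihedral_translate g (fun x => (‖p - rot x u‖ ^ 2)⁻¹ • cross3 (rot x u) p) a]
    rw [ha]
    simp only [← rotLin_apply, map_sum, map_smul]
    simp only [rotLin_apply, ← cross3_rot, hfix, inv_inv, rot_mul]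
    refine Finset.sum_congr rfl fun b _ => ?_
    rw [← norm_rot_sub (rotZ (2 * Real.pi / n)) p, hfix]
  · simp [cross3, cross_apply, hp0, hp1]

theorem vortexEnergy_symConfig (hn : 0 < n) (u : E3) : vortexEnergy (symConfig g f u) =
    -(n / 2) * (∑ k : Fin n, Real.log (‖u - rot (rotZ (k * (2 * Real.pi / n))) u‖ ^ 2) +
      ∑ k : Fin n, Real.log (‖u - rot (flipX * rotZ (k * (2 * Real.pi / n))) u‖ ^ 2) +
      2 * (Real.log (‖u - northPole‖ ^ 2) + Real.log (‖u - -northPole‖ ^ 2))) -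
    Real.log 4 / 2 := by
  rw [vortexEnergy_eq_sum, Fin.sum_univ_add]
  simp only [Fin.sum_univ_add, symConfig_castAdd, symConfig_natAdd]
  have e1 : ∀ a, ∑ b, Real.log (‖rot (g b) u - rot (g a) u‖ ^ 2) =
      ∑ k : Fin n, Real.log (‖u - rot (rotZ (k * (2 * Real.pi / n))) u‖ ^ 2) +
      ∑ k : Fin n, Real.log (‖u - rot (flipX * rotZ (k * (2 * Real.pi / n))) u‖ ^ 2) := by
    intro a
    rw [← sum_dihedral hn g (fun x => Real.log (‖u - rot x u‖ ^ 2)),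
      ← sum_dihedral_translate g (fun x => Real.log (‖u - rot x u‖ ^ 2)) a]
    refine Finset.sum_congr rfl fun b _ => ?_
    rw [← norm_rot_sub (g a) u, rot_mul_inv_rot, norm_sub_rev]
  have e2 : ∀ a : Fin (2 * n), ∑ b, Real.log (‖(f b : E3) - rot (g a) u‖ ^ 2) =
      Real.log (‖u - northPole‖ ^ 2) + Real.log (‖u - -northPole‖ ^ 2) := by
    intro a
    rw [sum_poles f (fun p => Real.log (‖p - rot (g a) u‖ ^ 2)),
      ← sum_rot_poles hn (g a) (fun p => Real.log (‖p - rot (g a) u‖ ^ 2)), norm_rot_sub,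
      norm_rot_sub, norm_sub_rev northPole, norm_sub_rev (-northPole)]
  have e3 : ∑ a, ∑ b, Real.log (‖rot (g b) u - (f a : E3)‖ ^ 2) =
      ∑ b, ∑ a, Real.log (‖(f a : E3) - rot (g b) u‖ ^ 2) := by
    rw [Finset.sum_comm]
    simp only [norm_sub_rev]
  have e4 : ∑ a, ∑ b, Real.log (‖(f b : E3) - f a‖ ^ 2) = 2 * Real.log 4 := by
    rw [sum_poles f (fun p => ∑ b, Real.log (‖(f b : E3) - p‖ ^ 2)),
      sum_poles f (fun q => Real.log (‖q - northPole‖ ^ 2)),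
      sum_poles f (fun q => Real.log (‖q - -northPole‖ ^ 2))]
    have h1 : ‖northPole - -northPole‖ ^ 2 = 4 := by
      rw [sub_neg_eq_add, ← two_smul ℝ, norm_smul, norm_northPole]; norm_num
    rw [norm_sub_rev (-northPole), h1]
    simp; ring
  rw [Finset.sum_add_distrib, Finset.sum_add_distrib, e3, e4]
  simp only [e1, e2, Finset.sum_const, Finset.card_univ, Fintype.card_fin, nsmul_eq_mul]
  push_cast
  ring

end Symmetric

/-! ### The reduced system in Mercator coordinates -/

/-- The denominator `cosh 2ns - cos 2nθ` in the reduced vector field. -/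
noncomputable def mercD (n : ℕ) (θ s : ℝ) : ℝ :=
  Real.cosh (n * (2 * s)) - Real.cos (n * (2 * θ))

/-- The angular velocity in longitude of the reduced system. -/
noncomputable def lonSpeed (n : ℕ) (θ s : ℝ) : ℝ :=
  Real.cosh s / 2 *
    ((2 * n + 1) * Real.sinh s - n * Real.cosh s * Real.sinh (n * (2 * s)) / mercD n θ s)

/-- The velocity in Mercator latitude of the reduced system. -/
noncomputable def latSpeed (n : ℕ) (θ s : ℝ) : ℝ :=
  Real.cosh s ^ 2 / 2 * (n * Real.sin (n * (2 * θ)) / mercD n θ s)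

/-- The derivative of `merc` at `(θ, s)` in the direction `(a, b)`. -/
noncomputable def mercTangent (θ s a b : ℝ) : E3 :=
  !₂[-Real.sin θ / Real.cosh s * a - Real.cos θ * Real.sinh s / Real.cosh s ^ 2 * b,
    Real.cos θ / Real.cosh s * a - Real.sin θ * Real.sinh s / Real.cosh s ^ 2 * b,
    1 / Real.cosh s ^ 2 * b]

theorem rot_rotZ_mul_merc (a θ s : ℝ) :
    rot (flipX * rotZ a) (merc θ s) = merc (-(θ + a)) (-s) := by
  rw [rot_mul, rot_rotZ_merc, rot_flipX_merc]

theorem norm_merc_sub_rotZ_sq (a θ s : ℝ) : ‖merc θ s - rot (rotZ a) (merc θ s)‖ ^ 2 =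
    2 * (1 - Real.cos a) / Real.cosh s ^ 2 := by
  rw [rot_rotZ_merc, norm_merc_sub_sq]
  simp [sq]

theorem norm_merc_sub_flip_sq (a θ s : ℝ) :
    ‖merc θ s - rot (flipX * rotZ a) (merc θ s)‖ ^ 2 =
      2 * (Real.cosh (2 * s) - Real.cos (2 * θ + a)) / Real.cosh s ^ 2 := by
  rw [rot_rotZ_mul_merc, norm_merc_sub_sq, Real.cosh_neg, sq]
  ring_nf

/-- The two vectors are (sinh s cosh s / 2) ∂θ and −(cosh² s / 2) ∂s of `merc`. Keeping the inverse
as a factor makes the identity valid for cos a = 1 too, where both sides vanish. -/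
theorem symField_rot_term (a θ s : ℝ) :
    (‖merc θ s - rot (rotZ a) (merc θ s)‖ ^ 2)⁻¹ • cross3 (rot (rotZ a) (merc θ s)) (merc θ s) =
      ((1 - Real.cos a) * (1 - Real.cos a)⁻¹) •
          (!₂[-(Real.sinh s / 2) * Real.sin θ, Real.sinh s / 2 * Real.cos θ, 0] : E3) +
        (Real.sin a * (1 - Real.cos a)⁻¹) •
          (!₂[Real.sinh s / 2 * Real.cos θ, Real.sinh s / 2 * Real.sin θ, -(1 / 2)] : E3) := by
  have hc := (Real.cosh_pos s).ne'
  rw [norm_merc_sub_rotZ_sq, rot_rotZ_merc, inv_div, mul_comm (2 : ℝ), ← div_div,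
    div_eq_mul_inv (Real.cosh s ^ 2)]
  generalize (1 - Real.cos a)⁻¹ = I
  have h1 := Real.sin_sq_add_cos_sq θ
  ext i
  fin_cases i
  · simp [cross3, cross_apply, merc, Real.sin_add, Real.cos_add]; field_simp; ring
  · simp [cross3, cross_apply, merc, Real.sin_add, Real.cos_add]; field_simp; ring
  · simp [cross3, cross_apply, merc, Real.sin_add, Real.cos_add]; field_simp
    linear_combination (-I * Real.sin a) * h1

theorem symField_flip_term (a θ s : ℝ) (h : Real.cosh (2 * s) - Real.cos (2 * θ + a) ≠ 0) :
    (‖merc θ s - rot (flipX * rotZ a) (merc θ s)‖ ^ 2)⁻¹ •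
        cross3 (rot (flipX * rotZ a) (merc θ s)) (merc θ s) =
      (1 - 2 * Real.cosh s ^ 2 * (Real.cosh (2 * s) - Real.cos (2 * θ + a))⁻¹) •
          (!₂[-(Real.sinh s / 2) * Real.sin θ, Real.sinh s / 2 * Real.cos θ, 0] : E3) -
        (Real.sin (2 * θ + a) * (Real.cosh (2 * s) - Real.cos (2 * θ + a))⁻¹) •
          (!₂[Real.sinh s / 2 * Real.cos θ, Real.sinh s / 2 * Real.sin θ, -(1 / 2)] : E3) := by
  have hc := (Real.cosh_pos s).ne'
  rw [norm_merc_sub_flip_sq, rot_rotZ_mul_merc, inv_div, mul_comm (2 : ℝ), ← div_div,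
    div_eq_mul_inv (Real.cosh s ^ 2)]
  have hI := mul_inv_cancel₀ h
  obtain ⟨β, rfl⟩ : ∃ β, a = β - 2 * θ := ⟨a + 2 * θ, by ring⟩
  simp only [show 2 * θ + (β - 2 * θ) = β by ring] at *
  rw [show -(θ + (β - 2 * θ)) = θ - β by ring]
  generalize (Real.cosh (2 * s) - Real.cos β)⁻¹ = I at *
  have h1 := Real.sin_sq_add_cos_sq θ
  rw [Real.cosh_two_mul] at hI
  have h2 := Real.cosh_sq s
  ext i
  fin_cases i
  · simp [cross3, cross_apply, merc, Real.sin_sub, Real.cos_sub]; field_simp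
    linear_combination (-Real.sin θ * Real.sinh s) * hI - Real.sin θ * Real.sinh s * I * h2
  · simp [cross3, cross_apply, merc, Real.sin_sub, Real.cos_sub]; field_simp
    linear_combination (Real.cos θ * Real.sinh s) * hI + Real.cos θ * Real.sinh s * I * h2
  · simp [cross3, cross_apply, merc, Real.sin_sub, Real.cos_sub]; field_simp
    linear_combination (I * Real.sin β) * h1

theorem symField_pole_term (θ s : ℝ) :
    (‖merc θ s - northPole‖ ^ 2)⁻¹ • cross3 northPole (merc θ s) +
        (‖merc θ s - -northPole‖ ^ 2)⁻¹ • cross3 (-northPole) (merc θ s) =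
      (2 : ℝ) • (!₂[-(Real.sinh s / 2) * Real.sin θ, Real.sinh s / 2 * Real.cos θ, 0] : E3) := by
  have hc := (Real.cosh_pos s).ne'
  have h2 := Real.cosh_sq s
  have h3 : Real.cosh s - Real.sinh s ≠ 0 := by
    rw [Real.cosh_sub_sinh]; exact (Real.exp_pos _).ne'
  have h4 : Real.cosh s + Real.sinh s ≠ 0 := by
    rw [Real.cosh_add_sinh]; exact (Real.exp_pos _).ne'
  rw [sub_neg_eq_add, norm_merc_sub_northPole_sq, norm_merc_add_northPole_sq]
  ext i
  fin_cases i
  · simp [cross3, cross_apply, merc, northPole, -Real.cosh_sub_sinh, -Real.cosh_add_sinh]; field_simp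
    linear_combination (2 * Real.sinh s * Real.sin θ) * h2
  · simp [cross3, cross_apply, merc, northPole, -Real.cosh_sub_sinh, -Real.cosh_add_sinh]; field_simp
    linear_combination (-2 * Real.sinh s * Real.cos θ) * h2
  · simp [cross3, cross_apply, merc, northPole]

/-- In the ∂θ direction, rotations, half-turns and poles contribute (n − 1) + n + 2 = 2n + 1,
diminished by 2 cosh² s times the sum of the inverses. In the ∂s direction the rotations cancel in
pairs and only the half-turns remain. -/
theorem symField_merc {n : ℕ} (hn : 0 < n) {θ s : ℝ} (h : 0 < mercD n θ s) :
    symField n (merc θ s) = mercTangent θ s (lonSpeed n θ s) (latSpeed n θ s) := by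
  have hne : ∀ k : Fin n, Real.cosh (2 * s) - Real.cos (2 * θ + k * (2 * Real.pi / n)) ≠ 0 :=
    fun k hk => cosh_sub_cos_ne_zero h k (by rw [← mul_sub, hk, mul_zero])
  have hc := (Real.cosh_pos s).ne'
  have h1 := sinh_mul_sum_inv_cosh_sub_cos hn h
  have h2 := sum_sin_div_cosh_sub_cos hn h
  rw [symField, symField_pole_term, Finset.sum_congr rfl fun k _ => symField_rot_term _ θ s,
    Finset.sum_congr rfl fun k _ => symField_flip_term _ θ s (hne k), Finset.sum_add_distrib,
    Finset.sum_sub_distrib, ← Finset.sum_smul, ← Finset.sum_smul, ← Finset.sum_smul,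
    ← Finset.sum_smul, sum_one_sub_cos_two_pi_div hn, sum_sin_two_pi_div, h2,
    Finset.sum_sub_distrib, ← Finset.mul_sum]
  rw [show Real.cosh (n * (2 * s)) - Real.cos (n * (2 * θ)) = mercD n θ s from rfl] at *
  rw [Real.sinh_two_mul] at h1
  generalize ∑ k : Fin n, (Real.cosh (2 * s) - Real.cos (2 * θ + k * (2 * Real.pi / n)))⁻¹ = S at *
  have h3 : ∀ c, n * Real.cosh s * Real.sinh (n * (2 * s)) / mercD n θ s * c =
      Real.cosh s * (2 * Real.sinh s * Real.cosh s * S) * c := by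
    intro c; rw [h1]; ring
  ext i
  fin_cases i
  · simp [mercTangent, lonSpeed, latSpeed]
    have := h3 (Real.sin θ / 2)
    field_simp at this ⊢
    linear_combination (-Real.cosh s) * this
  · simp [mercTangent, lonSpeed, latSpeed]
    have := h3 (Real.cos θ / 2)
    field_simp at this ⊢
    linear_combination (Real.cosh s) * this
  · simp [mercTangent, lonSpeed, latSpeed]
    field_simp

/-- The additive constant in the energy of a symmetric configuration. -/
noncomputable def energyConst (n : ℕ) : ℝ :=
  -(n / 2) * (∑ k : Fin n, Real.log (2 * (1 - Real.cos (k * (2 * Real.pi / n)))) + Real.log 2 +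
    2 * Real.log 4) - Real.log 4 / 2

/-- The coefficient of log cosh² s collects n − 1 from the rotations, n from the half-turns and 2
from the poles. -/
theorem vortexEnergy_symConfig_merc {n : ℕ} (hn : 0 < n) (g : Fin (2 * n) ≃ dihedral n)
    (f : Fin 2 ≃ poles) {θ s : ℝ} (h : 0 < mercD n θ s) :
    vortexEnergy (symConfig g f (merc θ s)) = energyConst n -
      n / 2 * (Real.log (mercD n θ s) - (2 * n + 1) * Real.log (Real.cosh s ^ 2)) := by
  have hc := Real.cosh_pos s
  have hL : Real.cosh s ^ 2 ≠ 0 := by positivity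
  have e1 : ∑ k : Fin n, Real.log (‖merc θ s - rot (rotZ (k * (2 * Real.pi / n))) (merc θ s)‖ ^ 2)
      = ∑ k : Fin n, Real.log (2 * (1 - Real.cos (k * (2 * Real.pi / n)))) -
        (n - 1) * Real.log (Real.cosh s ^ 2) := by
    -- The factor `x * x⁻¹` is the indicator of `x ≠ 0`; it removes the self-term, whose logarithm
    -- is 0 by convention.
    have : ∀ k : Fin n,
        Real.log (‖merc θ s - rot (rotZ (k * (2 * Real.pi / n))) (merc θ s)‖ ^ 2) =
        Real.log (2 * (1 - Real.cos (k * (2 * Real.pi / n)))) -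
          ((1 - Real.cos (k * (2 * Real.pi / n))) * (1 - Real.cos (k * (2 * Real.pi / n)))⁻¹) *
            Real.log (Real.cosh s ^ 2) := by
      intro k
      rw [norm_merc_sub_rotZ_sq]
      by_cases hk : 1 - Real.cos (k * (2 * Real.pi / n)) = 0
      · simp [hk]
      · rw [Real.log_div (by simpa using hk) hL, mul_inv_cancel₀ hk, one_mul]
    rw [Finset.sum_congr rfl fun k _ => this k, Finset.sum_sub_distrib, ← Finset.sum_mul,
      sum_one_sub_cos_two_pi_div hn]
  have e2 : ∑ k : Fin n,
      Real.log (‖merc θ s - rot (flipX * rotZ (k * (2 * Real.pi / n))) (merc θ s)‖ ^ 2)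
      = Real.log 2 + Real.log (mercD n θ s) - n * Real.log (Real.cosh s ^ 2) := by
    have : ∀ k : Fin n,
        Real.log (‖merc θ s - rot (flipX * rotZ (k * (2 * Real.pi / n))) (merc θ s)‖ ^ 2) =
        Real.log (2 * Real.cosh (2 * s) - 2 * Real.cos (2 * θ + k * (2 * Real.pi / n))) -
          Real.log (Real.cosh s ^ 2) := by
      intro k
      rw [norm_merc_sub_flip_sq, mul_sub, Real.log_div (cosh_sub_cos_ne_zero h k) hL]
    rw [Finset.sum_congr rfl fun k _ => this k, Finset.sum_sub_distrib,
      sum_log_cosh_sub_cos hn h, ← mul_sub,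
      show Real.cosh (n * (2 * s)) - Real.cos (n * (2 * θ)) = mercD n θ s from rfl,
      Real.log_mul two_ne_zero h.ne']
    simp
  have e3 : Real.log (‖merc θ s - northPole‖ ^ 2) + Real.log (‖merc θ s - -northPole‖ ^ 2) =
      Real.log 4 - Real.log (Real.cosh s ^ 2) := by
    have h3 : 0 < Real.cosh s - Real.sinh s := by
      rw [Real.cosh_sub_sinh]; exact Real.exp_pos _
    have h4 : 0 < Real.cosh s + Real.sinh s := by
      rw [Real.cosh_add_sinh]; exact Real.exp_pos _
    rw [sub_neg_eq_add, norm_merc_sub_northPole_sq, norm_merc_add_northPole_sq,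
      ← Real.log_mul (by positivity) (by positivity), ← Real.log_div (by norm_num) hL]
    congr 1
    field_simp
    linear_combination 4 * Real.cosh_sq s
  rw [vortexEnergy_symConfig g f hn, e1, e2, e3, energyConst]
  ring

theorem hasDerivAt_merc {θ s : ℝ → ℝ} {t a b : ℝ} (hθ : HasDerivAt θ a t) (hs : HasDerivAt s b t) :
    HasDerivAt (fun t => merc (θ t) (s t)) (mercTangent (θ t) (s t) a b) t := by
  have hc := (Real.cosh_pos (s t)).ne'
  rw [hasDerivAt_iff_hasFDerivAt, ← hasFDerivWithinAt_univ, hasFDerivWithinAt_euclidean]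
  intro i
  have key : HasDerivAt (fun t => merc (θ t) (s t) i) (mercTangent (θ t) (s t) a b i) t := by
    fin_cases i
    · simp only [merc, mercTangent, Fin.zero_eta, Matrix.cons_val_zero]
      refine (hθ.cos.div hs.cosh hc).congr_deriv ?_
      field_simp
    · simp only [merc, mercTangent, Fin.mk_one, Matrix.cons_val_one, Matrix.cons_val_zero]
      refine (hθ.sin.div hs.cosh hc).congr_deriv ?_
      field_simp
    · simp only [merc, mercTangent, Fin.reduceFinMk, Matrix.cons_val]
      refine (hs.sinh.div hs.cosh hc).congr_deriv ?_
      field_simp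
      linear_combination (b) * Real.cosh_sq (s t)
  rw [hasFDerivWithinAt_univ]
  refine key.hasFDerivAt.congr_fderiv ?_
  ext
  simp

theorem continuous_merc : Continuous fun p : ℝ × ℝ => merc p.1 p.2 := by
  have : ∀ p : ℝ × ℝ, Real.cosh p.2 ≠ 0 := fun p => (Real.cosh_pos _).ne'
  unfold merc
  refine (PiLp.continuous_toLp 2 _).comp (continuous_pi fun i => ?_)
  fin_cases i
  · simp; fun_prop (disch := exact this _)
  · simp; fun_prop (disch := exact this _)
  · simp; fun_prop (disch := exact this _)

theorem exists_rot_merc_eq {n : ℕ} (hn : 0 < n) (x : dihedral n) (θ s : ℝ) :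
    ∃ θ' s', rot x (merc θ s) = merc θ' s' := by
  rcases dihedral_cases hn x with ⟨k, hk⟩ | ⟨k, hk⟩
  · exact ⟨_, _, by rw [hk, rot_rotZ_merc]⟩
  · exact ⟨_, _, by rw [hk, rot_rotZ_mul_merc]⟩

theorem eq_one_of_rot_merc_eq {n : ℕ} (hn : 0 < n) (x : dihedral n) {θ s : ℝ}
    (h : 0 < mercD n θ s) (hx : rot x (merc θ s) = merc θ s) : x = 1 := by
  have hc := Real.cosh_pos s
  have h0 : ‖merc θ s - rot x (merc θ s)‖ ^ 2 = 0 := by rw [hx]; simp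
  rcases dihedral_cases hn x with ⟨k, hk⟩ | ⟨k, hk⟩
  · rw [hk, norm_merc_sub_rotZ_sq, div_eq_zero_iff] at h0
    have h1 : 1 - Real.cos (k * (2 * Real.pi / n)) = 0 := by
      simpa [hc.ne'] using h0
    have h2 : k = ⟨0, hn⟩ := eq_of_cos_eq_one _ _ (by simp; linarith)
    apply Subtype.ext
    rw [hk, h2]
    simp [rotZ_zero]
  · rw [hk, norm_merc_sub_flip_sq, div_eq_zero_iff] at h0
    exact (cosh_sub_cos_ne_zero h k (by
      have : Real.cosh (2 * s) - Real.cos (2 * θ + k * (2 * Real.pi / n)) = 0 := by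
        simpa [hc.ne'] using h0
      linarith)).elim

/-! ### From solutions of the reduced system to collision-free vortex solutions. -/

section Symmetric

variable {n : ℕ} (g : Fin (2 * n) ≃ dihedral n) (f : Fin 2 ≃ poles)

theorem norm_of_mem_poles {p : E3} (hp : p ∈ poles) : ‖p‖ = 1 := by
  rcases hp with rfl | rfl <;> simp [norm_northPole]

theorem merc_not_mem_poles (θ s : ℝ) : merc θ s ∉ poles := by
  rintro (h | h)
  · exact merc_ne_northPole _ _ h
  · exact merc_ne_neg_northPole _ _ h

theorem isCollisionFree_symConfig (hn : 0 < n) {θ s : ℝ} (h : 0 < mercD n θ s) :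
    IsCollisionFree (symConfig g f (merc θ s)) := by
  constructor
  · intro j
    refine Fin.addCases (fun a => ?_) (fun a => ?_) j
    · rw [symConfig_castAdd, norm_rot, norm_merc]
    · rw [symConfig_natAdd]; exact norm_of_mem_poles (f a).2
  · have hne : ∀ (a : Fin (2 * n)) (b : Fin 2), rot (g a) (merc θ s) ≠ f b := by
      intro a b hab
      obtain ⟨θ', s', h'⟩ := exists_rot_merc_eq hn (g a) θ s
      exact merc_not_mem_poles θ' s' (by rw [← h', hab]; exact (f b).2)
    intro i j
    refine Fin.addCases (fun a => ?_) (fun a => ?_) i <;>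
      refine Fin.addCases (fun b => ?_) (fun b => ?_) j <;>
      simp only [symConfig_castAdd, symConfig_natAdd]
    · intro hab
      have h1 : rot ((g a)⁻¹ * g b : dihedral n) (merc θ s) = merc θ s := by
        rw [Subgroup.coe_mul, Subgroup.coe_inv, rot_mul, ← hab, rot_inv_rot]
      have h2 := eq_one_of_rot_merc_eq hn _ h h1
      rw [inv_mul_eq_one] at h2
      rw [g.injective h2]
    · intro hab; exact (hne a b hab).elim
    · intro hab; exact (hne b a hab.symm).elim
    · intro hab
      rw [f.injective (Subtype.ext hab)]

theorem isVortexSolution_symConfig (hn : 2 ≤ n) {θ s : ℝ → ℝ}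
    (h : ∀ t, 0 < mercD n (θ t) (s t))
    (hθ : ∀ t, HasDerivAt θ (lonSpeed n (θ t) (s t)) t)
    (hs : ∀ t, HasDerivAt s (latSpeed n (θ t) (s t)) t) :
    IsVortexSolution fun t => symConfig g f (merc (θ t) (s t)) := by
  refine ⟨fun t => isCollisionFree_symConfig g f (by omega) (h t), fun t j => ?_⟩
  refine Fin.addCases (fun a => ?_) (fun a => ?_) j
  · rw [vortexField_symConfig_castAdd g f (by omega), symField_merc (by omega) (h t)]
    simp only [symConfig_castAdd]
    exact (rotLin (g a)).hasFDerivAt.comp_hasDerivAt t (hasDerivAt_merc (hθ t) (hs t))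
  · rw [vortexField_symConfig_natAdd g f hn]
    simp only [symConfig_natAdd]
    exact hasDerivAt_const _ _

theorem symConfig_injective (hn : 0 < n) : Function.Injective (symConfig g f) := by
  intro u v h
  have h1 := congrFun h (Fin.castAdd 2 ⟨0, by omega⟩)
  rw [symConfig_castAdd, symConfig_castAdd] at h1
  exact rot_injective _ h1

theorem dist_symConfig_le (u v : E3) : dist (symConfig g f u) (symConfig g f v) ≤ dist u v := by
  rw [dist_pi_le_iff dist_nonneg]
  intro j
  refine Fin.addCases (fun a => ?_) (fun a => ?_) j
  · rw [symConfig_castAdd, symConfig_castAdd, dist_eq_norm, norm_rot_sub, dist_eq_norm]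
  · rw [symConfig_natAdd, symConfig_natAdd, dist_self]; exact dist_nonneg

theorem continuous_symConfig : Continuous (symConfig g f) :=
  (LipschitzWith.of_dist_le_mul (K := 1) fun u v => by
    simpa using dist_symConfig_le g f u v).continuous

end Symmetric

/-- A polar system together with Mercator coordinates `Θ`, `S` on the punctured disc around `u₀`,
in which it becomes the reduced vortex system. -/
structure IsVortexChart (n : ℕ) (u₀ : E3) (Θ S : ℝ → ℝ → ℝ) (δ : ℝ) (K Kφ Kρ Ω : ℝ → ℝ → ℝ) :
    Prop extends IsPolarSystem δ K Kφ Kρ Ω where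
  noncollision : ∀ a, ∀ r ∈ Ioo 0 δ, 0 < mercD n (Θ a r) (S a r)
  chart_cont : ContinuousOn (fun p : ℝ × ℝ => merc (Θ p.1 p.2) (S p.1 p.2)) (univ ×ˢ Ioo 0 δ)
  chart_periodic : ∀ a, ∀ r ∈ Ioo 0 δ,
    merc (Θ (a + 2 * Real.pi) r) (S (a + 2 * Real.pi) r) = merc (Θ a r) (S a r)
  chart_inj : ∀ a a', ∀ r ∈ Ioo 0 δ, ∀ r' ∈ Ioo 0 δ,
    merc (Θ a r) (S a r) = merc (Θ a' r') (S a' r') → ∃ m : ℤ, a' = a + m * (2 * Real.pi)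
  chart_limit : ∀ ε > 0, ∃ η > 0, ∀ a, ∀ r ∈ Ioo 0 δ, r < η →
    dist (merc (Θ a r) (S a r)) u₀ < ε
  dynamics : ∀ (φ ρ : ℝ → ℝ) (t : ℝ), ρ t ∈ Ioo 0 δ → HasDerivAt φ (Ω (φ t) (ρ t)) t →
    HasDerivAt ρ (-(Kφ (φ t) (ρ t) / Kρ (φ t) (ρ t)) * Ω (φ t) (ρ t)) t →
    HasDerivAt (fun t => Θ (φ t) (ρ t)) (lonSpeed n (Θ (φ t) (ρ t)) (S (φ t) (ρ t))) t ∧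
    HasDerivAt (fun t => S (φ t) (ρ t)) (latSpeed n (Θ (φ t) (ρ t)) (S (φ t) (ρ t))) t

/-- The reparametrization `κ` from energy to level is left free, so that the same statement serves
energies decreasing to an equilibrium value and energies tending to infinity. -/
theorem IsVortexChart.exists_family {n : ℕ} (hn : 2 ≤ n) (g : Fin (2 * n) ≃ dihedral n)
    (f : Fin 2 ≃ poles) {u₀ : E3} {Θ S : ℝ → ℝ → ℝ} {δ : ℝ} {K Kφ Kρ Ω : ℝ → ℝ → ℝ}
    (hV : IsVortexChart n u₀ Θ S δ K Kφ Kρ Ω) {e : ℝ → ℝ}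
    (he : ∀ a, ∀ r ∈ Ioo 0 δ, vortexEnergy (symConfig g f (merc (Θ a r) (S a r))) = e (K a r)) :
    ∃ k₁ > 0, ∃ (φ ρ : ℝ → ℝ → ℝ) (T : ℝ → ℝ) (u : ℝ → ℝ → E3),
      (∀ k t, u k t = merc (Θ (φ k t) (ρ k t)) (S (φ k t) (ρ k t))) ∧
      (∀ (I : Set ℝ) (κ : ℝ → ℝ), ContinuousOn κ I → (∀ h ∈ I, κ h ∈ Ioo 0 k₁ ∧ e (κ h) = h) →
        IsPeriodicFamily I (fun h t => symConfig g f (u (κ h) t)) (fun h => T (κ h))) ∧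
      (∀ (l : Filter ℝ) (κ : ℝ → ℝ), Tendsto κ l (𝓝[>] 0) →
        TendstoUniformly (fun h t => symConfig g f (u (κ h) t)) (fun _ => symConfig g f u₀) l) ∧
      ((∀ M > 0, ∃ ε > 0, ∀ a, ∀ r ∈ Ioo 0 δ, r < ε → M ≤ Ω a r) → Tendsto T (𝓝[>] 0) (𝓝 0)) ∧
      (∀ k ∈ Ioo 0 k₁, Continuous (φ k) ∧ Continuous (ρ k) ∧ φ k (T k) = φ k 0 + 2 * Real.pi ∧ ρ k (T k) = ρ k 0 ∧
        (∀ t, ρ k t ∈ Ioo 0 δ ∧ K (φ k t) (ρ k t) = k) ∧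
        (∀ a, ∀ r ∈ Ioo 0 δ, K a r = k → ∃ t, φ k t = a ∧ ρ k t = r)) := by
  obtain ⟨k₁, hk₁, φ, ρ, T, hmain, hφc, hρc, hsmall, hT⟩ := hV.toIsPolarSystem.exists_periodic_motion
  refine ⟨k₁, hk₁, φ, ρ, T, fun k t => merc (Θ (φ k t) (ρ k t)) (S (φ k t) (ρ k t)),
    fun k t => rfl, fun I κ hκ hκI => ?_, fun l κ hκ => ?_, hT, fun k hk => ?_⟩
  · refine ⟨fun h hh => ?_, fun h hh t => ?_, fun h hh => ?_, ?_⟩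
    · obtain ⟨-, -, -, -, hd, -⟩ := hmain _ (hκI h hh).1
      have hdyn := fun t => hV.dynamics (φ (κ h)) (ρ (κ h)) t (hd t).1 (hd t).2.2.1 (hd t).2.2.2
      exact isVortexSolution_symConfig g f hn (fun t => hV.noncollision _ _ (hd t).1)
        (fun t => (hdyn t).1) (fun t => (hdyn t).2)
    · obtain ⟨-, -, -, -, hd, -⟩ := hmain _ (hκI h hh).1
      rw [he _ _ (hd t).1, (hd t).2.1, (hκI h hh).2]
    · obtain ⟨hT0, hmono, hφT, hρT, hd, -⟩ := hmain _ (hκI h hh).1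
      refine ⟨hT0, fun t => ?_, fun P hP hper => ?_⟩
      · simp only [hφT, hρT]
        rw [hV.chart_periodic _ _ (hd t).1]
      -- A period `P` brings the chart point back, so the angle has grown by 2πm; it increases
      -- strictly, hence m ≥ 1 and `P` is at least the time of one turn.
      · have h1 := symConfig_injective g f (by omega) (hper 0)
        obtain ⟨m, hm⟩ := hV.chart_inj _ _ _ (hd 0).1 _ (hd (0 + P)).1 h1.symm
        have h2 : φ (κ h) 0 < φ (κ h) (0 + P) := hmono (by linarith)
        have hm1 : (1 : ℤ) ≤ m := by
          by_contra hcon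
          have : m ≤ 0 := by omega
          have : (m : ℝ) ≤ 0 := by exact_mod_cast this
          nlinarith [Real.two_pi_pos]
        have hm2 : (1 : ℝ) ≤ m := by exact_mod_cast hm1
        have h3 : φ (κ h) (0 + T (κ h)) ≤ φ (κ h) (0 + P) := by
          rw [hφT, hm]; nlinarith [Real.two_pi_pos]
        simpa using hmono.le_iff_le.1 h3
    · have hmap : MapsTo (fun p : ℝ × ℝ => (κ p.1, p.2)) (I ×ˢ univ) (Ioo 0 k₁ ×ˢ univ) :=
        fun p hp => ⟨(hκI p.1 hp.1).1, mem_univ _⟩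
      have hκ' : ContinuousOn (fun p : ℝ × ℝ => (κ p.1, p.2)) (I ×ˢ univ) :=
        (hκ.comp continuousOn_fst fun p hp => hp.1).prodMk continuousOn_snd
      refine (continuous_symConfig g f).comp_continuousOn ?_
      refine hV.chart_cont.comp (f := fun p : ℝ × ℝ => (φ (κ p.1) p.2, ρ (κ p.1) p.2))
        ((hφc.comp hκ' hmap).prodMk (hρc.comp hκ' hmap)) fun p hp => ⟨mem_univ _, ?_⟩
      obtain ⟨-, -, -, -, hd, -⟩ := hmain _ (hκI p.1 hp.1).1
      exact (hd p.2).1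
  · rw [Metric.tendstoUniformly_iff]
    intro ε hε
    obtain ⟨η, hη, hlim⟩ := hV.chart_limit ε hε
    obtain ⟨k₂, hk₂, hρ⟩ := hsmall η hη
    filter_upwards [hκ (Ioo_mem_nhdsGT (lt_min hk₁ hk₂))] with h hh t
    have hk : κ h ∈ Ioo 0 k₁ := ⟨hh.1, hh.2.trans_le (min_le_left _ _)⟩
    obtain ⟨-, -, -, -, hd, -⟩ := hmain _ hk
    rw [dist_comm]
    exact (dist_symConfig_le g f _ _).trans_lt (hlim _ _ (hd t).1
      (hρ _ hk (hh.2.trans_le (min_le_right _ _)) t))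
  · obtain ⟨hT0, hmono, hφT, hρT, hd, hr⟩ := hmain _ hk
    refine ⟨continuous_iff_continuousAt.2 fun t => (hd t).2.2.1.continuousAt,
      continuous_iff_continuousAt.2 fun t => (hd t).2.2.2.continuousAt, ?_, ?_,
      fun t => ⟨(hd t).1, (hd t).2.1⟩, hr⟩
    · simpa using hφT 0
    · simpa using hρT 0

/-! ### Planar systems with the first integral `b² + q(y)` -/

/-- `b² + q(y)` in polar coordinates. -/
noncomputable def sqAdd (q : ℝ → ℝ) (a r : ℝ) : ℝ := (r * Real.cos a) ^ 2 + q (r * Real.sin a)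

/-- The angular derivative of `sqAdd q`, where `q'` is the derivative of `q`. -/
noncomputable def sqAddAngular (q' : ℝ → ℝ) (a r : ℝ) : ℝ :=
  r * (-(2 * (r * Real.cos a) * Real.sin a) + q' (r * Real.sin a) * Real.cos a)

/-- The radial derivative of `sqAdd q`, where `q'` is the derivative of `q`. -/
noncomputable def sqAddRadial (q' : ℝ → ℝ) (a r : ℝ) : ℝ :=
  2 * (r * Real.cos a) * Real.cos a + q' (r * Real.sin a) * Real.sin a

/-- The angular velocity of the planar system `b' = -w q'(y)`, `y' = 2wb`. -/
noncomputable def sqAddSpeed (q' : ℝ → ℝ) (w : ℝ → ℝ → ℝ) (a r : ℝ) : ℝ :=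
  w (r * Real.cos a) (r * Real.sin a) * sqAddRadial q' a r / r

theorem pos_of_mul_deriv_pos {q q' : ℝ → ℝ} {δ : ℝ} (hq : ∀ y, HasDerivAt q (q' y) y) (hq0 : q 0 = 0)
    (hsign : ∀ y, |y| < δ → y ≠ 0 → 0 < y * q' y) {y : ℝ} (hy : |y| < δ) (hy0 : y ≠ 0) : 0 < q y := by
  have hc : Continuous q := continuous_iff_continuousAt.2 fun y => (hq y).continuousAt
  rcases lt_or_gt_of_ne hy0 with h | h
  · have h1 : StrictAntiOn q (Icc y 0) := by
      refine strictAntiOn_of_deriv_neg (convex_Icc _ _) hc.continuousOn fun x hx => ?_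
      rw [interior_Icc] at hx
      rw [(hq x).deriv]
      have h2 := hsign x (by rw [abs_of_neg hx.2]; rw [abs_of_neg h] at hy; linarith [hx.1]) hx.2.ne
      exact neg_of_mul_pos_right h2 hx.2.le
    rw [← hq0]
    exact h1 ⟨le_rfl, h.le⟩ ⟨h.le, le_rfl⟩ h
  · have h1 : StrictMonoOn q (Icc 0 y) := by
      refine strictMonoOn_of_deriv_pos (convex_Icc _ _) hc.continuousOn fun x hx => ?_
      rw [interior_Icc] at hx
      rw [(hq x).deriv]
      have h2 := hsign x (by rw [abs_of_pos hx.1]; rw [abs_of_pos h] at hy; linarith [hx.2]) hx.1.ne'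
      exact pos_of_mul_pos_right h2 hx.1.le
    rw [← hq0]
    exact h1 ⟨le_rfl, h.le⟩ ⟨h.le, le_rfl⟩ h

theorem abs_mul_sin_lt {r δ : ℝ} (hr : r ∈ Ioo 0 δ) (a : ℝ) : |r * Real.sin a| < δ := by
  rw [abs_mul, abs_of_pos hr.1]
  have := Real.abs_sin_le_one a
  nlinarith [hr.1, hr.2, abs_nonneg (Real.sin a)]

theorem abs_mul_cos_lt {r δ : ℝ} (hr : r ∈ Ioo 0 δ) (a : ℝ) : |r * Real.cos a| < δ := by
  rw [abs_mul, abs_of_pos hr.1]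
  have := Real.abs_cos_le_one a
  nlinarith [hr.1, hr.2, abs_nonneg (Real.cos a)]

/-- With b = r cos a and y = r sin a, r times the radial derivative of b² + q(y) is 2b² + y q'(y),
positive under the sign condition. Nondegeneracy of the minimum of `q` is not required. -/
theorem isPolarSystem_sqAdd {q q' : ℝ → ℝ} {w : ℝ → ℝ → ℝ} {δ : ℝ} (hδ : 0 < δ)
    (hq : ∀ y, HasDerivAt q (q' y) y) (hq' : Continuous q') (hq0 : q 0 = 0)
    (hsign : ∀ y, |y| < δ → y ≠ 0 → 0 < y * q' y)
    (hw : ∀ a, ∀ r ∈ Ioo 0 δ, 0 < w (r * Real.cos a) (r * Real.sin a))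
    (hwc : ContinuousOn (fun p : ℝ × ℝ => w (p.2 * Real.cos p.1) (p.2 * Real.sin p.1))
      (univ ×ˢ Ioo 0 δ)) :
    IsPolarSystem δ (sqAdd q) (sqAddAngular q') (sqAddRadial q') (sqAddSpeed q' w) := by
  have hrad : ∀ a, ∀ r ∈ Ioo 0 δ, 0 < sqAddRadial q' a r := by
    intro a r hr
    have h1 : 0 < r * sqAddRadial q' a r := by
      have h2 : r * sqAddRadial q' a r =
          2 * (r * Real.cos a) ^ 2 + (r * Real.sin a) * q' (r * Real.sin a) := by
        unfold sqAddRadial; ring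
      rw [h2]
      by_cases h0 : r * Real.sin a = 0
      · rw [h0, zero_mul, add_zero]
        have hs : Real.sin a = 0 := (mul_eq_zero.1 h0).resolve_left hr.1.ne'
        have : Real.cos a ≠ 0 := fun hc => by
          have := Real.sin_sq_add_cos_sq a; rw [hs, hc] at this; norm_num at this
        have := hr.1
        positivity
      · have := hsign _ (abs_mul_sin_lt hr a) h0
        positivity
    exact pos_of_mul_pos_right h1 hr.1.le
  refine ⟨hδ, fun a r hr => ?_, hrad, fun a r hr => ?_, fun ε hε => ?_, fun a r => ?_, ?_,
    fun a r hr => ?_, fun a r => ?_⟩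
  · have hr1 : HasFDerivAt (fun p : ℝ × ℝ => p.2) (ContinuousLinearMap.snd ℝ ℝ ℝ) (a, r) :=
      hasFDerivAt_snd
    have ha1 : HasFDerivAt (fun p : ℝ × ℝ => p.1) (ContinuousLinearMap.fst ℝ ℝ ℝ) (a, r) :=
      hasFDerivAt_fst
    have h1 := ((hr1.mul ha1.cos).pow 2)
    have h2 := (hq (r * Real.sin a)).comp_hasFDerivAt (a, r) (hr1.mul ha1.sin)
    refine (h1.add h2).congr_fderiv ?_
    ext
    · simp [sqAddAngular, sqAddRadial]; ring
    · simp [sqAddAngular, sqAddRadial]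
  · unfold sqAdd
    by_cases h0 : r * Real.sin a = 0
    · have hs : Real.sin a = 0 := (mul_eq_zero.1 h0).resolve_left hr.1.ne'
      have : Real.cos a ≠ 0 := fun hc => by
        have := Real.sin_sq_add_cos_sq a; rw [hs, hc] at this; norm_num at this
      have := hr.1
      rw [h0, hq0]
      positivity
    · have := pos_of_mul_deriv_pos hq hq0 hsign (abs_mul_sin_lt hr a) h0
      positivity
  · obtain ⟨η, hη, hlim⟩ := Metric.continuousAt_iff.1 (hq 0).continuousAt (ε / 2) (by positivity)
    -- The bound η/2 makes |q| < ε/2, while r ≤ 1 and r ≤ ε/4 make (r cos a)² ≤ ε/4.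
    set r := min (δ / 2) (min (η / 2) (min 1 (ε / 4)))
    have hr0 : 0 < r := by positivity
    have hr1 : r ≤ δ / 2 := min_le_left _ _
    have hr2 : r ≤ η / 2 := (min_le_right _ _).trans (min_le_left _ _)
    have hr3 : r ≤ 1 := (min_le_right _ _).trans ((min_le_right _ _).trans (min_le_left _ _))
    have hr4 : r ≤ ε / 4 := (min_le_right _ _).trans ((min_le_right _ _).trans (min_le_right _ _))
    refine ⟨r, ⟨hr0, by linarith⟩, fun a => ?_⟩
    have h1 := hlim (x := r * Real.sin a) (by
      rw [Real.dist_eq, sub_zero]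
      exact abs_mul_sin_lt ⟨hr0, by linarith⟩ a)
    rw [Real.dist_eq, hq0, sub_zero] at h1
    have h2 := (abs_lt.1 h1).2
    have h3 : (r * Real.cos a) ^ 2 ≤ ε / 4 := by
      have := Real.cos_sq_le_one a
      rw [mul_pow]
      nlinarith [sq_nonneg (Real.cos a), sq_nonneg r]
    unfold sqAdd
    linarith
  · simp [sqAdd]
  · have hne : ∀ p ∈ (univ ×ˢ Ioo 0 δ : Set (ℝ × ℝ)), p.2 ≠ 0 := fun p hp => hp.2.1.ne'
    unfold sqAddSpeed sqAddRadial
    exact ContinuousOn.div (hwc.mul (by fun_prop)) continuousOn_snd hne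
  · exact div_pos (mul_pos (hw a r hr) (hrad a r hr)) hr.1
  · simp [sqAddSpeed, sqAddRadial]

/-- Back from polar to Cartesian coordinates: motion on a level curve with angular velocity
`sqAddSpeed` is the Hamiltonian-type system b' = −w q'(y), y' = 2wb. -/
theorem hasDerivAt_sqAdd_coords {q' : ℝ → ℝ} {w : ℝ → ℝ → ℝ} {φ ρ : ℝ → ℝ} {t : ℝ}
    (hρ0 : ρ t ≠ 0) (hrad : sqAddRadial q' (φ t) (ρ t) ≠ 0)
    (hφ : HasDerivAt φ (sqAddSpeed q' w (φ t) (ρ t)) t)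
    (hρ : HasDerivAt ρ (-(sqAddAngular q' (φ t) (ρ t) / sqAddRadial q' (φ t) (ρ t)) *
      sqAddSpeed q' w (φ t) (ρ t)) t) :
    HasDerivAt (fun t => ρ t * Real.cos (φ t))
        (-(w (ρ t * Real.cos (φ t)) (ρ t * Real.sin (φ t)) * q' (ρ t * Real.sin (φ t)))) t ∧
      HasDerivAt (fun t => ρ t * Real.sin (φ t))
        (w (ρ t * Real.cos (φ t)) (ρ t * Real.sin (φ t)) * (2 * (ρ t * Real.cos (φ t)))) t := by
  have hρ' : -(sqAddAngular q' (φ t) (ρ t) / sqAddRadial q' (φ t) (ρ t)) *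
      sqAddSpeed q' w (φ t) (ρ t) = -(w (ρ t * Real.cos (φ t)) (ρ t * Real.sin (φ t)) *
        (-(2 * (ρ t * Real.cos (φ t)) * Real.sin (φ t)) +
          q' (ρ t * Real.sin (φ t)) * Real.cos (φ t))) := by
    unfold sqAddSpeed sqAddAngular
    field_simp
  have hΩ : ρ t * sqAddSpeed q' w (φ t) (ρ t) = w (ρ t * Real.cos (φ t)) (ρ t * Real.sin (φ t)) *
      (2 * (ρ t * Real.cos (φ t)) * Real.cos (φ t) +
        q' (ρ t * Real.sin (φ t)) * Real.sin (φ t)) := by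
    unfold sqAddSpeed sqAddRadial
    field_simp
  rw [hρ'] at hρ
  have h1 := Real.sin_sq_add_cos_sq (φ t)
  constructor
  · refine (hρ.mul hφ.cos).congr_deriv ?_
    generalize sqAddSpeed q' w (φ t) (ρ t) = Ω at *
    generalize w (ρ t * Real.cos (φ t)) (ρ t * Real.sin (φ t)) = W at *
    generalize q' (ρ t * Real.sin (φ t)) = Q at *
    linear_combination (-Real.sin (φ t)) * hΩ - W * Q * h1
  · refine (hρ.mul hφ.sin).congr_deriv ?_
    generalize sqAddSpeed q' w (φ t) (ρ t) = Ω at *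
    generalize w (ρ t * Real.cos (φ t)) (ρ t * Real.sin (φ t)) = W at *
    generalize q' (ρ t * Real.sin (φ t)) = Q at *
    linear_combination (Real.cos (φ t)) * hΩ + 2 * W * ρ t * Real.cos (φ t) * h1

theorem merc_injective {θ s θ' s' : ℝ} (h : merc θ s = merc θ' s') :
    s = s' ∧ Real.cos (θ - θ') = 1 := by
  have h0 : merc θ s 0 = merc θ' s' 0 := by rw [h]
  have h1 : merc θ s 1 = merc θ' s' 1 := by rw [h]
  have h2 : merc θ s 2 = merc θ' s' 2 := by rw [h]
  simp [merc, ← Real.tanh_eq_sinh_div_cosh] at h0 h1 h2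
  have hs := Real.tanh_injective h2
  subst hs
  have hc := (Real.cosh_pos s).ne'
  rw [div_left_inj' hc] at h0 h1
  refine ⟨rfl, ?_⟩
  rw [Real.cos_sub, h0, h1]
  linear_combination Real.sin_sq_add_cos_sq θ'

/-! ### Charts around the points of longitude `θ₀` with `cos 2nθ₀ = ±1` -/

/-- The function `cosh s ^ (2n+1)`. -/
noncomputable def cellC (n : ℕ) (s : ℝ) : ℝ := Real.cosh s ^ (2 * n + 1)

theorem cellC_pos (n : ℕ) (s : ℝ) : 0 < cellC n s := pow_pos (Real.cosh_pos s) _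

theorem hasDerivAt_cellC (n : ℕ) (s : ℝ) :
    HasDerivAt (cellC n) ((2 * n + 1) * cellC n s * Real.sinh s / Real.cosh s) s := by
  have hc := (Real.cosh_pos s).ne'
  refine ((Real.hasDerivAt_cosh s).pow (2 * n + 1)).congr_deriv ?_
  simp only [cellC, Nat.add_sub_cancel, pow_succ]
  push_cast
  field_simp

theorem continuous_cellC (n : ℕ) : Continuous (cellC n) := by unfold cellC; fun_prop

/-- The function `(cosh 2ns - κ) / (2 cosh s ^ (4n+2))`. -/
noncomputable def cellQ (n : ℕ) (κ s : ℝ) : ℝ :=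
  (Real.cosh (n * (2 * s)) - κ) / (2 * cellC n s ^ 2)

/-- The derivative of `cellQ`. -/
noncomputable def cellQ' (n : ℕ) (κ s : ℝ) : ℝ :=
  (n * Real.sinh (n * (2 * s)) -
    (2 * n + 1) * (Real.cosh (n * (2 * s)) - κ) * Real.sinh s / Real.cosh s) / cellC n s ^ 2

theorem hasDerivAt_cellQ (n : ℕ) (κ s : ℝ) : HasDerivAt (cellQ n κ) (cellQ' n κ s) s := by
  have hc := (Real.cosh_pos s).ne'
  have hC := (cellC_pos n s).ne'
  have h1 := ((((hasDerivAt_id' s).const_mul (2 : ℝ)).const_mul (n : ℝ)).cosh.sub_const κ).div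
    (((hasDerivAt_cellC n s).pow 2).const_mul 2) (by simp [hC])
  refine h1.congr_deriv ?_
  unfold cellQ'
  simp
  field_simp

theorem continuous_cellQ' (n : ℕ) (κ : ℝ) : Continuous (cellQ' n κ) := by
  have h1 : ∀ s, Real.cosh s ≠ 0 := fun s => (Real.cosh_pos s).ne'
  have h2 : ∀ s, cellC n s ^ 2 ≠ 0 := fun s => (pow_pos (cellC_pos n s) 2).ne'
  have h3 := continuous_cellC n
  unfold cellQ'
  fun_prop (disch := first | exact h1 _ | exact h2 _ | (intro x; exact h1 x) | (intro x; exact h2 x))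

/-- The denominator `mercD` in the chart around `(θ₀, s₀)`. -/
noncomputable def cellD (n : ℕ) (κ b s : ℝ) : ℝ :=
  Real.cosh (n * (2 * s)) - κ * (1 - 2 * (b * cellC n s) ^ 2)

/-- The longitude in the chart around `(θ₀, s₀)`. -/
noncomputable def cellTheta (n : ℕ) (θ₀ b s : ℝ) : ℝ := θ₀ + Real.arcsin (b * cellC n s) / n

/-- The time change in the chart around `(θ₀, s₀)`. -/
noncomputable def cellW (n : ℕ) (κ b s : ℝ) : ℝ :=
  n * Real.cosh s ^ 2 * √(1 - (b * cellC n s) ^ 2) * cellC n s / (2 * cellD n κ b s)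

/-- Here sin 2nθ₀ = 0 and n(θ − θ₀) = arcsin(bC) with C = `cellC n s`, so double-angle formulas give
cos 2nθ = κ(1 − 2b²C²). Dividing D by C² then yields the separated form 2κb² + 2Q(s). -/
theorem mercD_cellTheta {n : ℕ} (hn : 0 < n) {κ θ₀ b s : ℝ} (hκ : κ ^ 2 = 1)
    (hθ : Real.cos (n * (2 * θ₀)) = κ) (hb : |b * cellC n s| ≤ 1) :
    mercD n (cellTheta n θ₀ b s) s = cellD n κ b s ∧
    Real.sin (n * (2 * cellTheta n θ₀ b s)) =
      2 * κ * (b * cellC n s) * √(1 - (b * cellC n s) ^ 2) := by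
  have hn' : (n : ℝ) ≠ 0 := by positivity
  have hb' := abs_le.1 hb
  have hsin0 : Real.sin (n * (2 * θ₀)) = 0 := by
    have := Real.sin_sq_add_cos_sq (n * (2 * θ₀))
    rw [hθ, hκ] at this
    exact pow_eq_zero_iff two_ne_zero |>.1 (by linarith)
  have e : n * (2 * cellTheta n θ₀ b s) = n * (2 * θ₀) + 2 * Real.arcsin (b * cellC n s) := by
    unfold cellTheta; field_simp
  have hsq : √(1 - (b * cellC n s) ^ 2) ^ 2 = 1 - (b * cellC n s) ^ 2 :=
    Real.sq_sqrt (by nlinarith [sq_abs (b * cellC n s), abs_nonneg (b * cellC n s)])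
  constructor
  · unfold mercD cellD
    rw [e, Real.cos_add, hθ, hsin0, Real.cos_two_mul, Real.cos_arcsin, hsq]
    ring
  · rw [e, Real.sin_add, hθ, hsin0, Real.sin_two_mul, Real.cos_arcsin,
      Real.sin_arcsin hb'.1 hb'.2]
    ring

/-- Parameters for which the chart around `(θ₀, s₀)` is defined on a disc of radius `δ`. -/
structure IsCell (n : ℕ) (κ θ₀ s₀ δ : ℝ) : Prop where
  two_le : 2 ≤ n
  κ_sq : κ ^ 2 = 1
  cos_eq : Real.cos (n * (2 * θ₀)) = κ
  radius_pos : 0 < δ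
  radius_le : δ * cellC n (|s₀| + δ) ≤ 1
  denom_pos : ∀ a, ∀ r ∈ Ioo 0 δ, 0 < cellD n κ (r * Real.cos a) (s₀ + κ * (r * Real.sin a))
  deriv_sign : ∀ y, |y| < δ → y ≠ 0 → 0 < y * cellQ' n κ (s₀ + κ * y)

theorem cellC_le_of_abs_le {n : ℕ} {s s' : ℝ} (h : |s| ≤ |s'|) : cellC n s ≤ cellC n s' :=
  pow_le_pow_left₀ (Real.cosh_pos s).le (Real.cosh_le_cosh.2 h) _

namespace IsCell

variable {n : ℕ} {κ θ₀ s₀ δ : ℝ}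

theorem abs_κ (h : IsCell n κ θ₀ s₀ δ) : |κ| = 1 := by
  have := sq_abs κ
  rw [h.κ_sq] at this
  nlinarith [abs_nonneg κ]

theorem abs_lat_le (h : IsCell n κ θ₀ s₀ δ) (a : ℝ) {r : ℝ} (hr : r ∈ Ioo 0 δ) :
    |s₀ + κ * (r * Real.sin a)| ≤ |s₀| + δ := by
  refine (abs_add_le _ _).trans (add_le_add le_rfl ?_)
  rw [abs_mul, h.abs_κ, one_mul]
  exact (abs_mul_sin_lt hr a).le

/-- Keeps the argument of `arcsin` in the open interval, where it is differentiable and the square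
root in `cellW` is positive. -/
theorem abs_lt_one (h : IsCell n κ θ₀ s₀ δ) (a : ℝ) {r : ℝ} (hr : r ∈ Ioo 0 δ) :
    |r * Real.cos a * cellC n (s₀ + κ * (r * Real.sin a))| < 1 := by
  rw [abs_mul, abs_of_pos (cellC_pos n _)]
  have h1 : cellC n (s₀ + κ * (r * Real.sin a)) ≤ cellC n (|s₀| + δ) :=
    cellC_le_of_abs_le ((h.abs_lat_le a hr).trans (le_abs_self _))
  have h2 := abs_mul_cos_lt hr a
  have h3 := h.radius_le
  calc |r * Real.cos a| * cellC n (s₀ + κ * (r * Real.sin a))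
      < δ * cellC n (s₀ + κ * (r * Real.sin a)) := by
        exact mul_lt_mul_of_pos_right h2 (cellC_pos n _)
    _ ≤ δ * cellC n (|s₀| + δ) := mul_le_mul_of_nonneg_left h1 h.radius_pos.le
    _ ≤ 1 := h3

theorem continuous_chart (n : ℕ) (κ θ₀ s₀ : ℝ) : Continuous fun p : ℝ × ℝ =>
    merc (cellTheta n θ₀ p.1 (s₀ + κ * p.2)) (s₀ + κ * p.2) := by
  have h3 := continuous_cellC n
  have h4 := Real.continuous_arcsin
  refine continuous_merc.comp (f := fun p : ℝ × ℝ =>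
    (cellTheta n θ₀ p.1 (s₀ + κ * p.2), s₀ + κ * p.2)) ?_
  unfold cellTheta
  fun_prop

/-- The latitude is s₀ + κy. With this sign the potential κ(Q(s₀ + κy) − Q(s₀)) has derivative κ²Q'
= Q' at s₀ + κy, and for κ = −1 a maximum of Q becomes a minimum of the potential, so one treatment
covers both signs. -/
theorem isVortexChart (h : IsCell n κ θ₀ s₀ δ) :
    IsVortexChart n (merc θ₀ s₀)
      (fun a r => cellTheta n θ₀ (r * Real.cos a) (s₀ + κ * (r * Real.sin a)))
      (fun a r => s₀ + κ * (r * Real.sin a)) δ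
      (sqAdd fun y => κ * (cellQ n κ (s₀ + κ * y) - cellQ n κ s₀))
      (sqAddAngular fun y => cellQ' n κ (s₀ + κ * y))
      (sqAddRadial fun y => cellQ' n κ (s₀ + κ * y))
      (sqAddSpeed (fun y => cellQ' n κ (s₀ + κ * y)) fun b y => cellW n κ b (s₀ + κ * y)) := by
  have hn : 0 < n := by have := h.two_le; omega
  have hn' : (0 : ℝ) < n := by positivity
  have hnc : Continuous (cellC n) := continuous_cellC n
  have hsqrt : ∀ a, ∀ r ∈ Ioo 0 δ,
      0 < 1 - (r * Real.cos a * cellC n (s₀ + κ * (r * Real.sin a))) ^ 2 := fun a r hr => by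
    have := h.abs_lt_one a hr
    rw [← sq_abs]
    nlinarith [abs_nonneg (r * Real.cos a * cellC n (s₀ + κ * (r * Real.sin a)))]
  have hW : ∀ a, ∀ r ∈ Ioo 0 δ,
      0 < cellW n κ (r * Real.cos a) (s₀ + κ * (r * Real.sin a)) := fun a r hr => by
    have h1 := h.denom_pos a r hr
    have h2 := Real.sqrt_pos.2 (hsqrt a r hr)
    have h3 := cellC_pos n (s₀ + κ * (r * Real.sin a))
    have h4 := Real.cosh_pos (s₀ + κ * (r * Real.sin a))
    unfold cellW
    positivity
  have hpolar := isPolarSystem_sqAdd (q := fun y => κ * (cellQ n κ (s₀ + κ * y) - cellQ n κ s₀))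
    (q' := fun y => cellQ' n κ (s₀ + κ * y)) (w := fun b y => cellW n κ b (s₀ + κ * y))
    h.radius_pos (fun y => by
      have h1 := (((hasDerivAt_cellQ n κ (s₀ + κ * y)).comp y
        (((hasDerivAt_id' y).const_mul κ).const_add s₀)).sub_const (cellQ n κ s₀)).const_mul κ
      refine h1.congr_deriv ?_
      linear_combination (cellQ' n κ (s₀ + κ * y)) * h.κ_sq)
    ((continuous_cellQ' n κ).comp (by fun_prop)) (by simp) h.deriv_sign hW (by
      unfold cellW
      refine ContinuousOn.div (by fun_prop) (by unfold cellD; fun_prop) fun p hp => ?_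
      exact (mul_pos two_pos (h.denom_pos p.1 p.2 hp.2)).ne')
  refine ⟨hpolar, fun a r hr => ?_, ?_, fun a r hr => ?_, fun a a' r hr r' hr' heq => ?_,
    fun ε hε => ?_, fun φ ρ t hρt hφ hρ => ?_⟩
  · rw [(mercD_cellTheta hn h.κ_sq h.cos_eq (h.abs_lt_one a hr).le).1]
    exact h.denom_pos a r hr
  · exact ((continuous_chart n κ θ₀ s₀).comp
      (by fun_prop : Continuous fun p : ℝ × ℝ =>
        (p.2 * Real.cos p.1, p.2 * Real.sin p.1))).continuousOn
  · simp
  · obtain ⟨h1, h2⟩ := merc_injective heq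
    have hκ0 : κ ≠ 0 := fun h0 => by have := h.κ_sq; rw [h0] at this; norm_num at this
    have hy : r * Real.sin a = r' * Real.sin a' := mul_left_cancel₀ hκ0 (by linarith)
    -- Both longitudes differ from θ₀ by at most π/(2n), so they differ from each other by at most
    -- π; being congruent modulo 2π they are equal.
    have hb : r * Real.cos a = r' * Real.cos a' := by
      have g1 := abs_le.1 (h.abs_lt_one a hr).le
      have g2 := abs_le.1 (h.abs_lt_one a' hr').le
      rw [← hy] at g2 h2
      generalize r * Real.cos a = b at *
      generalize r' * Real.cos a' = b' at *
      generalize s₀ + κ * (r * Real.sin a) = s at *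
      have e1 := Real.neg_pi_div_two_le_arcsin (b * cellC n s)
      have e2 := Real.arcsin_le_pi_div_two (b * cellC n s)
      have e3 := Real.neg_pi_div_two_le_arcsin (b' * cellC n s)
      have e4 := Real.arcsin_le_pi_div_two (b' * cellC n s)
      have hdiff : cellTheta n θ₀ b s - cellTheta n θ₀ b' s =
          (Real.arcsin (b * cellC n s) - Real.arcsin (b' * cellC n s)) / n := by
        unfold cellTheta; ring
      have hn1 : (1 : ℝ) ≤ n := by exact_mod_cast hn
      have hpi := Real.pi_pos
      have habs : |(Real.arcsin (b * cellC n s) - Real.arcsin (b' * cellC n s)) / n| ≤ Real.pi := by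
        rw [abs_div, abs_of_pos hn', div_le_iff₀ hn']
        have : |Real.arcsin (b * cellC n s) - Real.arcsin (b' * cellC n s)| ≤ Real.pi := by
          rw [abs_le]; constructor <;> linarith
        nlinarith
      have habs' := abs_le.1 habs
      have h3 := (Real.cos_eq_one_iff_of_lt_of_lt (by rw [hdiff]; linarith)
        (by rw [hdiff]; linarith)).1 h2
      rw [hdiff, div_eq_zero_iff] at h3
      have h4 : Real.arcsin (b * cellC n s) = Real.arcsin (b' * cellC n s) := by
        rcases h3 with h3 | h3
        · linarith
        · exact absurd h3 hn'.ne'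
      have h5 := congrArg Real.sin h4
      rw [Real.sin_arcsin g1.1 g1.2, Real.sin_arcsin g2.1 g2.2] at h5
      exact mul_right_cancel₀ (cellC_pos n s).ne' h5
    have hrr : r = r' := by
      have : r ^ 2 = r' ^ 2 := by
        have t1 := Real.sin_sq_add_cos_sq a
        have t2 := Real.sin_sq_add_cos_sq a'
        calc r ^ 2 = (r * Real.sin a) ^ 2 + (r * Real.cos a) ^ 2 := by
              linear_combination (-r ^ 2) * t1
          _ = r' ^ 2 := by rw [hy, hb]; linear_combination (r' ^ 2) * t2
      exact (pow_left_inj₀ hr.1.le hr'.1.le two_ne_zero).1 this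
    subst hrr
    have hs := mul_left_cancel₀ hr.1.ne' hy
    have hc := mul_left_cancel₀ hr.1.ne' hb
    obtain ⟨m, hm⟩ := (Real.cos_eq_one_iff (a' - a)).1 (by
      rw [Real.cos_sub, hs, hc]; linear_combination Real.sin_sq_add_cos_sq a')
    exact ⟨m, by linarith⟩
  · obtain ⟨η, hη, hlim⟩ := Metric.continuousAt_iff.1
      ((continuous_chart n κ θ₀ s₀).continuousAt (x := (0, 0))) ε hε
    refine ⟨η, hη, fun a r hr hrη => ?_⟩
    have h1 := hlim (x := (r * Real.cos a, r * Real.sin a)) (by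
      rw [Prod.dist_eq, max_lt_iff]
      simp only [Real.dist_eq, sub_zero]
      exact ⟨abs_mul_cos_lt ⟨hr.1, hrη⟩ a, abs_mul_sin_lt ⟨hr.1, hrη⟩ a⟩)
    simpa [cellTheta] using h1
  · obtain ⟨hb, hy⟩ := hasDerivAt_sqAdd_coords hρt.1.ne' (hpolar.radial_pos _ _ hρt).ne' hφ hρ
    obtain ⟨eD, eS⟩ := mercD_cellTheta hn h.κ_sq h.cos_eq (h.abs_lt_one (φ t) hρt).le
    have hlt := abs_lt.1 (h.abs_lt_one (φ t) hρt)
    have hD := (h.denom_pos (φ t) (ρ t) hρt).ne'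
    have hS2 := (Real.sqrt_pos.2 (hsqrt (φ t) _ hρt)).ne'
    have hs : HasDerivAt (fun t => s₀ + κ * (ρ t * Real.sin (φ t)))
        (latSpeed n (cellTheta n θ₀ (ρ t * Real.cos (φ t)) (s₀ + κ * (ρ t * Real.sin (φ t))))
          (s₀ + κ * (ρ t * Real.sin (φ t)))) t := by
      refine ((hy.const_mul κ).const_add s₀).congr_deriv ?_
      unfold latSpeed cellW
      rw [eD, eS]
      field_simp
    refine ⟨?_, hs⟩
    have hθ := ((((Real.hasDerivAt_arcsin hlt.1.ne' hlt.2.ne).comp t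
      (hb.mul ((hasDerivAt_cellC n _).comp t hs))).div_const (n : ℝ)).const_add θ₀)
    refine hθ.congr_deriv ?_
    unfold lonSpeed latSpeed
    rw [eD, eS]
    unfold cellW cellQ'
    have hc := (Real.cosh_pos (s₀ + κ * (ρ t * Real.sin (φ t)))).ne'
    have hC := (cellC_pos n (s₀ + κ * (ρ t * Real.sin (φ t)))).ne'
    have hDdef : cellD n κ (ρ t * Real.cos (φ t)) (s₀ + κ * (ρ t * Real.sin (φ t))) =
      Real.cosh (n * (2 * (s₀ + κ * (ρ t * Real.sin (φ t))))) - κ *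
        (1 - 2 * (ρ t * Real.cos (φ t) * cellC n (s₀ + κ * (ρ t * Real.sin (φ t)))) ^ 2) := rfl
    simp only [Function.comp]
    generalize s₀ + κ * (ρ t * Real.sin (φ t)) = s at *
    generalize ρ t * Real.cos (φ t) = b at *
    generalize cellD n κ b s = D at *
    generalize √(1 - (b * cellC n s) ^ 2) = R at *
    field_simp
    rw [hDdef]
    ring_nf

theorem energy_eq (h : IsCell n κ θ₀ s₀ δ) (g : Fin (2 * n) ≃ dihedral n) (f : Fin 2 ≃ poles)
    (a : ℝ) {r : ℝ} (hr : r ∈ Ioo 0 δ) :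
    vortexEnergy (symConfig g f
      (merc (cellTheta n θ₀ (r * Real.cos a) (s₀ + κ * (r * Real.sin a)))
        (s₀ + κ * (r * Real.sin a)))) = energyConst n - n / 2 * Real.log (2 * κ *
          sqAdd (fun y => κ * (cellQ n κ (s₀ + κ * y) - cellQ n κ s₀)) a r + 2 * cellQ n κ s₀) := by
  have hn : 0 < n := by have := h.two_le; omega
  have hD := h.denom_pos a r hr
  obtain ⟨eD, -⟩ := mercD_cellTheta hn h.κ_sq h.cos_eq (h.abs_lt_one a hr).le
  rw [vortexEnergy_symConfig_merc hn g f (by rw [eD]; exact hD), eD]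
  congr 2
  have hC := cellC_pos n (s₀ + κ * (r * Real.sin a))
  rw [show (2 * (n : ℝ) + 1) * Real.log (Real.cosh (s₀ + κ * (r * Real.sin a)) ^ 2) =
      Real.log (cellC n (s₀ + κ * (r * Real.sin a)) ^ 2) by
    rw [cellC, ← pow_mul, mul_comm (2 * n + 1) 2, pow_mul _ 2 (2 * n + 1),
      Real.log_pow _ (2 * n + 1)]
    push_cast; ring, ← Real.log_div hD.ne' (by positivity)]
  congr 1
  simp only [sqAdd]
  have hκ := h.κ_sq
  have hQ : cellQ n κ (s₀ + κ * (r * Real.sin a)) * (2 * cellC n (s₀ + κ * (r * Real.sin a)) ^ 2) =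
      Real.cosh (n * (2 * (s₀ + κ * (r * Real.sin a)))) - κ := by
    have := hC.ne'
    unfold cellQ
    rw [div_mul_cancel₀ _ (by positivity)]
  rw [div_eq_iff (by positivity)]
  unfold cellD
  generalize cellQ n κ (s₀ + κ * (r * Real.sin a)) = Q at *
  generalize cellQ n κ s₀ = Q₀ at *
  generalize cellC n (s₀ + κ * (r * Real.sin a)) = C at *
  linear_combination (-1) * hQ - 2 * (Q - Q₀) * C ^ 2 * hκ

end IsCell

/-! ### Winding numbers -/

theorem WindsAround.rot {p : E3} {c : ℝ → E3} {T : ℝ} {k : ℤ} (h : WindsAround p c T k) (x : SO3) :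
    WindsAround (rot x p) (fun t => rot x (c t)) T k := by
  obtain ⟨e₁, e₂, h1, h2, h3, h4, h5, r, φ, hφ, hr, hk⟩ := h
  exact ⟨_root_.rot x e₁, _root_.rot x e₂, by rw [norm_rot, h1], by rw [norm_rot, h2],
    by rw [inner_rot, h3], by rw [cross3_rot, h4], by simp only [h5], r, φ, hφ,
    fun t => by simpa only [inner_rot] using hr t, hk⟩

/-- In the frame turned by `ψ` the projected curve has a positive first component `P`, hence polar
angle arctan(Q/P) within a quarter turn. Adding `ψ` gives a continuous polar angle, and the
arctangent takes the same value at both ends. -/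
theorem windsAround_of_pos {p e₁ e₂ : E3} {c : ℝ → E3} {T : ℝ} {k : ℤ} {ψ : ℝ → ℝ}
    (h1 : ‖e₁‖ = 1) (h2 : ‖e₂‖ = 1) (h3 : inner ℝ e₁ e₂ = 0) (h4 : cross3 e₁ e₂ = p)
    (hc : Continuous c) (hψ : Continuous ψ) (hcT : c T = c 0)
    (hpos : ∀ t, 0 < inner ℝ e₁ (c t) * Real.cos (ψ t) + inner ℝ e₂ (c t) * Real.sin (ψ t))
    (hψT : ψ T = ψ 0 + k * (2 * Real.pi)) : WindsAround p c T k := by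
  set P := fun t => inner ℝ e₁ (c t) * Real.cos (ψ t) + inner ℝ e₂ (c t) * Real.sin (ψ t) with hP
  set Q := fun t => inner ℝ e₂ (c t) * Real.cos (ψ t) - inner ℝ e₁ (c t) * Real.sin (ψ t) with hQ
  have hPc : Continuous P := by fun_prop
  have hQc : Continuous Q := by fun_prop
  refine ⟨e₁, e₂, h1, h2, h3, h4, hcT, fun t => P t * √(1 + (Q t / P t) ^ 2),
    fun t => ψ t + Real.arctan (Q t / P t), ?_, fun t => ?_, ?_⟩
  · exact hψ.add (Real.continuous_arctan.comp (hQc.div hPc fun t => (hpos t).ne'))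
  · have hpt : 0 < P t := hpos t
    have hs : 0 < √(1 + (Q t / P t) ^ 2) := Real.sqrt_pos.2 (by positivity)
    refine ⟨mul_pos hpt hs, ?_, ?_⟩
    · rw [Real.cos_add, Real.cos_arctan, Real.sin_arctan]
      have : inner ℝ e₁ (c t) = P t * Real.cos (ψ t) - Q t * Real.sin (ψ t) := by
        simp only [hP, hQ]
        linear_combination (-inner ℝ e₁ (c t)) * Real.sin_sq_add_cos_sq (ψ t)
      rw [this]; field_simp
    · rw [Real.sin_add, Real.cos_arctan, Real.sin_arctan]
      have : inner ℝ e₂ (c t) = P t * Real.sin (ψ t) + Q t * Real.cos (ψ t) := by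
        simp only [hP, hQ]
        linear_combination (-inner ℝ e₂ (c t)) * Real.sin_sq_add_cos_sq (ψ t)
      rw [this]; field_simp
  · have hcos : Real.cos (ψ T) = Real.cos (ψ 0) := by rw [hψT, Real.cos_add_int_mul_two_pi]
    have hsin : Real.sin (ψ T) = Real.sin (ψ 0) := by rw [hψT, Real.sin_add_int_mul_two_pi]
    simp only [hP, hQ, hcT, hcos, hsin]
    rw [hψT]
    ring

/-- Dividing arcsin v by n ≥ 1 preserves its sign and does not increase its modulus, so its sine has
the sign of v and modulus at most |v|. -/
theorem cellTheta_sub_estimate {n : ℕ} (hn : 0 < n) {v : ℝ} (hv : |v| ≤ 1) :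
    Real.sin (Real.arcsin v / n) ^ 2 ≤ v * Real.sin (Real.arcsin v / n) ∧
      0 ≤ Real.cos (Real.arcsin v / n) ∧ (v ≠ 0 → Real.sin (Real.arcsin v / n) ≠ 0) := by
  have hn1 : (1 : ℝ) ≤ n := by exact_mod_cast hn
  have key : ∀ v : ℝ, 0 ≤ v → v ≤ 1 → 0 ≤ Real.sin (Real.arcsin v / n) ∧
      Real.sin (Real.arcsin v / n) ≤ v ∧ 0 ≤ Real.cos (Real.arcsin v / n) ∧
      (0 < v → 0 < Real.sin (Real.arcsin v / n)) := by
    intro v hv0 hv1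
    have h0 : 0 ≤ Real.arcsin v := Real.arcsin_nonneg.2 hv0
    have h1 : Real.arcsin v ≤ Real.pi / 2 := Real.arcsin_le_pi_div_two v
    have h2 : Real.arcsin v / n ≤ Real.arcsin v := div_le_self h0 hn1
    have h3 : 0 ≤ Real.arcsin v / n := by positivity
    have hpi := Real.pi_pos
    refine ⟨Real.sin_nonneg_of_nonneg_of_le_pi h3 (by linarith), ?_,
      Real.cos_nonneg_of_neg_pi_div_two_le_of_le (by linarith) (by linarith), fun hpos => ?_⟩
    · conv_rhs => rw [← Real.sin_arcsin (by linarith) hv1]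
      exact Real.sin_le_sin_of_le_of_le_pi_div_two (by linarith) h1 h2
    · exact Real.sin_pos_of_pos_of_lt_pi (div_pos (Real.arcsin_pos.2 hpos) (by linarith))
        (by linarith)
  have hv' := abs_le.1 hv
  rcases le_total 0 v with h | h
  · obtain ⟨k1, k2, k3, k4⟩ := key v h hv'.2
    exact ⟨by nlinarith, k3, fun h0 => (k4 (lt_of_le_of_ne h h0.symm)).ne'⟩
  · obtain ⟨k1, k2, k3, k4⟩ := key (-v) (by linarith) (by linarith)
    rw [Real.arcsin_neg, neg_div, Real.sin_neg] at k1 k2 k4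
    rw [Real.arcsin_neg, neg_div, Real.cos_neg] at k3
    exact ⟨by nlinarith, k3, fun h0 =>
      (neg_pos.1 (k4 (neg_pos.2 (lt_of_le_of_ne h h0)))).ne⟩

namespace IsCell

variable {n : ℕ} {κ θ₀ s₀ δ : ℝ}

/-- Up to a positive factor, this is the component of the projected curve along the direction of
angle κa. Let x be the longitude relative to θ₀. The difference sinh s − sinh s₀ has the sign of κ
sin a. The error from cos x ≠ 1 is at most 1 − cos x, because |tanh s₀| ≤ 1; it is absorbed by cos a
sin x ≥ sin² x ≥ 1 − cos x, which uses rC < 1 and cos x ≥ 0. -/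
theorem pos_of_chart (h : IsCell n κ θ₀ s₀ δ) (a : ℝ) {r : ℝ} (hr : r ∈ Ioo 0 δ) :
    0 < Real.cos a * Real.sin (Real.arcsin
        (r * Real.cos a * cellC n (s₀ + κ * (r * Real.sin a))) / n) +
      κ * Real.sin a * ((Real.sinh (s₀ + κ * (r * Real.sin a)) - Real.sinh s₀ * Real.cos
        (Real.arcsin (r * Real.cos a * cellC n (s₀ + κ * (r * Real.sin a))) / n)) /
          Real.cosh s₀) := by
  have hn : 0 < n := by have := h.two_le; omega
  have hlt := h.abs_lt_one a hr
  obtain ⟨e1, e2, e3⟩ := cellTheta_sub_estimate hn hlt.le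
  set C := cellC n (s₀ + κ * (r * Real.sin a)) with hCdef
  have hC : 0 < C := cellC_pos _ _
  set x := Real.arcsin (r * Real.cos a * C) / n
  have hm : r * C < 1 := by
    have h1 : C ≤ cellC n (|s₀| + δ) :=
      cellC_le_of_abs_le ((h.abs_lat_le a hr).trans (le_abs_self _))
    calc r * C < δ * C := mul_lt_mul_of_pos_right hr.2 hC
      _ ≤ δ * cellC n (|s₀| + δ) := mul_le_mul_of_nonneg_left h1 h.radius_pos.le
      _ ≤ 1 := h.radius_le
  have hm0 : 0 < r * C := mul_pos hr.1 hC
  have hcx := Real.cos_le_one x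
  have hsx := Real.sin_sq_add_cos_sq x
  have hc0 := Real.cosh_pos s₀
  have hκ := h.κ_sq
  have t1 : Real.sin x ^ 2 ≤ Real.cos a * Real.sin x := by
    have : 0 ≤ Real.cos a * Real.sin x := by
      have h1 : 0 ≤ (r * C) * (Real.cos a * Real.sin x) := by nlinarith [sq_nonneg (Real.sin x)]
      exact nonneg_of_mul_nonneg_right h1 hm0
    nlinarith
  have t2 : 0 ≤ κ * Real.sin a * ((Real.sinh (s₀ + κ * (r * Real.sin a)) - Real.sinh s₀)
      / Real.cosh s₀) ∧ (Real.sin a ≠ 0 →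
      0 < κ * Real.sin a * ((Real.sinh (s₀ + κ * (r * Real.sin a)) - Real.sinh s₀)
      / Real.cosh s₀)) := by
    have hpos : Real.sin a ≠ 0 →
      0 < κ * Real.sin a * ((Real.sinh (s₀ + κ * (r * Real.sin a)) - Real.sinh s₀)
      / Real.cosh s₀) := by
      intro hs
      have hκ0 : κ ≠ 0 := fun h0 => by rw [h0] at hκ; norm_num at hκ
      rcases lt_or_gt_of_ne (mul_ne_zero hκ0 hs) with hneg | hpos
      · refine mul_pos_of_neg_of_neg hneg (div_neg_of_neg_of_pos ?_ hc0)
        rw [sub_neg]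
        exact Real.sinh_lt_sinh.2 (by nlinarith [hr.1])
      · refine mul_pos hpos (div_pos ?_ hc0)
        rw [sub_pos]
        exact Real.sinh_lt_sinh.2 (by nlinarith [hr.1])
    refine ⟨?_, hpos⟩
    by_cases hs : Real.sin a = 0
    · simp [hs]
    · exact (hpos hs).le
  have t3 : |κ * Real.sin a * (Real.sinh s₀ / Real.cosh s₀)| ≤ 1 := by
    rw [abs_mul, abs_mul, h.abs_κ, one_mul, ← Real.tanh_eq_sinh_div_cosh]
    have := Real.abs_sin_le_one a
    have h2 : |Real.tanh s₀| ≤ 1 := (Real.abs_tanh_lt_one s₀).le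
    nlinarith [abs_nonneg (Real.sin a), abs_nonneg (Real.tanh s₀)]
  have t4 := abs_le.1 t3
  have expand : Real.cos a * Real.sin x + κ * Real.sin a *
      ((Real.sinh (s₀ + κ * (r * Real.sin a)) - Real.sinh s₀ * Real.cos x) / Real.cosh s₀) =
      Real.cos a * Real.sin x + κ * Real.sin a * ((Real.sinh (s₀ + κ * (r * Real.sin a)) -
        Real.sinh s₀) / Real.cosh s₀) +
        κ * Real.sin a * (Real.sinh s₀ / Real.cosh s₀) * (1 - Real.cos x) := by
    field_simp; ring
  rw [expand]
  by_cases hv : r * Real.cos a * C = 0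
  · have hcos : Real.cos a = 0 := by
      rcases mul_eq_zero.1 hv with h1 | h1
      · exact (mul_eq_zero.1 h1).resolve_left hr.1.ne'
      · exact absurd h1 hC.ne'
    have hs : Real.sin a ≠ 0 := fun hs => by
      have := Real.sin_sq_add_cos_sq a; rw [hs, hcos] at this; norm_num at this
    have := t2.2 hs
    nlinarith
  · have hsne := e3 hv
    have hsq : 0 < Real.sin x ^ 2 := by positivity
    have t5 : Real.sin x ^ 2 < Real.cos a * Real.sin x := by
      have h1 : (r * C) * Real.sin x ^ 2 < (r * C) * (Real.cos a * Real.sin x) := by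
        nlinarith
      exact lt_of_mul_lt_mul_left h1 hm0.le
    nlinarith [t2.1]

/-- The frame consists of the unit vectors pointing east and north at the centre. Latitude increases
with κy, so the chart angle φ corresponds to the direction κφ and the winding number is κ. -/
theorem windsAround (h : IsCell n κ θ₀ s₀ δ) {ε : ℤ} (hε : (ε : ℝ) = κ) {φ ρ : ℝ → ℝ} {T : ℝ}
    {c : ℝ → E3} (hcont : Continuous c) (hφ : Continuous φ) (hρ : ∀ t, ρ t ∈ Ioo 0 δ)
    (hφT : φ T = φ 0 + 2 * Real.pi) (hρT : ρ T = ρ 0)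
    (hc : ∀ t, c t = merc (cellTheta n θ₀ (ρ t * Real.cos (φ t))
      (s₀ + κ * (ρ t * Real.sin (φ t)))) (s₀ + κ * (ρ t * Real.sin (φ t)))) :
    WindsAround (merc θ₀ s₀) c T ε := by
  have hc0 := Real.cosh_pos s₀
  have hsc := Real.sin_sq_add_cos_sq θ₀
  have hch := Real.cosh_sq s₀
  have hκ : κ = 1 ∨ κ = -1 := (abs_eq zero_le_one).1 h.abs_κ
  set e₁ : E3 := !₂[-Real.sin θ₀, Real.cos θ₀, 0] with he₁
  set e₂ : E3 := !₂[-Real.cos θ₀ * Real.sinh s₀ / Real.cosh s₀,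
    -Real.sin θ₀ * Real.sinh s₀ / Real.cosh s₀, 1 / Real.cosh s₀] with he₂
  have h1 : ‖e₁‖ ^ 2 = 1 := by
    rw [norm_sq_eq_sum]; simp [e₁]
  have h2 : ‖e₂‖ ^ 2 = 1 := by
    rw [norm_sq_eq_sum]; simp [e₂]; field_simp
    linear_combination (Real.sinh s₀ ^ 2) * hsc - hch
  have inner_eq : ∀ u v : E3, inner ℝ u v = u 0 * v 0 + u 1 * v 1 + u 2 * v 2 := by
    intro u v
    rw [PiLp.inner_apply, Fin.sum_univ_three]; simp; ring
  have i1 : ∀ x s, inner ℝ e₁ (merc (θ₀ + x) s) = Real.sin x / Real.cosh s := by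
    intro x s
    rw [inner_eq]
    simp [e₁, merc, Real.cos_add, Real.sin_add]
    field_simp
    linear_combination (Real.sin x) * hsc
  have i2 : ∀ x s, inner ℝ e₂ (merc (θ₀ + x) s) =
      (Real.sinh s - Real.sinh s₀ * Real.cos x) / Real.cosh s₀ / Real.cosh s := by
    intro x s
    rw [inner_eq]
    simp [e₂, merc, Real.cos_add, Real.sin_add]
    field_simp
    linear_combination (-Real.sinh s₀ * Real.cos x) * hsc
  refine windsAround_of_pos (e₁ := e₁) (e₂ := e₂) (ψ := fun t => κ * φ t) ?_ ?_ ?_ ?_ hcont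
    (by fun_prop) ?_ (fun t => ?_) ?_
  · exact (pow_eq_one_iff_of_nonneg (norm_nonneg _) two_ne_zero).1 h1
  · exact (pow_eq_one_iff_of_nonneg (norm_nonneg _) two_ne_zero).1 h2
  · rw [inner_eq]; simp [e₁, e₂]; ring
  · ext i
    fin_cases i
    · simp [cross3, cross_apply, e₁, e₂, merc]; ring
    · simp [cross3, cross_apply, e₁, e₂, merc]; ring
    · simp [cross3, cross_apply, e₁, e₂, merc]; field_simp; linear_combination (Real.sinh s₀) * hsc
  · rw [hc, hc, hφT, hρT, Real.cos_add_two_pi, Real.sin_add_two_pi]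
  · have hp := h.pos_of_chart (φ t) (hρ t)
    rw [hc, cellTheta, i1, i2]
    have hch := Real.cosh_pos (s₀ + κ * (ρ t * Real.sin (φ t)))
    have hcosκ : Real.cos (κ * φ t) = Real.cos (φ t) := by
      rcases hκ with rfl | rfl <;> simp
    have hsinκ : Real.sin (κ * φ t) = κ * Real.sin (φ t) := by
      rcases hκ with rfl | rfl <;> simp
    rw [hcosκ, hsinκ]
    refine lt_of_lt_of_eq (div_pos hp hch) ?_
    ring
  · rw [hφT, hε]; ring

end IsCell

/-! ### Existence of cells -/

theorem exists_radius (n : ℕ) (s₀ : ℝ) : ∃ δ₀ > 0, ∀ δ ∈ Ioc 0 δ₀, δ * cellC n (|s₀| + δ) ≤ 1 := by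
  have hc : Continuous fun δ : ℝ => δ * cellC n (|s₀| + δ) := by
    have := continuous_cellC n; fun_prop
  have h0 : (fun δ : ℝ => δ * cellC n (|s₀| + δ)) 0 < 1 := by simp
  obtain ⟨ε, hε, h⟩ := Metric.eventually_nhds_iff.1 (hc.continuousAt.tendsto.eventually (gt_mem_nhds h0))
  refine ⟨ε / 2, by positivity, fun δ hδ => (h ?_).le⟩
  rw [Real.dist_eq, sub_zero, abs_of_pos hδ.1]
  linarith [hδ.2]

theorem cellQ_one (n : ℕ) (s : ℝ) : cellQ n 1 s = Real.sinh (n * s) ^ 2 / cellC n s ^ 2 := by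
  have := (cellC_pos n s).ne'
  unfold cellQ
  rw [show n * (2 * s) = 2 * (n * s) by ring, Real.cosh_two_mul, Real.cosh_sq]
  field_simp; ring

theorem cellQ'_one (n : ℕ) (s : ℝ) : cellQ' n 1 s = 2 * Real.sinh (n * s) *
    (n * Real.cosh (n * s) - (2 * n + 1) * Real.sinh (n * s) * Real.tanh s) / cellC n s ^ 2 := by
  have := (cellC_pos n s).ne'
  have := (Real.cosh_pos s).ne'
  unfold cellQ'
  rw [show n * (2 * s) = 2 * (n * s) by ring, Real.cosh_two_mul, Real.cosh_sq, Real.sinh_two_mul,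
    Real.tanh_eq_sinh_div_cosh]
  field_simp; ring

/-- Displays the sign of Q': it is that of n tanh(ns) − (2n+1) tanh s, whose positive zero is the
anti-prism latitude. -/
theorem cellQ'_neg_one (n : ℕ) (s : ℝ) : cellQ' n (-1) s = 2 * Real.cosh (n * s) ^ 2 *
    (n * Real.tanh (n * s) - (2 * n + 1) * Real.tanh s) / cellC n s ^ 2 := by
  have := (cellC_pos n s).ne'
  have := (Real.cosh_pos s).ne'
  have := (Real.cosh_pos (n * s)).ne'
  unfold cellQ'
  rw [show n * (2 * s) = 2 * (n * s) by ring, Real.cosh_two_mul, Real.sinh_two_mul,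
    Real.tanh_eq_sinh_div_cosh, Real.tanh_eq_sinh_div_cosh]
  field_simp
  linear_combination (2 * n + 1) * Real.sinh s * Real.cosh_sq (n * s)

theorem sinh_le_mul_cosh {u : ℝ} (hu : 0 ≤ u) : Real.sinh u ≤ u * Real.cosh u := by
  have hmono : MonotoneOn (fun u => u * Real.cosh u - Real.sinh u) (Ici 0) := by
    refine monotoneOn_of_deriv_nonneg (convex_Ici _) (by fun_prop) (by fun_prop) fun x hx => ?_
    rw [interior_Ici] at hx
    have hd : HasDerivAt (fun u => u * Real.cosh u - Real.sinh u) (x * Real.sinh x) x :=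
      (((hasDerivAt_id' x).mul (Real.hasDerivAt_cosh x)).sub (Real.hasDerivAt_sinh x)).congr_deriv
        (by ring)
    rw [hd.deriv]
    exact mul_nonneg hx.le (Real.sinh_pos_iff.2 hx).le
  have := hmono (mem_Ici.2 le_rfl) hu hu
  simp at this
  linarith

/-- From sinh u ≤ u cosh u with u = n|y| one gets sinh²(ny) ≤ y sinh(ny) · n cosh(ny); the
hypothesis leaves at least half of the leading term of y Q'. -/
theorem cellQ_one_le {n : ℕ} {y : ℝ}
    (h : 0 < n * Real.cosh (n * y) - (4 * n + 2) * Real.sinh (n * y) * Real.tanh y) :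
    cellQ n 1 y ≤ y * cellQ' n 1 y := by
  have hC := cellC_pos n y
  rw [cellQ_one, cellQ'_one, mul_div_assoc', div_le_div_iff_of_pos_right (by positivity)]
  have hst : 0 ≤ y * Real.sinh (n * y) ∧
      Real.sinh (n * y) ^ 2 ≤ (y * Real.sinh (n * y)) * (n * Real.cosh (n * y)) := by
    have key : ∀ y : ℝ, 0 ≤ y → 0 ≤ y * Real.sinh (n * y) ∧
        Real.sinh (n * y) ^ 2 ≤ (y * Real.sinh (n * y)) * (n * Real.cosh (n * y)) := by
      intro y hy
      have h1 : 0 ≤ n * y := by positivity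
      have h2 := Real.sinh_nonneg_iff.2 h1
      exact ⟨mul_nonneg hy h2, by nlinarith [sinh_le_mul_cosh h1]⟩
    rcases le_total 0 y with hy | hy
    · exact key y hy
    · simpa using key (-y) (by linarith)
  nlinarith [hst.1, hst.2]

/-- Besides the sign condition, the inequality Q ≤ y Q' is recorded: it bounds r times the radial
derivative below by b² + Q, which makes the angular velocity blow up at the collision. -/
theorem exists_isCell_equator {n : ℕ} (hn : 2 ≤ n) {θ₀ : ℝ} (hθ : Real.cos (n * (2 * θ₀)) = 1) :
    ∃ δ, IsCell n 1 θ₀ 0 δ ∧ ∀ y, |y| < δ → cellQ n 1 y ≤ y * cellQ' n 1 y := by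
  have hn' : (0 : ℝ) < n := by positivity
  obtain ⟨δ₀, hδ₀, hrad⟩ := exists_radius n 0
  have hc : Continuous fun y : ℝ =>
      n * Real.cosh (n * y) - (4 * n + 2) * Real.sinh (n * y) * Real.tanh y := by
    have h1 : ∀ s, Real.cosh s ≠ 0 := fun s => (Real.cosh_pos s).ne'
    simp only [Real.tanh_eq_sinh_div_cosh]
    fun_prop (disch := exact h1 _)
  have h0 : 0 < (fun y : ℝ =>
      n * Real.cosh (n * y) - (4 * n + 2) * Real.sinh (n * y) * Real.tanh y) 0 := by simpa using (by omega : 0 < n)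
  obtain ⟨ε, hε, h⟩ := Metric.eventually_nhds_iff.1 (hc.continuousAt.tendsto.eventually (lt_mem_nhds h0))
  have hle : ∀ y, |y| < min δ₀ ε → cellQ n 1 y ≤ y * cellQ' n 1 y := fun y hy =>
    cellQ_one_le (h (by rw [Real.dist_eq, sub_zero]; exact hy.trans_le (min_le_right _ _)))
  have hδ : 0 < min δ₀ ε := lt_min hδ₀ hε
  refine ⟨min δ₀ ε, ⟨hn, by norm_num, hθ, hδ, hrad _ ⟨hδ, min_le_left _ _⟩, fun a r hr => ?_,
    fun y hy hy0 => ?_⟩, hle⟩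
  · unfold cellD
    simp only [zero_add, one_mul]
    have hCp := cellC_pos n (r * Real.sin a)
    by_cases hs : Real.sin a = 0
    · have hcos : Real.cos a ≠ 0 := fun hc => by
        have := Real.sin_sq_add_cos_sq a; rw [hs, hc] at this; norm_num at this
      have := hr.1
      have h1 := Real.one_le_cosh (n * (2 * (r * Real.sin a)))
      have : 0 < (r * Real.cos a * cellC n (r * Real.sin a)) ^ 2 := by positivity
      linarith
    · have h1 := Real.one_lt_cosh.2 (show n * (2 * (r * Real.sin a)) ≠ 0 from
        mul_ne_zero hn'.ne' (mul_ne_zero two_ne_zero (mul_ne_zero hr.1.ne' hs)))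
      nlinarith [sq_nonneg (r * Real.cos a * cellC n (r * Real.sin a))]
  · rw [zero_add, one_mul]
    refine lt_of_lt_of_le ?_ (hle y hy)
    rw [cellQ_one]
    have := cellC_pos n y
    have : Real.sinh (n * y) ≠ 0 := by
      rw [Ne, Real.sinh_eq_zero]; exact mul_ne_zero hn'.ne' hy0
    positivity

/-- With the radius at most `z`, the latitude stays on the side of the equator containing `s₀`,
where Q' changes sign only at `s₀`. The southern case follows from the oddness of tanh. -/
theorem exists_isCell_antiprism {n : ℕ} (hn : 2 ≤ n) {θ₀ z s₀ : ℝ}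
    (hθ : Real.cos (n * (2 * θ₀)) = -1) (hz : 0 < z) (hs₀ : s₀ = z ∨ s₀ = -z)
    (hlt : ∀ s, 0 < s → s < z → 0 < n * Real.tanh (n * s) - (2 * n + 1) * Real.tanh s)
    (hgt : ∀ s, z < s → n * Real.tanh (n * s) - (2 * n + 1) * Real.tanh s < 0) :
    ∃ δ, IsCell n (-1) θ₀ s₀ δ := by
  obtain ⟨δ₀, hδ₀, hrad⟩ := exists_radius n s₀
  have hδ : 0 < min δ₀ z := lt_min hδ₀ hz
  have hr := hrad _ ⟨hδ, min_le_left _ _⟩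
  refine ⟨min δ₀ z, hn, by norm_num, hθ, hδ, hr, fun a r hra => ?_, fun y hy hy0 => ?_⟩
  · have h1 : |r * Real.cos a * cellC n (s₀ + -1 * (r * Real.sin a))| < 1 := by
      have h2 : |s₀ + -1 * (r * Real.sin a)| ≤ |s₀| + min δ₀ z := by
        refine (abs_add_le _ _).trans (add_le_add le_rfl ?_)
        rw [abs_mul, abs_neg, abs_one, one_mul]
        exact (abs_mul_sin_lt hra a).le
      have h1 := cellC_le_of_abs_le (n := n) (h2.trans (le_abs_self _))
      rw [abs_mul, abs_of_pos (cellC_pos n _)]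
      calc |r * Real.cos a| * cellC n (s₀ + -1 * (r * Real.sin a))
          < min δ₀ z * cellC n (s₀ + -1 * (r * Real.sin a)) :=
            mul_lt_mul_of_pos_right (abs_mul_cos_lt hra a) (cellC_pos n _)
        _ ≤ min δ₀ z * cellC n (|s₀| + min δ₀ z) := mul_le_mul_of_nonneg_left h1 hδ.le
        _ ≤ 1 := hr
    have h2 := Real.one_le_cosh (n * (2 * (s₀ + -1 * (r * Real.sin a))))
    have h3 : (r * Real.cos a * cellC n (s₀ + -1 * (r * Real.sin a))) ^ 2 < 1 := by
      rw [← sq_abs]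
      nlinarith [abs_nonneg (r * Real.cos a * cellC n (s₀ + -1 * (r * Real.sin a)))]
    unfold cellD
    linarith
  · have hC := cellC_pos n (s₀ + -1 * y)
    have hch := Real.cosh_pos (n * (s₀ + -1 * y))
    have hy1 := abs_lt.1 (hy.trans_le (min_le_right _ _))
    rw [cellQ'_neg_one, mul_div_assoc', mul_left_comm]
    refine div_pos (mul_pos (by positivity) ?_) (by positivity)
    rcases hs₀ with rfl | rfl
    · rcases lt_or_gt_of_ne hy0 with h | h
      · exact mul_pos_of_neg_of_neg h (hgt _ (by linarith))
      · exact mul_pos h (hlt _ (by linarith) (by linarith))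
    · have e : n * Real.tanh (n * (-z + -1 * y)) - (2 * n + 1) * Real.tanh (-z + -1 * y) =
          -(n * Real.tanh (n * (z + y)) - (2 * n + 1) * Real.tanh (z + y)) := by
        rw [show -z + -1 * y = -(z + y) by ring, mul_neg, Real.tanh_neg, Real.tanh_neg]; ring
      rw [e]
      rcases lt_or_gt_of_ne hy0 with h | h
      · exact mul_pos_of_neg_of_neg h (neg_neg_of_pos (hlt _ (by linarith) (by linarith)))
      · exact mul_pos h (neg_pos.2 (hgt _ (by linarith)))

/-- On the cell of a collision the angular velocity tends to infinity at the collision. -/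
theorem IsCell.speed_unbounded {n : ℕ} {θ₀ δ : ℝ} (h : IsCell n 1 θ₀ 0 δ)
    (hle : ∀ y, |y| < δ → cellQ n 1 y ≤ y * cellQ' n 1 y) :
    ∀ M > 0, ∃ ε > 0, ∀ a, ∀ r ∈ Ioo 0 δ, r < ε →
      M ≤ sqAddSpeed (fun y => cellQ' n 1 (0 + 1 * y)) (fun b y => cellW n 1 b (0 + 1 * y)) a r := by
  intro M hM
  have hn : 0 < n := by have := h.two_le; omega
  have hn1 : (1 : ℝ) ≤ n := by exact_mod_cast hn
  set B := cellC n (|0| + δ) with hB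
  have hB0 : 0 < B := cellC_pos _ _
  -- `B` bounds C = `cellC` on the disc. The first bound keeps the square root Z at least 1/2. With
  -- D = 2C²K and K ≤ r · (radial derivative), the speed is at least n cosh² s · Z / (4Cr²) ≥
  -- 1/(8Br²), and the second bound makes this at least M.
  refine ⟨min (1 / (2 * B)) (√(1 / (8 * B * M))), lt_min (by positivity)
    (Real.sqrt_pos.2 (by positivity)), fun a r hr hrε => ?_⟩
  have hr1 : r < 1 / (2 * B) := hrε.trans_le (min_le_left _ _)
  have hr2 : r ^ 2 ≤ 1 / (8 * B * M) := by
    have := (hrε.trans_le (min_le_right _ _)).le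
    rw [← Real.sq_sqrt (by positivity : (0 : ℝ) ≤ 1 / (8 * B * M))]
    exact pow_le_pow_left₀ hr.1.le this 2
  have hr0 := hr.1
  have hD := h.denom_pos a r hr
  have hCB : cellC n (0 + 1 * (r * Real.sin a)) ≤ B :=
    cellC_le_of_abs_le ((h.abs_lat_le a hr).trans (le_abs_self _))
  simp only [sqAddSpeed, cellW]
  have hC := cellC_pos n (0 + 1 * (r * Real.sin a))
  have hrad : (r * Real.cos a) ^ 2 + cellQ n 1 (0 + 1 * (r * Real.sin a)) ≤
      r * sqAddRadial (fun y => cellQ' n 1 (0 + 1 * y)) a r := by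
    have h1 := hle _ (abs_mul_sin_lt hr a)
    unfold sqAddRadial
    simp only [zero_add, one_mul]
    nlinarith [sq_nonneg (r * Real.cos a)]
  have hDK : cellD n 1 (r * Real.cos a) (0 + 1 * (r * Real.sin a)) =
      2 * cellC n (0 + 1 * (r * Real.sin a)) ^ 2 *
        ((r * Real.cos a) ^ 2 + cellQ n 1 (0 + 1 * (r * Real.sin a))) := by
    generalize 0 + 1 * (r * Real.sin a) = s
    generalize r * Real.cos a = b
    have := (cellC_pos n s).ne'
    unfold cellD cellQ
    field_simp; ring
  have hsq : 1 / 2 ≤ √(1 - (r * Real.cos a * cellC n (0 + 1 * (r * Real.sin a))) ^ 2) := by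
    refine Real.le_sqrt_of_sq_le ?_
    have h1 : |r * Real.cos a * cellC n (0 + 1 * (r * Real.sin a))| ≤ 1 / 2 := by
      rw [abs_mul, abs_mul, abs_of_pos hr.1, abs_of_pos (cellC_pos n _)]
      have h2 := Real.abs_cos_le_one a
      have h3 : r * B ≤ 1 / 2 := by
        rw [lt_div_iff₀ (by positivity)] at hr1; linarith
      calc r * |Real.cos a| * cellC n (0 + 1 * (r * Real.sin a)) ≤ r * 1 * B := by gcongr
        _ ≤ 1 / 2 := by linarith
    have h2 := pow_le_pow_left₀ (abs_nonneg _) h1 2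
    rw [sq_abs] at h2
    norm_num1 at h2 ⊢; linarith
  have hch := Real.one_le_cosh (0 + 1 * (r * Real.sin a))
  generalize sqAddRadial (fun y => cellQ' n 1 (0 + 1 * y)) a r = R at *
  rw [hDK] at hD ⊢
  generalize (r * Real.cos a) ^ 2 + cellQ n 1 (0 + 1 * (r * Real.sin a)) = K at *
  generalize √(1 - (r * Real.cos a * cellC n (0 + 1 * (r * Real.sin a))) ^ 2) = Z at *
  generalize cellC n (0 + 1 * (r * Real.sin a)) = C at *
  generalize Real.cosh (0 + 1 * (r * Real.sin a)) = c at *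
  have hK : 0 < K := pos_of_mul_pos_right hD (by positivity)
  have hMr : M * (8 * B * r ^ 2) ≤ 1 := by
    rw [le_div_iff₀ (by positivity)] at hr2; linarith
  have h4 : (1 : ℝ) / 2 ≤ n * c ^ 2 * Z := by
    have : (1 : ℝ) ≤ n * c ^ 2 := by nlinarith
    nlinarith
  rw [le_div_iff₀ hr0, div_mul_eq_mul_div, le_div_iff₀ (by positivity)]
  have h5 : M * r * (2 * (2 * C ^ 2 * K)) * r ≤ (n * c ^ 2 * Z * C * R) * r := by
    have h6 : M * (8 * B * r ^ 2) * (C * K) ≤ 1 * (C * K) :=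
      mul_le_mul_of_nonneg_right hMr (by positivity)
    have h7 : M * r ^ 2 * (C * K) * C ≤ M * r ^ 2 * (C * K) * B :=
      mul_le_mul_of_nonneg_left hCB (by positivity)
    have h8 : 1 / 2 * (C * K) ≤ n * c ^ 2 * Z * (C * (r * R)) := by
      have : C * K ≤ C * (r * R) := mul_le_mul_of_nonneg_left hrad hC.le
      have hCK : 0 < C * K := mul_pos hC hK
      nlinarith
    nlinarith
  exact le_of_mul_le_mul_right h5 hr0

/-! ### The chart around the north pole -/

theorem mercD_pos {n : ℕ} (hn : 0 < n) (θ : ℝ) {s : ℝ} (hs : s ≠ 0) : 0 < mercD n θ s := by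
  have h1 := Real.one_lt_cosh.2 (show n * (2 * s) ≠ 0 by positivity)
  have h2 := Real.cos_le_one (n * (2 * θ))
  unfold mercD
  linarith

theorem continuous_mercD (n : ℕ) : Continuous fun p : ℝ × ℝ => mercD n p.1 p.2 := by
  unfold mercD; fun_prop

/-- Since D ≥ cosh 2ns − 1, the quotient sinh 2ns / D is at most coth s, so the bracket in
`lonSpeed` is at least (n+1) sinh s − n/sinh s, which is at least sinh s when sinh s ≥ 1. -/
theorem half_le_lonSpeed {n : ℕ} (hn : 0 < n) (θ : ℝ) {s : ℝ} (hs : 1 ≤ s) :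
    s / 2 ≤ lonSpeed n θ s := by
  have hs0 : 0 < s := by linarith
  have hn1 : (1 : ℝ) ≤ n := by exact_mod_cast hn
  have hD := mercD_pos hn θ hs0.ne'
  have hch := Real.one_le_cosh s
  have hsh : s ≤ Real.sinh s := Real.self_le_sinh_iff.2 hs0.le
  have hsh0 : 0 < Real.sinh s := by linarith
  have hq : Real.sinh (n * (2 * s)) / mercD n θ s ≤ Real.cosh s / Real.sinh s := by
    rw [div_le_div_iff₀ hD hsh0]
    -- After clearing denominators the claim is this inequality, expanded by the addition formula;
    -- it holds because 2ns − s ≥ s.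
    have h1 : Real.cosh s ≤ Real.cosh (n * (2 * s) - s) := by
      rw [Real.cosh_le_cosh, abs_of_pos hs0]
      refine le_trans ?_ (le_abs_self _)
      nlinarith
    rw [Real.cosh_sub] at h1
    have h2 := Real.cos_le_one (n * (2 * θ))
    unfold mercD
    nlinarith
  have h3 : n * Real.cosh s * Real.sinh (n * (2 * s)) / mercD n θ s ≤
      n * Real.cosh s * (Real.cosh s / Real.sinh s) := by
    rw [mul_div_assoc]
    exact mul_le_mul_of_nonneg_left hq (by positivity)
  have h4 : Real.sinh s ≤
      (2 * n + 1) * Real.sinh s - n * Real.cosh s * (Real.cosh s / Real.sinh s) := by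
    have e : n * Real.cosh s * (Real.cosh s / Real.sinh s) =
        n * Real.sinh s + n / Real.sinh s := by
      field_simp
      exact Real.cosh_sq s
    have : n / Real.sinh s ≤ n * Real.sinh s := by
      rw [div_le_iff₀ hsh0]
      have : 1 ≤ Real.sinh s * Real.sinh s := by nlinarith
      nlinarith
    rw [e]
    linarith
  unfold lonSpeed
  nlinarith

/-- The energy function `mercD / cosh s ^ (4n+2)` in the coordinates `θ` and `r = exp (-s)`. -/
noncomputable def poleK (n : ℕ) (a r : ℝ) : ℝ :=
  mercD n a (-Real.log r) / Real.cosh (-Real.log r) ^ (4 * n + 2)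

/-- The angular derivative of `poleK`. -/
noncomputable def poleAngular (n : ℕ) (a r : ℝ) : ℝ :=
  poleK n a r * (4 * latSpeed n a (-Real.log r) / Real.cosh (-Real.log r) ^ 2)

/-- The radial derivative of `poleK`. -/
noncomputable def poleRadial (n : ℕ) (a r : ℝ) : ℝ :=
  poleK n a r * (4 * lonSpeed n a (-Real.log r) / (Real.cosh (-Real.log r) ^ 2 * r))

/-- The logarithmic derivatives of K are 4/cosh² s times `latSpeed` in θ and −4/cosh² s times
`lonSpeed` in s, which expresses conservation of K. The substitution r = exp(−s) turns the latter
into the positive radial derivative. -/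
theorem hasFDerivAt_poleK {n : ℕ} (a : ℝ) {r : ℝ} (hr : 0 < r)
    (hD : mercD n a (-Real.log r) ≠ 0) :
    HasFDerivAt (fun p : ℝ × ℝ => poleK n p.1 p.2)
      (poleAngular n a r • ContinuousLinearMap.fst ℝ ℝ ℝ +
        poleRadial n a r • ContinuousLinearMap.snd ℝ ℝ ℝ) (a, r) := by
  have hc := (Real.cosh_pos (-Real.log r)).ne'
  have hs : HasDerivAt (fun r => -Real.log r) (-r⁻¹) r := (Real.hasDerivAt_log hr.ne').neg
  have h1 := ((hs.const_mul (2 : ℝ)).const_mul (n : ℝ)).cosh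
  have h2 := (hs.cosh.pow (4 * n + 2)).inv (by simpa using hc)
  have h3 := (((hasDerivAt_id' a).const_mul (2 : ℝ)).const_mul (n : ℝ)).cos
  have g1 := h1.comp_hasFDerivAt (a, r) (hasFDerivAt_snd (𝕜 := ℝ) (E := ℝ) (F := ℝ))
  have g2 := h2.comp_hasFDerivAt (a, r) (hasFDerivAt_snd (𝕜 := ℝ) (E := ℝ) (F := ℝ))
  have g3 := h3.comp_hasFDerivAt (a, r) (hasFDerivAt_fst (𝕜 := ℝ) (E := ℝ) (F := ℝ))
  have g4 := ((g1.sub g3).mul g2).congr_of_eventuallyEq (f₁ := fun p : ℝ × ℝ => poleK n p.1 p.2)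
    (Eventually.of_forall fun p => by simp [poleK, mercD, div_eq_mul_inv])
  refine (g4.congr_fderiv ?_)
  have hDdef : mercD n a (-Real.log r) =
    Real.cosh (n * (2 * -Real.log r)) - Real.cos (n * (2 * a)) := rfl
  have e : 4 * n + 2 - 1 = 4 * n + 1 := rfl
  ext
  · simp [poleAngular, poleK, latSpeed]
    field_simp
    ring
  · simp [poleRadial, poleK, lonSpeed, e]
    rw [Real.cosh_neg] at hc
    field_simp
    rw [hDdef, mul_neg, mul_neg, Real.cosh_neg]
    ring_nf

theorem poleK_pos {n : ℕ} (hn : 0 < n) (a : ℝ) {r : ℝ} (hr : r ∈ Ioo 0 (Real.exp (-1))) :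
    0 < poleK n a r ∧ 1 < -Real.log r := by
  have h1 : 1 < -Real.log r := by
    have := (Real.log_lt_iff_lt_exp hr.1).2 hr.2
    linarith
  have h2 := mercD_pos hn a (by linarith : -Real.log r ≠ 0)
  exact ⟨div_pos h2 (pow_pos (Real.cosh_pos _) _), h1⟩

/-- D grows at most like cosh s ^ (2n), against cosh s ^ (4n+2) in the denominator, and 1 ≤ 2r cosh
s. The crude linear bound suffices for decay uniform in the angle. -/
theorem poleK_le {n : ℕ} (a : ℝ) {r : ℝ} (hr : r ∈ Ioo 0 1) :
    poleK n a r ≤ 4 * 4 ^ n * r := by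
  have hs : 0 < -Real.log r := by have := Real.log_neg hr.1 hr.2; linarith
  have hexp : Real.exp (-Real.log r) = r⁻¹ := by rw [Real.exp_neg, Real.exp_log hr.1]
  set s := -Real.log r with hsdef
  have hch := Real.one_le_cosh s
  have h1 : Real.exp s ≤ 2 * Real.cosh s := by
    rw [Real.cosh_eq]; linarith [Real.exp_pos (-s)]
  have h2 : Real.cosh (n * (2 * s)) ≤ 4 ^ n * Real.cosh s ^ (2 * n) := by
    calc Real.cosh (n * (2 * s)) ≤ Real.exp (n * (2 * s)) := by
          rw [Real.cosh_eq]
          have : Real.exp (-(n * (2 * s))) ≤ Real.exp (n * (2 * s)) :=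
            Real.exp_le_exp.2 (by nlinarith [show (0 : ℝ) ≤ n * s by positivity])
          linarith
      _ = Real.exp s ^ (2 * n) := by
          rw [← Real.exp_nat_mul]; congr 1; push_cast; ring
      _ ≤ (2 * Real.cosh s) ^ (2 * n) := pow_le_pow_left₀ (Real.exp_pos _).le h1 _
      _ = _ := by rw [mul_pow, pow_mul 2 2 n]; norm_num
  have h3 : mercD n a s ≤ 2 * (4 ^ n * Real.cosh s ^ (2 * n)) := by
    have := Real.neg_one_le_cos (n * (2 * a))
    have := Real.one_le_cosh (n * (2 * s))
    unfold mercD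
    linarith
  have h4 : r⁻¹ ≤ 2 * Real.cosh s := by rwa [hexp] at h1
  have h5 : 1 ≤ 2 * r * Real.cosh s := by
    have := mul_le_mul_of_nonneg_left h4 hr.1.le
    rw [mul_inv_cancel₀ hr.1.ne'] at this
    linarith
  unfold poleK
  rw [← hsdef, div_le_iff₀ (by positivity)]
  have h6 : Real.cosh s ^ (2 * n + 1) ≤ Real.cosh s ^ (4 * n + 2) :=
    pow_le_pow_right₀ hch (by omega)
  have h7 : Real.cosh s ^ (2 * n) ≤ 2 * r * Real.cosh s ^ (2 * n + 1) := by
    rw [pow_succ]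
    nlinarith [pow_pos (Real.cosh_pos s) (2 * n)]
  have h8 : (0 : ℝ) < 4 ^ n := by positivity
  calc mercD n a s ≤ 2 * (4 ^ n * Real.cosh s ^ (2 * n)) := h3
    _ ≤ 2 * (4 ^ n * (2 * r * Real.cosh s ^ (4 * n + 2))) := by
        have h9 : Real.cosh s ^ (2 * n) ≤ 2 * r * Real.cosh s ^ (4 * n + 2) :=
          h7.trans (mul_le_mul_of_nonneg_left h6 (by linarith [hr.1]))
        gcongr
    _ = _ := by ring

theorem dist_merc_northPole_sq (θ : ℝ) {s : ℝ} :
    dist (merc θ s) northPole ^ 2 ≤ 2 * Real.exp (-s) := by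
  have hch := Real.one_le_cosh s
  have hch0 := (Real.cosh_pos s).ne'
  have h1 : dist (merc θ s) northPole ^ 2 = 2 * Real.exp (-s) / Real.cosh s := by
    rw [dist_eq_norm, norm_sq_eq_sum, ← Real.cosh_sub_sinh]
    simp [merc, northPole]
    field_simp
    linear_combination Real.sin_sq_add_cos_sq θ - Real.cosh_sq s +
      2 * Real.cosh s * Real.cosh_sub_sinh s
  rw [h1]
  exact div_le_self (by positivity) hch

theorem continuousOn_lonSpeed {n : ℕ} (hn : 0 < n) :
    ContinuousOn (fun p : ℝ × ℝ => lonSpeed n p.1 p.2) {p | p.2 ≠ 0} := by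
  have hD := continuous_mercD n
  have h : ∀ p ∈ {p : ℝ × ℝ | p.2 ≠ 0}, mercD n p.1 p.2 ≠ 0 := fun p hp =>
    (mercD_pos hn p.1 hp).ne'
  unfold lonSpeed
  fun_prop (disch := exact h)

theorem isVortexChart_northPole {n : ℕ} (hn : 0 < n) :
    IsVortexChart n northPole (fun a _ => a) (fun _ r => -Real.log r) (Real.exp (-1))
      (poleK n) (poleAngular n) (poleRadial n) (fun a r => lonSpeed n a (-Real.log r)) := by
  have hsmall : ∀ r ∈ Ioo 0 (Real.exp (-1)), r ∈ Ioo 0 1 := fun r hr =>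
    ⟨hr.1, hr.2.trans (Real.exp_lt_one_iff.2 (by norm_num))⟩
  have hDpos : ∀ a, ∀ r ∈ Ioo 0 (Real.exp (-1)), 0 < mercD n a (-Real.log r) := fun a r hr =>
    mercD_pos hn a (by linarith [(poleK_pos hn a hr).2])
  have hlon : ∀ a, ∀ r ∈ Ioo 0 (Real.exp (-1)), 0 < lonSpeed n a (-Real.log r) := fun a r hr => by
    have h := (poleK_pos hn a hr).2
    have := half_le_lonSpeed hn a h.le
    linarith
  have hlog : ContinuousOn (fun p : ℝ × ℝ => -Real.log p.2) (univ ×ˢ Ioo 0 (Real.exp (-1))) :=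
    (Real.continuousOn_log.comp continuousOn_snd fun p hp => hp.2.1.ne').neg
  have hper : ∀ a s, mercD n (a + 2 * Real.pi) s = mercD n a s := fun a s => by
    unfold mercD
    rw [show n * (2 * (a + 2 * Real.pi)) = n * (2 * a) + (2 * n : ℕ) * (2 * Real.pi) by
      push_cast; ring, Real.cos_add_nat_mul_two_pi]
  refine ⟨⟨Real.exp_pos _, fun a r hr => hasFDerivAt_poleK a hr.1 (hDpos a r hr).ne',
    fun a r hr => ?_, fun a r hr => (poleK_pos hn a hr).1, fun ε hε => ?_, fun a r => ?_, ?_,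
    hlon, fun a r => ?_⟩, hDpos, ?_, fun a r hr => ?_, fun a a' r hr r' hr' heq => ?_,
    fun ε hε => ?_, fun φ ρ t hρt hφ hρ => ?_⟩
  · have := hr.1
    have := hlon a r hr
    have := (poleK_pos hn a hr).1
    have := Real.cosh_pos (-Real.log r)
    unfold poleRadial
    positivity
  · have h4 : (0 : ℝ) < 8 * 4 ^ n := by positivity
    have hm : 0 < min (Real.exp (-1)) (ε / (8 * 4 ^ n)) :=
      lt_min (Real.exp_pos _) (div_pos hε h4)
    have hr : min (Real.exp (-1)) (ε / (8 * 4 ^ n)) / 2 ∈ Ioo 0 (Real.exp (-1)) :=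
      ⟨by positivity, (half_lt_self hm).trans_le (min_le_left _ _)⟩
    refine ⟨_, hr, fun a => (poleK_le a (hsmall _ hr)).trans_lt ?_⟩
    have h5 := min_le_right (Real.exp (-1)) (ε / (8 * 4 ^ n))
    rw [le_div_iff₀ h4] at h5
    linarith
  · simp only [poleK, hper]
  · refine ContinuousOn.comp (g := fun p : ℝ × ℝ => lonSpeed n p.1 p.2)
      (f := fun p : ℝ × ℝ => (p.1, -Real.log p.2)) (continuousOn_lonSpeed hn)
      (continuousOn_fst.prodMk hlog) fun p hp => ?_
    have := (poleK_pos hn p.1 hp.2).2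
    exact (by linarith : -Real.log p.2 ≠ 0)
  · simp only [lonSpeed, hper]
  · exact Continuous.comp_continuousOn (g := fun p : ℝ × ℝ => merc p.1 p.2)
      (f := fun p : ℝ × ℝ => (p.1, -Real.log p.2)) continuous_merc (continuousOn_fst.prodMk hlog)
  · simp [merc]
  · obtain ⟨-, h2⟩ := merc_injective heq
    obtain ⟨m, hm⟩ := (Real.cos_eq_one_iff (a - a')).1 h2
    exact ⟨-m, by push_cast; linarith⟩
  · refine ⟨ε ^ 2 / 2, by positivity, fun a r hr hrε => ?_⟩
    have h := dist_merc_northPole_sq a (s := -Real.log r)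
    rw [neg_neg, Real.exp_log hr.1] at h
    exact lt_of_pow_lt_pow_left₀ 2 hε.le (by linarith)
  · refine ⟨hφ, (hρ.log hρt.1.ne').neg.congr_deriv ?_⟩
    have h1 := (hlon (φ t) _ hρt).ne'
    have h2 := hρt.1.ne'
    have h3 := (poleK_pos hn (φ t) hρt).1.ne'
    have h4 := (Real.cosh_pos (-Real.log (ρ t))).ne'
    unfold poleAngular poleRadial
    generalize lonSpeed n (φ t) (-Real.log (ρ t)) = A at *
    generalize Real.cosh (-Real.log (ρ t)) = B at *
    field_simp

theorem lonSpeed_unbounded {n : ℕ} (hn : 0 < n) : ∀ M > 0, ∃ ε > 0, ∀ a,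
    ∀ r ∈ Ioo 0 (Real.exp (-1)), r < ε → M ≤ lonSpeed n a (-Real.log r) := by
  intro M hM
  refine ⟨Real.exp (-(2 * M)), Real.exp_pos _, fun a r hr hrε => ?_⟩
  have h1 := (poleK_pos hn a hr).2
  have h2 := (Real.log_lt_iff_lt_exp hr.1).2 hrε
  have := half_le_lonSpeed hn a h1.le
  linarith

theorem vortexEnergy_pole {n : ℕ} (hn : 0 < n) (g : Fin (2 * n) ≃ dihedral n) (f : Fin 2 ≃ poles)
    (a : ℝ) {r : ℝ} (hr : r ∈ Ioo 0 (Real.exp (-1))) :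
    vortexEnergy (symConfig g f (merc a (-Real.log r))) =
      energyConst n - n / 2 * Real.log (poleK n a r) := by
  have hD := mercD_pos hn a (by linarith [(poleK_pos hn a hr).2] : -Real.log r ≠ 0)
  have hc := Real.cosh_pos (-Real.log r)
  rw [vortexEnergy_symConfig_merc hn g f hD, poleK, Real.log_div hD.ne' (by positivity),
    Real.log_pow, Real.log_pow]
  push_cast; ring

/-! ### Reparametrization by the energy -/

theorem energy_reparam {n : ℕ} (hn : 0 < n) (C h : ℝ) :
    C - n / 2 * Real.log (Real.exp ((C - h) * (2 / n))) = h := by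
  have : (n : ℝ) ≠ 0 := by positivity
  rw [Real.log_exp]
  field_simp
  ring

/-- For the collision families: the level is an exponential in −h, so level 0 corresponds to
infinite energy. -/
theorem exists_reparam_atTop {n : ℕ} (hn : 0 < n) (C : ℝ) {c k₁ : ℝ} (hc : 0 < c) (hk : 0 < k₁) :
    ∃ (h₁ : ℝ) (κ : ℝ → ℝ), Continuous κ ∧ Tendsto κ atTop (𝓝[>] 0) ∧
      ∀ h ∈ Ioi h₁, κ h ∈ Ioo 0 k₁ ∧ C - n / 2 * Real.log (c * κ h) = h := by
  have hn' : (0 : ℝ) < n := by positivity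
  have hpos : ∀ h : ℝ, 0 < Real.exp ((C - h) * (2 / n)) / c := fun h => by positivity
  have hlim : Tendsto (fun h : ℝ => Real.exp ((C - h) * (2 / n)) / c) atTop (𝓝[>] 0) := by
    refine tendsto_nhdsWithin_iff.2 ⟨?_, Eventually.of_forall hpos⟩
    have h1 : Tendsto (fun h : ℝ => C - h) atTop atBot := by
      simpa [sub_eq_add_neg] using tendsto_atBot_add_const_left atTop C tendsto_neg_atTop_atBot
    have h2 := Real.tendsto_exp_atBot.comp
      (h1.atBot_mul_const (show 0 < 2 / (n : ℝ) by positivity))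
    simpa using h2.div_const c
  obtain ⟨h₁, hh₁⟩ := eventually_atTop.1 (hlim (Ioo_mem_nhdsGT hk))
  refine ⟨h₁, _, by fun_prop, hlim, fun h hh => ⟨hh₁ h (mem_Ioi.1 hh).le, ?_⟩⟩
  rw [mul_div_cancel₀ _ hc.ne', energy_reparam hn]

/-- For the anti-prism family: solving for the level gives Q − exp(2(C − h)/n)/2, which vanishes at
the equilibrium energy and is positive above it. -/
theorem exists_reparam_nhdsGT {n : ℕ} (hn : 0 < n) (C : ℝ) {Q k₁ : ℝ} (hQ : 0 < Q) (hk : 0 < k₁) :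
    ∃ h₁ > C - n / 2 * Real.log (2 * Q), ∃ κ : ℝ → ℝ, Continuous κ ∧
      Tendsto κ (𝓝[>] (C - n / 2 * Real.log (2 * Q))) (𝓝[>] 0) ∧
      ∀ h ∈ Ioo (C - n / 2 * Real.log (2 * Q)) h₁, κ h ∈ Ioo 0 k₁ ∧
        C - n / 2 * Real.log (-2 * κ h + 2 * Q) = h := by
  have hn' : (0 : ℝ) < n := by positivity
  set E := C - n / 2 * Real.log (2 * Q) with hE
  have hE0 : Q - Real.exp ((C - E) * (2 / n)) / 2 = 0 := by
    rw [hE, show (C - (C - n / 2 * Real.log (2 * Q))) * (2 / n) = Real.log (2 * Q) by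
      field_simp; ring, Real.exp_log (by positivity)]
    ring
  have hcont : Continuous fun h : ℝ => Q - Real.exp ((C - h) * (2 / n)) / 2 := by fun_prop
  have hlim : Tendsto (fun h : ℝ => Q - Real.exp ((C - h) * (2 / n)) / 2) (𝓝[>] E) (𝓝[>] 0) := by
    refine tendsto_nhdsWithin_iff.2 ⟨?_, ?_⟩
    · rw [← hE0]
      exact hcont.continuousAt.tendsto.mono_left nhdsWithin_le_nhds
    · filter_upwards [self_mem_nhdsWithin] with h hh
      have h1 : Real.exp ((C - h) * (2 / n)) < Real.exp ((C - E) * (2 / n)) := by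
        apply Real.exp_lt_exp.2
        have : 0 < 2 / (n : ℝ) := by positivity
        have := mem_Ioi.1 hh
        nlinarith
      rw [mem_Ioi]
      linarith
  obtain ⟨h₁, hh₁, hsub⟩ := mem_nhdsGT_iff_exists_Ioo_subset.1 (hlim (Ioo_mem_nhdsGT hk))
  refine ⟨h₁, hh₁, _, hcont, hlim, fun h hh => ⟨hsub hh, ?_⟩⟩
  rw [show -2 * (Q - Real.exp ((C - h) * (2 / n)) / 2) + 2 * Q = Real.exp ((C - h) * (2 / n)) by
    ring, energy_reparam hn]

/-! ### The loops traversed by the vortices -/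

/-- Two vortices attached to the same point differ by an element of the stabilizer of `u₀`; if the
stabilizer maps the curve into its own range, their loops coincide. -/
theorem range_rot_eq {n : ℕ} (g : Fin (2 * n) ≃ dihedral n) {u₀ : E3} {c : ℝ → E3}
    (hstab : ∀ z : dihedral n, rot z u₀ = u₀ → ∀ t, rot z (c t) ∈ range c) (i j : Fin (2 * n))
    (hij : rot (g i) u₀ = rot (g j) u₀) :
    range (fun t => rot (g i) (c t)) = range (fun t => rot (g j) (c t)) := by
  have key : ∀ i j : Fin (2 * n), rot (g i) u₀ = rot (g j) u₀ →
      range (fun t => rot (g i) (c t)) ⊆ range (fun t => rot (g j) (c t)) := by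
    rintro i j hij _ ⟨t, rfl⟩
    obtain ⟨t', ht'⟩ := hstab ((g j)⁻¹ * g i) (by
      rw [Subgroup.coe_mul, Subgroup.coe_inv, rot_mul, hij, rot_inv_rot]) t
    refine ⟨t', ?_⟩
    simp only [ht']
    rw [Subgroup.coe_mul, Subgroup.coe_inv, rot_mul_inv_rot]
  exact (key i j hij).antisymm (key j i hij.symm)

theorem cellC_neg (n : ℕ) (s : ℝ) : cellC n (-s) = cellC n s := by simp [cellC]

theorem cellQ_neg (n : ℕ) (κ s : ℝ) : cellQ n κ (-s) = cellQ n κ s := by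
  simp [cellQ, cellC_neg]

theorem merc_eq_of_cos_eq_one {θ θ' : ℝ} (h : Real.cos (θ - θ') = 1) (s : ℝ) :
    merc θ s = merc θ' s := by
  obtain ⟨m, hm⟩ := (Real.cos_eq_one_iff _).1 h
  rw [show θ = θ' + m * (2 * Real.pi) by linarith, merc, merc, Real.cos_add_int_mul_two_pi,
    Real.sin_add_int_mul_two_pi]

/-- The family of periodic solutions emanating from an equatorial collision. -/
theorem exists_family_equator {n : ℕ} (hn : 2 ≤ n) (g : Fin (2 * n) ≃ dihedral n)
    (f : Fin 2 ≃ poles) {θ₀ : ℝ} (hθ : Real.cos (n * (2 * θ₀)) = 1) :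
    ∃ (h₁ : ℝ) (u : ℝ → ℝ → E3) (T : ℝ → ℝ),
      IsPeriodicFamily (Ioi h₁) (fun h t => symConfig g f (u h t)) T ∧
      TendstoUniformly (fun h t => symConfig g f (u h t)) (fun _ => symConfig g f (merc θ₀ 0))
        atTop ∧
      Tendsto T atTop (𝓝 0) ∧
      ∀ h ∈ Ioi h₁,
        (∀ i j : Fin (2 * n), rot (g i) (merc θ₀ 0) = rot (g j) (merc θ₀ 0) →
          range (fun t => rot (g i) (u h t)) = range (fun t => rot (g j) (u h t))) ∧
        ∀ j : Fin (2 * n),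
          WindsAround (rot (g j) (merc θ₀ 0)) (fun t => rot (g j) (u h t)) (T h) 1 := by
  have hn0 : 0 < n := by omega
  obtain ⟨δ, hcell, hle⟩ := exists_isCell_equator hn hθ
  obtain ⟨k₁, hk₁, φ, ρ, T, u, hu, hfam, hlim, hT, hloop⟩ :=
    hcell.isVortexChart.exists_family hn g f
      (e := fun k => energyConst n - n / 2 * Real.log (2 * 1 * k + 2 * cellQ n 1 0))
      (fun a r hr => hcell.energy_eq g f a hr)
  obtain ⟨h₁, κ, hκ, hκlim, hκI⟩ := exists_reparam_atTop hn0 (energyConst n) two_pos hk₁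
  have hQ0 : cellQ n 1 0 = 0 := by simp [cellQ]
  refine ⟨h₁, fun h => u (κ h), fun h => T (κ h), hfam _ κ hκ.continuousOn fun h hh =>
    ⟨(hκI h hh).1, ?_⟩, hlim _ κ hκlim, (hT (hcell.speed_unbounded hle)).comp hκlim,
    fun h hh => ?_⟩
  · rw [hQ0, mul_one, mul_zero, add_zero, (hκI h hh).2]
  · obtain ⟨hφc, hρc, hφT, hρT, hd, hr⟩ := hloop _ (hκI h hh).1
    refine ⟨range_rot_eq g fun z hz t => ?_, fun j => ?_⟩
    · simp only [hu]
      set a := φ (κ h) t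
      set r := ρ (κ h) t
      rcases dihedral_cases hn0 z with ⟨k, hk⟩ | ⟨k, hk⟩
      · rw [hk, rot_rotZ_merc] at hz ⊢
        have h1 := (merc_injective hz).2
        refine ⟨t, ?_⟩
        simp only [hu]
        refine (merc_eq_of_cos_eq_one ?_ _).symm
        rw [← h1]; congr 1; ring
      · rw [hk, rot_rotZ_mul_merc] at hz ⊢
        have h1 := (merc_injective hz).2
        -- The half-turn fixing the vertex acts as (b, y) ↦ (−b, −y), a shift of the chart angle by
        -- π. Since Q is even the image lies on the same level curve, all of which is traversed.
        obtain ⟨t', hta, htr⟩ := hr (a + Real.pi) r (hd t).1 (by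
          rw [← (hd t).2]
          simp only [sqAdd, Real.sin_add_pi, Real.cos_add_pi, mul_neg, zero_add, one_mul,
            cellQ_neg, neg_sq]
          rfl)
        refine ⟨t', ?_⟩
        simp only [hu, hta, htr, Real.sin_add_pi, Real.cos_add_pi, mul_neg, zero_add, one_mul]
        refine (merc_eq_of_cos_eq_one ?_ _).symm
        rw [← h1]; congr 1
        simp only [cellTheta, cellC_neg, neg_mul, Real.arcsin_neg]
        ring
    · refine WindsAround.rot (hcell.windsAround (by norm_num) ?_ hφc (fun t => (hd t).1) hφT hρT
        (fun t => hu _ t)) (g j)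
      have := IsCell.continuous_chart n 1 θ₀ 0
      have h2 : Continuous fun t => (ρ (κ h) t * Real.cos (φ (κ h) t),
        ρ (κ h) t * Real.sin (φ (κ h) t)) := by fun_prop
      exact (this.comp h2).congr fun t => (hu _ t).symm

/-- The family of periodic solutions emanating from an anti-prism with poles. -/
theorem exists_family_antiprism {n : ℕ} (hn : 2 ≤ n) (g : Fin (2 * n) ≃ dihedral n)
    (f : Fin 2 ≃ poles) {θ₀ z s₀ : ℝ} (hθ : Real.cos (n * (2 * θ₀)) = -1) (hz : 0 < z)
    (hs₀ : s₀ = z ∨ s₀ = -z)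
    (hlt : ∀ s, 0 < s → s < z → 0 < n * Real.tanh (n * s) - (2 * n + 1) * Real.tanh s)
    (hgt : ∀ s, z < s → n * Real.tanh (n * s) - (2 * n + 1) * Real.tanh s < 0) :
    ∃ h₁ > vortexEnergy (symConfig g f (merc θ₀ s₀)), ∃ (u : ℝ → ℝ → E3) (T : ℝ → ℝ),
      IsPeriodicFamily (Ioo (vortexEnergy (symConfig g f (merc θ₀ s₀))) h₁)
        (fun h t => symConfig g f (u h t)) T ∧
      TendstoUniformly (fun h t => symConfig g f (u h t)) (fun _ => symConfig g f (merc θ₀ s₀))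
        (𝓝[>] (vortexEnergy (symConfig g f (merc θ₀ s₀)))) ∧
      ∀ h ∈ Ioo (vortexEnergy (symConfig g f (merc θ₀ s₀))) h₁, ∀ j : Fin (2 * n),
        WindsAround (rot (g j) (merc θ₀ s₀)) (fun t => rot (g j) (u h t)) (T h) (-1) := by
  have hn0 : 0 < n := by omega
  obtain ⟨δ, hcell⟩ := exists_isCell_antiprism hn hθ hz hs₀ hlt hgt
  obtain ⟨k₁, hk₁, φ, ρ, T, u, hu, hfam, hlim, hT, hloop⟩ :=
    hcell.isVortexChart.exists_family hn g f
      (e := fun k => energyConst n - n / 2 * Real.log (2 * (-1) * k + 2 * cellQ n (-1) s₀))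
      (fun a r hr => hcell.energy_eq g f a hr)
  have hC := cellC_pos n s₀
  have hD : mercD n θ₀ s₀ = Real.cosh (n * (2 * s₀)) + 1 := by
    rw [mercD, hθ, sub_neg_eq_add]
  have hD0 : 0 < mercD n θ₀ s₀ := by rw [hD]; positivity
  have hQ : 2 * cellQ n (-1) s₀ = mercD n θ₀ s₀ / cellC n s₀ ^ 2 := by
    rw [hD, cellQ]; field_simp; ring
  have hE : vortexEnergy (symConfig g f (merc θ₀ s₀)) =
      energyConst n - n / 2 * Real.log (2 * cellQ n (-1) s₀) := by
    rw [vortexEnergy_symConfig_merc hn0 g f hD0, hQ, Real.log_div hD0.ne' (by positivity), cellC,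
      Real.log_pow, Real.log_pow, Real.log_pow]
    push_cast; ring
  obtain ⟨h₁, hh₁, κ, hκ, hκlim, hκI⟩ := exists_reparam_nhdsGT hn0 (energyConst n)
    (show 0 < cellQ n (-1) s₀ by
      have : 0 < 2 * cellQ n (-1) s₀ := by rw [hQ]; positivity
      linarith) hk₁
  rw [hE]
  refine ⟨h₁, hh₁, fun h => u (κ h), fun h => T (κ h), hfam _ κ hκ.continuousOn fun h hh =>
    ⟨(hκI h hh).1, ?_⟩, hlim _ κ hκlim, fun h hh j => ?_⟩
  · rw [show (2 : ℝ) * -1 = -2 by norm_num]; exact (hκI h hh).2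
  · obtain ⟨hφc, hρc, hφT, hρT, hd, hr⟩ := hloop _ (hκI h hh).1
    refine WindsAround.rot (hcell.windsAround (by norm_num) ?_ hφc (fun t => (hd t).1) hφT hρT
      (fun t => hu _ t)) (g j)
    have := IsCell.continuous_chart n (-1) θ₀ s₀
    have h2 : Continuous fun t => (ρ (κ h) t * Real.cos (φ (κ h) t),
      ρ (κ h) t * Real.sin (φ (κ h) t)) := by fun_prop
    exact (this.comp h2).congr fun t => (hu _ t).symm

theorem windsAround_northPole {θ s : ℝ → ℝ} {c : ℝ → E3} {T : ℝ} {k : ℤ}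
    (hc : ∀ t, c t = merc (θ t) (s t)) (hθ : Continuous θ) (hcT : c T = c 0)
    (hθT : θ T - θ 0 = 2 * Real.pi * k) : WindsAround northPole c T k := by
  have norm_one : ∀ v : E3, ‖v‖ ^ 2 = 1 → ‖v‖ = 1 := fun v hv =>
    (pow_eq_one_iff_of_nonneg (norm_nonneg _) two_ne_zero).1 hv
  refine ⟨!₂[1, 0, 0], !₂[0, 1, 0], norm_one _ (by rw [norm_sq_eq_sum]; simp),
    norm_one _ (by rw [norm_sq_eq_sum]; simp), ?_, ?_, hcT, fun t => 1 / Real.cosh (s t), θ, hθ,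
    fun t => ⟨by have := Real.cosh_pos (s t); positivity, ?_, ?_⟩, hθT⟩
  · rw [PiLp.inner_apply, Fin.sum_univ_three]; simp
  · ext i
    fin_cases i <;> simp [cross3, cross_apply, northPole]
  · rw [hc, PiLp.inner_apply, Fin.sum_univ_three]; simp [merc]; ring
  · rw [hc, PiLp.inner_apply, Fin.sum_univ_three]; simp [merc]; ring

theorem poleK_add_mul_two_pi_div {n : ℕ} (hn : 0 < n) (a : ℝ) (k : ℕ) (r : ℝ) :
    poleK n (a + k * (2 * Real.pi / n)) r = poleK n a r := by
  have : (n : ℝ) ≠ 0 := by positivity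
  rw [poleK, poleK, mercD, mercD, show n * (2 * (a + k * (2 * Real.pi / n))) =
    n * (2 * a) + (2 * k : ℕ) * (2 * Real.pi) by push_cast; field_simp,
    Real.cos_add_nat_mul_two_pi]

/-- The family of periodic solutions converging to the polar collision. -/
theorem exists_family_northPole {n : ℕ} (hn : 2 ≤ n) (g : Fin (2 * n) ≃ dihedral n)
    (f : Fin 2 ≃ poles) :
    ∃ (h₁ : ℝ) (u : ℝ → ℝ → E3) (T : ℝ → ℝ),
      IsPeriodicFamily (Ioi h₁) (fun h t => symConfig g f (u h t)) T ∧
      TendstoUniformly (fun h t => symConfig g f (u h t)) (fun _ => symConfig g f northPole)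
        atTop ∧
      Tendsto T atTop (𝓝 0) ∧
      ∀ h ∈ Ioi h₁,
        (∀ i j : Fin (2 * n), rot (g i) northPole = rot (g j) northPole →
          range (fun t => rot (g i) (u h t)) = range (fun t => rot (g j) (u h t))) ∧
        ∀ j : Fin (2 * n),
          (rot (g j) northPole = northPole →
            WindsAround northPole (fun t => rot (g j) (u h t)) (T h) 1) ∧
          (rot (g j) northPole = -northPole →
            WindsAround northPole (fun t => rot (g j) (u h t)) (T h) (-1)) := by
  have hn0 : 0 < n := by omega
  obtain ⟨k₁, hk₁, φ, ρ, T, u, hu, hfam, hlim, hT, hloop⟩ :=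
    (isVortexChart_northPole hn0).exists_family hn g f
      (e := fun k => energyConst n - n / 2 * Real.log (1 * k))
      (fun a r hr => by rw [vortexEnergy_pole hn0 g f a hr, one_mul])
  obtain ⟨h₁, κ, hκ, hκlim, hκI⟩ := exists_reparam_atTop hn0 (energyConst n) one_pos hk₁
  refine ⟨h₁, fun h => u (κ h), fun h => T (κ h), hfam _ κ hκ.continuousOn hκI, hlim _ κ hκlim,
    (hT (lonSpeed_unbounded hn0)).comp hκlim, fun h hh => ?_⟩
  obtain ⟨hφc, hρc, hφT, hρT, hd, hr⟩ := hloop _ (hκI h hh).1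
  have huT : u (κ h) (T (κ h)) = u (κ h) 0 := by
    rw [hu, hu, hφT, hρT]
    simp [merc]
  beta_reduce
  refine ⟨range_rot_eq g fun z hz t => ?_, fun j => ⟨fun hj => ?_, fun hj => ?_⟩⟩
  · rcases rot_mem_poles hn0 z with ⟨-, k, hk⟩ | ⟨h1, -⟩
    · obtain ⟨t', hta, htr⟩ := hr (φ (κ h) t + (k : ℕ) * (2 * Real.pi / n)) (ρ (κ h) t) (hd t).1
        (by rw [poleK_add_mul_two_pi_div hn0, (hd t).2])
      exact ⟨t', by rw [hu, hta, htr, hk, hu, rot_rotZ_merc]⟩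
    · exact absurd (hz.symm.trans h1) northPole_ne_neg
  · rcases rot_mem_poles hn0 (g j) with ⟨-, k, hk⟩ | ⟨h1, -⟩
    · refine windsAround_northPole (θ := fun t => φ (κ h) t + (k : ℕ) * (2 * Real.pi / n))
        (s := fun t => -Real.log (ρ (κ h) t)) (fun t => ?_) (by fun_prop) (by simp only [huT]) ?_
      · rw [hk, hu, rot_rotZ_merc]
      · rw [hφT]; push_cast; ring
    · exact absurd (hj.symm.trans h1) northPole_ne_neg
  · rcases rot_mem_poles hn0 (g j) with ⟨h1, -⟩ | ⟨-, k, hk⟩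
    · exact absurd (h1.symm.trans hj) northPole_ne_neg
    · refine windsAround_northPole (θ := fun t => -(φ (κ h) t + (k : ℕ) * (2 * Real.pi / n)))
        (s := fun t => - -Real.log (ρ (κ h) t)) (fun t => ?_) (by fun_prop) (by simp only [huT]) ?_
      · rw [hk, hu, rot_rotZ_mul_merc]
      · rw [hφT]; push_cast; ring

theorem flipX_mem_dihedral (n : ℕ) : flipX ∈ dihedral n := Subgroup.subset_closure (by simp)

/-- The south pole reduces to the north pole by precomposing with `flipX`, which amounts to
relabelling the group by a right translation. -/
theorem exists_family_poles {n : ℕ} (hn : 2 ≤ n) (g : Fin (2 * n) ≃ dihedral n)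
    (f : Fin 2 ≃ poles) {u₀ : E3} (hu₀ : u₀ ∈ poles) :
    ∃ (h₁ : ℝ) (u : ℝ → ℝ → E3) (T : ℝ → ℝ),
      IsPeriodicFamily (Ioi h₁) (fun h t => symConfig g f (u h t)) T ∧
      TendstoUniformly (fun h t => symConfig g f (u h t)) (fun _ => symConfig g f u₀) atTop ∧
      Tendsto T atTop (𝓝 0) ∧
      ∀ h ∈ Ioi h₁,
        (∀ i j : Fin (2 * n), rot (g i) u₀ = rot (g j) u₀ →
          range (fun t => rot (g i) (u h t)) = range (fun t => rot (g j) (u h t))) ∧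
        ∀ j : Fin (2 * n),
          (rot (g j) u₀ = northPole →
            WindsAround northPole (fun t => rot (g j) (u h t)) (T h) 1) ∧
          (rot (g j) u₀ = -northPole →
            WindsAround northPole (fun t => rot (g j) (u h t)) (T h) (-1)) := by
  rcases hu₀ with rfl | rfl
  · exact exists_family_northPole hn g f
  · set g' : Fin (2 * n) ≃ dihedral n :=
      g.trans (Equiv.mulRight ⟨flipX, flipX_mem_dihedral n⟩) with hg'
    have hrot : ∀ j u, rot (g' j) u = rot (g j) (rot flipX u) := fun j u => by
      rw [← rot_mul]; rfl
    have hconf : ∀ u, symConfig g f (rot flipX u) = symConfig g' f u := fun u => by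
      funext j
      refine Fin.addCases (fun a => ?_) (fun a => ?_) j
      · rw [symConfig_castAdd, symConfig_castAdd, hrot]
      · rw [symConfig_natAdd, symConfig_natAdd]
    obtain ⟨h₁, u, T, H1, H2, H3, H4⟩ := exists_family_northPole hn g' f
    refine ⟨h₁, fun h t => rot flipX (u h t), T, ?_⟩
    simp only [hconf, ← rot_flipX_northPole, ← hrot] at *
    exact ⟨H1, H2, H3, H4⟩

theorem ncard_eq_of_equiv {n : ℕ} (g : Fin (2 * n) ≃ dihedral n)
    {e : Fin n ⊕ Fin n ≃ dihedral n} (P : SO3 → Prop) :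
    {j : Fin (2 * n) | P (g j)}.ncard = {p : Fin n ⊕ Fin n | P (e p)}.ncard := by
  refine ncard_congr (fun j _ => e.symm (g j)) (fun j hj => by simpa using hj)
    (fun i j _ _ h => g.injective (e.symm.injective h)) fun p hp => ⟨g.symm (e p), ?_, ?_⟩
  · simpa using hp
  · simp

theorem ncard_rot_eq_pole {n : ℕ} (hn : 0 < n) (g : Fin (2 * n) ≃ dihedral n) {u₀ p : E3}
    (hu₀ : u₀ ∈ poles) (hp : p ∈ poles) : {j : Fin (2 * n) | rot (g j) u₀ = p}.ncard = n := by
  obtain ⟨e, he1, he2⟩ := exists_dihedralEquiv hn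
  rw [ncard_eq_of_equiv (e := e) g fun x => rot x u₀ = p]
  have hneg : ∀ x : SO3, rot x (-northPole) = -rot x northPole := fun x => by
    rw [← rotLin_apply, map_neg, rotLin_apply]
  have h1 : ∀ k, rot (e (Sum.inl k)) northPole = northPole := fun k => by
    rw [he1, rot_rotZ_northPole]
  have h2 : ∀ k, rot (e (Sum.inr k)) northPole = -northPole := fun k => by
    rw [he2, rot_mul, rot_rotZ_northPole, rot_flipX_northPole]
  have hne := northPole_ne_neg
  have hl : (range (Sum.inl : Fin n → Fin n ⊕ Fin n)).ncard = n := by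
    rw [← image_univ, ncard_image_of_injective _ Sum.inl_injective, ncard_univ]; simp
  have hr : (range (Sum.inr : Fin n → Fin n ⊕ Fin n)).ncard = n := by
    rw [← image_univ, ncard_image_of_injective _ Sum.inr_injective, ncard_univ]; simp
  have hset : {p' : Fin n ⊕ Fin n | rot (e p') u₀ = p} = range Sum.inl ∨
      {p' : Fin n ⊕ Fin n | rot (e p') u₀ = p} = range Sum.inr := by
    rcases hu₀ with rfl | rfl <;> rcases hp with rfl | rfl
    · left; ext (k | k) <;> simp [h1, h2, hne.symm]
    · right; ext (k | k) <;> simp [h1, h2, hne]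
    · right; ext (k | k) <;> simp [h1, h2, hneg, hne.symm]
    · left; ext (k | k) <;> simp [h1, h2, hneg, hne, hne.symm]
  rcases hset with h | h
  · rw [h, hl]
  · rw [h, hr]

/-! ### The vertices of the equatorial polygon -/

theorem merc_zero_eq_equatorPoint (n l : ℕ) :
    merc (l * Real.pi / n) 0 = equatorPoint n l := by
  simp [merc, equatorPoint]

/-! ### The height of the anti-prism -/

theorem hasDerivAt_tanh (x : ℝ) : HasDerivAt Real.tanh (1 / Real.cosh x ^ 2) x := by
  have hc := (Real.cosh_pos x).ne'
  have h := (Real.hasDerivAt_sinh x).div (Real.hasDerivAt_cosh x) hc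
  refine (h.congr_of_eventuallyEq (f₁ := Real.tanh)
    (Eventually.of_forall fun y => Real.tanh_eq_sinh_div_cosh y)).congr_deriv ?_
  congr 1
  linear_combination Real.cosh_sq x

theorem tanh_pos {x : ℝ} (hx : 0 < x) : 0 < Real.tanh x := by
  rw [Real.tanh_eq_sinh_div_cosh]
  exact div_pos (Real.sinh_pos_iff.2 hx) (Real.cosh_pos x)

theorem mul_sinh_lt_sinh_mul {n : ℕ} (hn : 2 ≤ n) {x : ℝ} (hx : 0 < x) :
    n * Real.sinh x < Real.sinh (n * x) := by
  have hs := Real.sinh_pos_iff.2 hx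
  have hch := Real.one_lt_cosh.2 hx.ne'
  induction n, hn using Nat.le_induction with
  | base => push_cast; rw [Real.sinh_two_mul]; nlinarith
  | succ k hk ih =>
    push_cast
    rw [add_mul, one_mul, add_mul, one_mul, Real.sinh_add]
    have h1 := Real.one_le_cosh (k * x)
    have h2 : 0 ≤ k * Real.sinh x := by positivity
    nlinarith

/-- The derivative has the sign of n sinh 2s − sinh 2ns, which is negative. -/
theorem strictAntiOn_tanh_div {n : ℕ} (hn : 2 ≤ n) :
    StrictAntiOn (fun s => Real.tanh (n * s) / Real.tanh s) (Ioi 0) := by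
  have hd : ∀ s : ℝ, 0 < s → HasDerivAt (fun s => Real.tanh (n * s) / Real.tanh s)
      ((1 / Real.cosh (n * s) ^ 2 * n * Real.tanh s - Real.tanh (n * s) * (1 / Real.cosh s ^ 2)) /
        Real.tanh s ^ 2) s := fun s hs => by
    have h1 : HasDerivAt (fun s : ℝ => n * s) n s := by
      simpa using (hasDerivAt_id' s).const_mul (n : ℝ)
    exact ((hasDerivAt_tanh (n * s)).comp s h1).div (hasDerivAt_tanh s) (tanh_pos hs).ne'
  refine strictAntiOn_of_deriv_neg (convex_Ioi _)
    (fun s hs => (hd s hs).continuousAt.continuousWithinAt) fun s hs => ?_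
  rw [interior_Ioi] at hs
  rw [(hd s hs).deriv]
  have hs0 : 0 < s := hs
  refine div_neg_of_neg_of_pos ?_ (pow_pos (tanh_pos hs0) 2)
  have h1 := mul_sinh_lt_sinh_mul hn (show 0 < 2 * s by positivity)
  rw [show n * (2 * s) = 2 * (n * s) by ring, Real.sinh_two_mul, Real.sinh_two_mul] at h1
  have hc := Real.cosh_pos s
  have hcn := Real.cosh_pos (n * s)
  rw [Real.tanh_eq_sinh_div_cosh, Real.tanh_eq_sinh_div_cosh, sub_neg]
  rw [show 1 / Real.cosh (n * s) ^ 2 * n * (Real.sinh s / Real.cosh s) =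
      n * Real.sinh s * Real.cosh s / (Real.cosh (n * s) ^ 2 * Real.cosh s ^ 2) by field_simp,
    show Real.sinh (n * s) / Real.cosh (n * s) * (1 / Real.cosh s ^ 2) =
      Real.sinh (n * s) * Real.cosh (n * s) / (Real.cosh (n * s) ^ 2 * Real.cosh s ^ 2) by
        field_simp]
  exact div_lt_div_of_pos_right (by linarith) (by positivity)

/-- The latitude of the anti-prism. -/
theorem exists_antiprism_lat {n : ℕ} (hn : 3 ≤ n) : ∃ z : ℝ, 0 < z ∧
    n * Real.tanh (n * z) - (2 * n + 1) * Real.tanh z = 0 ∧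
    (∀ s, 0 < s → s < z → 0 < n * Real.tanh (n * s) - (2 * n + 1) * Real.tanh s) ∧
    (∀ s, z < s → n * Real.tanh (n * s) - (2 * n + 1) * Real.tanh s < 0) := by
  have hn3 : (3 : ℝ) ≤ n := by exact_mod_cast hn
  have hn0 : (0 : ℝ) < n := by linarith
  set F := fun s : ℝ => n * Real.tanh (n * s) - (2 * n + 1) * Real.tanh s with hF
  have hd : ∀ s : ℝ, HasDerivAt F (n * (1 / Real.cosh (n * s) ^ 2 * n) -
      (2 * n + 1) * (1 / Real.cosh s ^ 2)) s := fun s => by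
    have h1 : HasDerivAt (fun s : ℝ => n * s) n s := by
      simpa using (hasDerivAt_id' s).const_mul (n : ℝ)
    exact (((hasDerivAt_tanh (n * s)).comp s h1).const_mul (n : ℝ)).sub
      ((hasDerivAt_tanh s).const_mul (2 * n + 1 : ℝ))
  -- The slope at 0 is n² − (2n+1), positive exactly from n = 3 on.
  have hsmall : ∃ ε, 0 < ε ∧ ε < 1 ∧ 0 < F ε := by
    have h1 := (hd 0).tendsto_slope_zero_right
    have h2 : (0 : ℝ) < n * (1 / Real.cosh (n * 0) ^ 2 * n) -
      (2 * n + 1) * (1 / Real.cosh 0 ^ 2) := by simp; nlinarith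
    obtain ⟨ε, h3, h4⟩ := ((h1.eventually (lt_mem_nhds h2)).and
      (Ioo_mem_nhdsGT (zero_lt_one' ℝ))).exists
    refine ⟨ε, h4.1, h4.2, ?_⟩
    have h5 : F 0 = 0 := by simp [hF]
    rw [h5, zero_add, sub_zero, smul_eq_mul] at h3
    exact pos_of_mul_pos_right h3 (inv_pos.2 h4.1).le
  -- From tanh n < 1 and tanh 1 > 1/2 one gets F(1) < n − (2n+1)/2 < 0.
  have hlarge : F 1 < 0 := by
    have h1 := Real.tanh_lt_one (n * 1)
    have h2 : 1 / 2 < Real.tanh 1 := by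
      have hs : (1 : ℝ) ≤ Real.sinh 1 := Real.self_le_sinh_iff.2 zero_le_one
      have hc := Real.cosh_pos 1
      rw [Real.tanh_eq_sinh_div_cosh, lt_div_iff₀ hc]
      nlinarith [Real.cosh_sq 1]
    simp only [hF]
    nlinarith
  obtain ⟨ε, hε0, hε1, hFε⟩ := hsmall
  have hcont : Continuous F := continuous_iff_continuousAt.2 fun s => (hd s).continuousAt
  obtain ⟨z, hz, hFz⟩ := intermediate_value_Icc' hε1.le hcont.continuousOn ⟨hlarge.le, hFε.le⟩
  have hz0 : 0 < z := hε0.trans_le hz.1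
  have hsplit : ∀ s, 0 < s →
      F s = Real.tanh s * (n * (Real.tanh (n * s) / Real.tanh s) - (2 * n + 1)) := fun s hs => by
    have := (tanh_pos hs).ne'
    simp only [hF]
    field_simp
  have hz1 : n * (Real.tanh (n * z) / Real.tanh z) - (2 * n + 1) = 0 := by
    rw [hsplit z hz0] at hFz
    exact (mul_eq_zero.1 hFz).resolve_left (tanh_pos hz0).ne'
  refine ⟨z, hz0, hFz, fun s hs0 hsz => ?_, fun s hzs => ?_⟩
  · have h := strictAntiOn_tanh_div (by omega : 2 ≤ n) hs0 hz0 hsz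
    refine lt_of_lt_of_eq (mul_pos (tanh_pos hs0) ?_) (hsplit s hs0).symm
    simp only at h
    nlinarith
  · have hs0 := hz0.trans hzs
    have h := strictAntiOn_tanh_div (by omega : 2 ≤ n) hz0 hs0 hzs
    refine lt_of_eq_of_lt (hsplit s hs0) (mul_neg_of_pos_of_neg (tanh_pos hs0) ?_)
    simp only at h
    nlinarith

/-- With T₂ₙ(cosh s) = cosh 2ns and U₂ₙ(cosh s) sinh s = sinh((2n+1)s), roots above 1 are the values
cosh s at positive zeros of the equilibrium equation. -/
theorem antiprismPoly_eval_cosh (n : ℕ) (s : ℝ) :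
    (antiprismPoly n).eval (Real.cosh s) * Real.sinh s = 2 * Real.cosh (n * s) ^ 2 * Real.cosh s *
      ((2 * n + 1) * Real.tanh s - n * Real.tanh (n * s)) := by
  have hc := (Real.cosh_pos s).ne'
  have hcn := (Real.cosh_pos (n * s)).ne'
  have hU := Polynomial.Chebyshev.U_real_cosh s (2 * n)
  have hT := Polynomial.Chebyshev.T_real_cosh s (2 * n)
  push_cast at hU hT
  rw [add_mul, one_mul, Real.sinh_add] at hU
  rw [show 2 * (n : ℝ) * s = 2 * (n * s) by ring] at hU hT
  simp only [antiprismPoly, Polynomial.eval_add, Polynomial.eval_sub, Polynomial.eval_mul,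
    Polynomial.eval_C]
  rw [hT, add_mul, sub_mul, mul_assoc (n : ℝ), hU, Real.tanh_eq_sinh_div_cosh,
    Real.tanh_eq_sinh_div_cosh, Real.sinh_two_mul, Real.cosh_two_mul]
  field_simp
  linear_combination (-(2 * n + 1)) * Real.sinh s * Real.cosh_sq (n * s)

/-- The unique root of `antiprismPoly` above one. -/
theorem antiprismPoly_root {n : ℕ} {z : ℝ} (hz : 0 < z)
    (h0 : n * Real.tanh (n * z) - (2 * n + 1) * Real.tanh z = 0)
    (hlt : ∀ s, 0 < s → s < z → 0 < n * Real.tanh (n * s) - (2 * n + 1) * Real.tanh s)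
    (hgt : ∀ s, z < s → n * Real.tanh (n * s) - (2 * n + 1) * Real.tanh s < 0) :
    1 < Real.cosh z ∧ (antiprismPoly n).eval (Real.cosh z) = 0 ∧
      ∀ μ : ℝ, 1 < μ → (antiprismPoly n).eval μ = 0 → μ = Real.cosh z := by
  refine ⟨Real.one_lt_cosh.2 hz.ne', ?_, fun μ hμ hroot => ?_⟩
  · have h := antiprismPoly_eval_cosh n z
    rw [show (2 * n + 1) * Real.tanh z - n * Real.tanh (n * z) = 0 by linarith, mul_zero] at h
    exact (mul_eq_zero.1 h).resolve_right (Real.sinh_pos_iff.2 hz).ne'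
  · have hμ' := Real.cosh_arcosh hμ.le
    have hs : 0 < Real.arcosh μ := Real.arcosh_pos hμ
    set s := Real.arcosh μ
    have h := antiprismPoly_eval_cosh n s
    rw [hμ', hroot, zero_mul, eq_comm] at h
    have hcn := Real.cosh_pos (n * s)
    have h1 := (mul_eq_zero.1 h).resolve_left (by positivity)
    rcases lt_trichotomy s z with h2 | h2 | h2
    · linarith [hlt s hs h2]
    · rw [← hμ', h2]
    · linarith [hgt s h2]

/-- The anti-prism with poles is an equilibrium. -/
theorem isVortexEquilibrium_antiprism {n : ℕ} (hn : 2 ≤ n) (g : Fin (2 * n) ≃ dihedral n)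
    (f : Fin 2 ≃ poles) {θ₀ z s₀ : ℝ} (hθ : Real.cos (n * (2 * θ₀)) = -1)
    (hs₀ : s₀ = z ∨ s₀ = -z) (h0 : n * Real.tanh (n * z) - (2 * n + 1) * Real.tanh z = 0) :
    IsVortexEquilibrium (symConfig g f (merc θ₀ s₀)) := by
  have hD : mercD n θ₀ s₀ = 2 * Real.cosh (n * s₀) ^ 2 := by
    rw [mercD, hθ, show n * (2 * s₀) = 2 * (n * s₀) by ring, Real.cosh_two_mul, Real.sinh_sq]
    ring
  have hc := Real.cosh_pos s₀
  have hcn := Real.cosh_pos (n * s₀)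
  have hD0 : 0 < mercD n θ₀ s₀ := by rw [hD]; positivity
  have h1 : n * Real.tanh (n * s₀) - (2 * n + 1) * Real.tanh s₀ = 0 := by
    rcases hs₀ with rfl | rfl
    · exact h0
    · rw [mul_neg, Real.tanh_neg, Real.tanh_neg]; linarith
  have hlon : lonSpeed n θ₀ s₀ = 0 := by
    have : lonSpeed n θ₀ s₀ = -(Real.cosh s₀ ^ 2 / 2) *
        (n * Real.tanh (n * s₀) - (2 * n + 1) * Real.tanh s₀) := by
      rw [lonSpeed, hD, show n * (2 * s₀) = 2 * (n * s₀) by ring, Real.sinh_two_mul,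
        Real.tanh_eq_sinh_div_cosh, Real.tanh_eq_sinh_div_cosh]
      field_simp
      ring
    rw [this, h1, mul_zero]
  have hlat : latSpeed n θ₀ s₀ = 0 := by
    have := Real.sin_sq_add_cos_sq (n * (2 * θ₀))
    rw [hθ] at this
    have h2 : Real.sin (n * (2 * θ₀)) = 0 := pow_eq_zero_iff two_ne_zero |>.1 (by linarith)
    rw [latSpeed, h2]; simp
  refine ⟨isCollisionFree_symConfig g f (by omega) hD0, fun j => ?_⟩
  refine Fin.addCases (fun a => ?_) (fun a => ?_) j
  · rw [vortexField_symConfig_castAdd g f (by omega), symField_merc (by omega) hD0, hlon, hlat,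
      ← rotLin_apply]
    have : mercTangent θ₀ s₀ 0 0 = 0 := by
      ext i; fin_cases i <;> simp [mercTangent]
    rw [this, map_zero]
  · exact vortexField_symConfig_natAdd g f hn _ a

/-! ### Orbits of the dihedral group -/

theorem merc_eq_of_dvd {n : ℕ} (hn : 0 < n) {m m' : ℤ} (h : (n : ℤ) ∣ m - m') (θ s : ℝ) :
    merc (θ + m * (2 * Real.pi / n)) s = merc (θ + m' * (2 * Real.pi / n)) s := by
  obtain ⟨q, hq⟩ := h
  have hn0 : (n : ℝ) ≠ 0 := by positivity
  refine merc_eq_of_cos_eq_one ((Real.cos_eq_one_iff _).2 ⟨q, ?_⟩) s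
  have : (m : ℝ) - m' = n * q := by exact_mod_cast hq
  field_simp
  linear_combination (-2 * Real.pi) * this

theorem dvd_of_merc_eq {n : ℕ} (hn : 0 < n) {m m' : ℤ} {θ s s' : ℝ}
    (h : merc (θ + m * (2 * Real.pi / n)) s = merc (θ + m' * (2 * Real.pi / n)) s') :
    (n : ℤ) ∣ m - m' := by
  refine cos_mul_two_pi_div_eq_one hn ?_
  rw [← (merc_injective h).2]
  congr 1
  push_cast
  ring

theorem exists_fin_dvd {n : ℕ} (hn : 0 < n) (m : ℤ) : ∃ i : Fin n, (n : ℤ) ∣ (i : ℕ) - m := by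
  have h1 := Int.emod_nonneg m (by positivity : (n : ℤ) ≠ 0)
  have h2 := Int.emod_lt_of_pos m (by positivity : (0 : ℤ) < n)
  refine ⟨⟨(m % n).toNat, by omega⟩, ?_⟩
  simp only [Int.toNat_of_nonneg h1]
  exact ⟨-(m / n), by have := Int.emod_add_mul_ediv m n; linarith⟩

theorem equatorPoint_add (n l k : ℕ) : equatorPoint n (l + 2 * k) =
    merc (l * Real.pi / n + (k : ℤ) * (2 * Real.pi / n)) 0 := by
  rw [← merc_zero_eq_equatorPoint]
  congr 1
  push_cast
  ring

/-- The orbit of a vertex of the equatorial polygon. -/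
theorem range_rot_equatorPoint {n : ℕ} (hn : 0 < n) (g : Fin (2 * n) ≃ dihedral n) (l : ℕ) :
    range (fun j : Fin (2 * n) => rot (g j) (equatorPoint n l)) =
      {x | ∃ k : ℕ, k < n ∧ x = equatorPoint n (l + 2 * k)} := by
  have hn0 : (n : ℝ) ≠ 0 := by positivity
  obtain ⟨e, he1, he2⟩ := exists_dihedralEquiv hn
  have h1 : ∀ k, rot (e (Sum.inl k)) (equatorPoint n l) = equatorPoint n (l + 2 * k) := fun k => by
    rw [he1, ← merc_zero_eq_equatorPoint, rot_rotZ_merc, equatorPoint_add, Int.cast_natCast]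
  ext x
  constructor
  · rintro ⟨j, rfl⟩
    obtain ⟨p, hp⟩ := e.surjective (g j)
    simp only [← hp]
    rcases p with k | k
    · exact ⟨k, k.2, h1 k⟩
    -- The half-turned copy has longitude index −l − 2k = l + 2(−l − k).
    · obtain ⟨i, hi⟩ := exists_fin_dvd hn (-(l : ℤ) - (k : ℕ))
      refine ⟨i, i.2, ?_⟩
      rw [equatorPoint_add, merc_eq_of_dvd hn hi, he2, ← merc_zero_eq_equatorPoint,
        rot_rotZ_mul_merc, neg_zero]
      congr 1
      push_cast
      field_simp
      ring
  · rintro ⟨k, hk, rfl⟩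
    exact ⟨g.symm (e (Sum.inl ⟨k, hk⟩)), by simp [h1]⟩

/-- Exactly one rotation and exactly one half-turn carry the base vertex to a given vertex. -/
theorem ncard_rot_eq_equatorPoint {n : ℕ} (hn : 0 < n) (g : Fin (2 * n) ≃ dihedral n) (l : ℕ)
    {k : ℕ} (hk : k < n) :
    {j : Fin (2 * n) | rot (g j) (equatorPoint n l) = equatorPoint n (l + 2 * k)}.ncard = 2 := by
  have hn0 : (n : ℝ) ≠ 0 := by positivity
  obtain ⟨e, he1, he2⟩ := exists_dihedralEquiv hn
  have h1 : ∀ i : Fin n, rot (e (Sum.inl i)) (equatorPoint n l) =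
      merc (l * Real.pi / n + ((i : ℕ) : ℤ) * (2 * Real.pi / n)) 0 := fun i => by
    rw [he1, ← merc_zero_eq_equatorPoint, rot_rotZ_merc, Int.cast_natCast]
  have h2 : ∀ i : Fin n, rot (e (Sum.inr i)) (equatorPoint n l) =
      merc (l * Real.pi / n + (-(l : ℤ) - (i : ℕ) : ℤ) * (2 * Real.pi / n)) 0 := fun i => by
    rw [he2, ← merc_zero_eq_equatorPoint, rot_rotZ_mul_merc, neg_zero]
    congr 1
    push_cast
    field_simp
    ring
  have huniq : ∀ i i' : Fin n, (n : ℤ) ∣ (i : ℕ) - (i' : ℕ) → i = i' := fun i i' h =>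
    eq_of_cos_eq_one i i' (by
      have := (merc_injective (merc_eq_of_dvd hn h 0 0)).2
      rw [← this]; congr 1; push_cast; ring)
  obtain ⟨i₀, hi₀⟩ := exists_fin_dvd hn (-(l : ℤ) - k)
  rw [ncard_eq_of_equiv (e := e) g fun x => rot x (equatorPoint n l) = equatorPoint n (l + 2 * k)]
  have hset : {p : Fin n ⊕ Fin n |
      rot (e p) (equatorPoint n l) = equatorPoint n (l + 2 * k)} =
      {Sum.inl ⟨k, hk⟩, Sum.inr i₀} := by
    ext (i | i)
    · simp only [mem_ofPred_eq, h1, equatorPoint_add, mem_insert_iff, mem_singleton_iff,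
        Sum.inl.injEq, reduceCtorEq, or_false]
      refine ⟨fun h => huniq _ _ (by simpa using dvd_of_merc_eq hn h), ?_⟩
      rintro rfl; rfl
    · simp only [mem_ofPred_eq, h2, equatorPoint_add, mem_insert_iff, mem_singleton_iff,
        Sum.inr.injEq, reduceCtorEq, false_or]
      refine ⟨fun h => huniq _ _ ?_, ?_⟩
      · have h3 := dvd_of_merc_eq hn h
        have := dvd_add h3 hi₀
        rw [← dvd_neg]
        convert this using 1
        ring
      · rintro rfl
        obtain ⟨c, hc⟩ := hi₀
        exact merc_eq_of_dvd hn ⟨-c, by linarith⟩ _ _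
  rw [hset, ncard_pair (by simp)]

/-! ### The vertices of the anti-prism -/

theorem antiprismPoint_tanh (n : ℕ) (z : ℝ) {σ : ℝ} (hσ : σ = 1 ∨ σ = -1) (k : ℕ) :
    antiprismPoint n (Real.tanh z) σ k = merc ((2 * k + 1) * Real.pi / (2 * n)) (σ * z) := by
  have hc := Real.cosh_pos z
  have hsq : √(1 - Real.tanh z ^ 2) = 1 / Real.cosh z := by
    rw [Real.tanh_eq_sinh_div_cosh, show 1 - (Real.sinh z / Real.cosh z) ^ 2 =
      (1 / Real.cosh z) ^ 2 by field_simp; linear_combination Real.cosh_sq z,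
      Real.sqrt_sq (by positivity)]
  have h1 : Real.cosh (σ * z) = Real.cosh z ∧ Real.sinh (σ * z) = σ * Real.sinh z := by
    rcases hσ with rfl | rfl <;> simp
  rw [antiprismPoint, merc, hsq, h1.1, h1.2, Real.tanh_eq_sinh_div_cosh]
  congr 1
  ext i
  fin_cases i <;> simp <;> ring

theorem mul_neg_one_pow_eq_or (k : ℕ) {σ : ℝ} (hσ : σ = 1 ∨ σ = -1) :
    σ * (-1) ^ k = 1 ∨ σ * (-1) ^ k = -1 := by
  rcases hσ with rfl | rfl <;> rcases neg_one_pow_eq_or ℝ k with h | h <;> simp [h]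

/-- The orbit of a vertex of the anti-prism. -/
theorem range_rot_antiprismPoint {n : ℕ} (hn : 0 < n) (g : Fin (2 * n) ≃ dihedral n) (z : ℝ)
    {σ : ℝ} (hσ : σ = 1 ∨ σ = -1) (l : ℕ) :
    range (fun j : Fin (2 * n) => rot (g j) (antiprismPoint n (Real.tanh z) σ l)) =
      antiprismVertices n (Real.tanh z) (σ * (-1) ^ l) := by
  have hn0 : (n : ℝ) ≠ 0 := by positivity
  have hn0' : (n : ℤ) ≠ 0 := by positivity
  obtain ⟨e, he1, he2⟩ := exists_dihedralEquiv hn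
  set θ := (2 * (l : ℝ) + 1) * Real.pi / (2 * n) with hθ
  have h1 : ∀ i : Fin n, rot (e (Sum.inl i)) (antiprismPoint n (Real.tanh z) σ l) =
      merc (θ + ((i : ℕ) : ℤ) * (2 * Real.pi / n)) (σ * z) := fun i => by
    rw [he1, antiprismPoint_tanh n z hσ, rot_rotZ_merc, Int.cast_natCast]
  have h2 : ∀ i : Fin n, rot (e (Sum.inr i)) (antiprismPoint n (Real.tanh z) σ l) =
      merc (-θ + (-(i : ℕ) : ℤ) * (2 * Real.pi / n)) (-(σ * z)) := fun i => by
    rw [he2, antiprismPoint_tanh n z hσ, rot_rotZ_mul_merc]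
    congr 1
    push_cast
    ring
  have h3 : ∀ k : ℕ, antiprismPoint n (Real.tanh z) (σ * (-1) ^ l * (-1) ^ k) k =
      merc ((2 * k + 1) * Real.pi / (2 * n)) (σ * (-1) ^ l * (-1) ^ k * z) := fun k =>
    antiprismPoint_tanh n z (mul_neg_one_pow_eq_or k (mul_neg_one_pow_eq_or l hσ)) k
  -- Rotations shift the longitude index by an even number and keep the height.
  have heven : ∀ (k : ℕ) (m : ℤ), (k : ℤ) = l + 2 * m →
      antiprismPoint n (Real.tanh z) (σ * (-1) ^ l * (-1) ^ k) k =
        merc (θ + m * (2 * Real.pi / n)) (σ * z) := fun k m hkm => by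
    have hkm' : (k : ℝ) = l + 2 * m := by exact_mod_cast hkm
    have hp : (-1 : ℝ) ^ l * (-1) ^ k = 1 := by
      rw [← pow_add]; exact Even.neg_one_pow ⟨((l : ℤ) + m).toNat, by omega⟩
    rw [h3, mul_assoc σ, hp, mul_one, hkm', hθ]
    congr 1
    field_simp
    ring
  -- Half-turns send the index l + 2i to −l − 1 − 2i, of opposite parity, and reverse the height.
  have hodd : ∀ (k : ℕ) (m : ℤ), (k : ℤ) = -(l : ℤ) - 1 + 2 * m →
      antiprismPoint n (Real.tanh z) (σ * (-1) ^ l * (-1) ^ k) k =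
        merc (-θ + m * (2 * Real.pi / n)) (-(σ * z)) := fun k m hkm => by
    have hkm' : (k : ℝ) = -l - 1 + 2 * m := by exact_mod_cast hkm
    have hp : (-1 : ℝ) ^ l * (-1) ^ k = -1 := by
      rw [← pow_add]; exact Odd.neg_one_pow ⟨(m - 1).toNat, by omega⟩
    rw [h3, mul_assoc σ, hp, hkm', hθ]
    congr 1
    · field_simp
      ring
    · ring
  ext x
  constructor
  · rintro ⟨j, rfl⟩
    obtain ⟨p, hp⟩ := e.surjective (g j)
    simp only [← hp]
    rcases p with i | i
    · have e1 := Int.emod_nonneg ((l : ℤ) + 2 * (i : ℕ)) (by omega : (2 * n : ℤ) ≠ 0)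
      have e2 := Int.emod_lt_of_pos ((l : ℤ) + 2 * (i : ℕ)) (by omega : 0 < (2 * n : ℤ))
      have e3 := Int.emod_add_mul_ediv ((l : ℤ) + 2 * (i : ℕ)) (2 * n)
      refine ⟨(((l : ℤ) + 2 * (i : ℕ)) % (2 * n)).toNat, by omega, ?_⟩
      rw [h1, heven _ ((i : ℕ) - n * (((l : ℤ) + 2 * (i : ℕ)) / (2 * n)))
        (by rw [Int.toNat_of_nonneg e1]; linarith)]
      exact merc_eq_of_dvd hn ⟨((l : ℤ) + 2 * (i : ℕ)) / (2 * n), by ring⟩ _ _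
    · have e1 := Int.emod_nonneg (-(l : ℤ) - 1 - 2 * (i : ℕ)) (by omega : (2 * n : ℤ) ≠ 0)
      have e2 := Int.emod_lt_of_pos (-(l : ℤ) - 1 - 2 * (i : ℕ)) (by omega : 0 < (2 * n : ℤ))
      have e3 := Int.emod_add_mul_ediv (-(l : ℤ) - 1 - 2 * (i : ℕ)) (2 * n)
      refine ⟨((-(l : ℤ) - 1 - 2 * (i : ℕ)) % (2 * n)).toNat, by omega, ?_⟩
      rw [h2, hodd _ (-(i : ℕ) - n * ((-(l : ℤ) - 1 - 2 * (i : ℕ)) / (2 * n)))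
        (by rw [Int.toNat_of_nonneg e1]; linarith)]
      exact merc_eq_of_dvd hn ⟨(-(l : ℤ) - 1 - 2 * (i : ℕ)) / (2 * n), by ring⟩ _ _
  · rintro ⟨k, hk, rfl⟩
    rcases Int.even_or_odd' ((k : ℤ) - l) with ⟨m, hm | hm⟩
    · obtain ⟨i, hi⟩ := exists_fin_dvd hn m
      refine ⟨g.symm (e (Sum.inl i)), ?_⟩
      simp only [Equiv.apply_symm_apply]
      rw [h1, heven k m (by linarith)]
      exact merc_eq_of_dvd hn hi _ _
    · obtain ⟨i, hi⟩ := exists_fin_dvd hn (-(m + l + 1))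
      refine ⟨g.symm (e (Sum.inr i)), ?_⟩
      simp only [Equiv.apply_symm_apply]
      rw [h2, hodd k (m + l + 1) (by linarith)]
      obtain ⟨c, hc⟩ := hi
      exact merc_eq_of_dvd hn ⟨-c, by linarith⟩ _ _

/-! ### The cube and the icosahedron -/

theorem exists_orthonormalBasis_eq {v : Fin 3 → E3} (hv : Orthonormal ℝ v) :
    ∃ b : OrthonormalBasis (Fin 3) ℝ E3, ∀ i, b i = v i := by
  obtain ⟨b, hb⟩ := Orthonormal.exists_orthonormalBasis_extension_of_card_eq (ι := Fin 3) (𝕜 := ℝ)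
    (E := E3) (by simp) (v := v) (s := univ) (hv.comp _ Subtype.val_injective)
  exact ⟨b, fun i => hb i (mem_univ i)⟩

theorem inner_eq_sum (u v : E3) : inner ℝ u v = u 0 * v 0 + u 1 * v 1 + u 2 * v 2 := by
  rw [PiLp.inner_apply, Fin.sum_univ_three]; simp; ring

/-- A set of points determined by the signs of their coordinates is exhausted by a subset with as
many elements as there are sign patterns. -/
theorem eq_of_sign_injOn (b : OrthonormalBasis (Fin 3) ℝ E3) {S T : Set E3}
    {A : Finset (Fin 3 → SignType)} (hST : S ⊆ T) (hcard : A.card ≤ S.ncard)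
    (hA : ∀ x ∈ T, (fun i => SignType.sign (inner ℝ (b i) x)) ∈ A)
    (habs : ∀ x ∈ T, ∀ y ∈ T, (∀ i, SignType.sign (inner ℝ (b i) x : ℝ) =
      SignType.sign (inner ℝ (b i) y : ℝ)) → ∀ i, |inner ℝ (b i) x| = |inner ℝ (b i) y|) :
    S = T := by
  have hinj : InjOn (fun x i => SignType.sign (inner ℝ (b i) x : ℝ)) T := by
    intro x hx y hy hxy
    have hs : ∀ i, SignType.sign (inner ℝ (b i) x : ℝ) = SignType.sign (inner ℝ (b i) y : ℝ) :=
      fun i => congrFun hxy i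
    have ha := habs x hx y hy hs
    refine b.repr.injective (PiLp.ext fun i => ?_)
    rw [b.repr_apply_apply, b.repr_apply_apply, ← sign_mul_abs (inner ℝ (b i) x), hs i, ha i,
      sign_mul_abs]
  have hT : T.Finite := Set.Finite.of_injOn (fun x hx => hA x hx) hinj A.finite_toSet
  refine eq_of_subset_of_ncard_le hST (le_trans ?_ hcard) hT
  rw [← ncard_coe_finset A]
  exact ncard_le_ncard_of_injOn _ (fun x hx => hA x hx) hinj A.finite_toSet

/-- A cube has one vertex for each of the 8 sign patterns without zeros, so inclusion and
cardinality suffice. -/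
theorem isCube_of_subset {S : Set E3} {v : Fin 3 → E3} (hv : Orthonormal ℝ v) (hS : S.ncard = 8)
    (h : ∀ x ∈ S, ∀ i, |inner ℝ (v i) x| = 1 / √3) : IsCube S := by
  obtain ⟨b, hb⟩ := exists_orthonormalBasis_eq hv
  refine ⟨b, eq_of_sign_injOn b (A := Finset.univ.filter fun f => ∀ i, f i ≠ 0)
    (fun x hx i => by rw [hb]; exact h x hx i) (by rw [hS]; decide) (fun x hx => ?_)
    fun x hx y hy _ i => by rw [hx i, hy i]⟩
  simp only [Finset.mem_filter, Finset.mem_univ, true_and, ne_eq, sign_eq_zero_iff]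
  intro i hi
  have h1 := hx i
  rw [hi, abs_zero] at h1
  exact absurd h1 (by positivity)

/-- An icosahedron has one vertex for each of the 12 = 3 · 4 sign patterns with exactly one zero;
the place of the zero determines the absolute values of the coordinates. -/
theorem isIcosahedron_of_subset {S : Set E3} {v : Fin 3 → E3} (hv : Orthonormal ℝ v)
    (hS : S.ncard = 12) (h : ∀ x ∈ S, ∃ i : Fin 3, inner ℝ (v i) x = 0 ∧
      |inner ℝ (v (i + 1)) x| = 1 / √(1 + Real.goldenRatio ^ 2) ∧
      |inner ℝ (v (i + 2)) x| = Real.goldenRatio / √(1 + Real.goldenRatio ^ 2)) :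
    IsIcosahedron S := by
  obtain ⟨b, hb⟩ := exists_orthonormalBasis_eq hv
  have hφ := Real.goldenRatio_pos
  have hne1 : ∀ x : ℝ, |x| = 1 / √(1 + Real.goldenRatio ^ 2) → x ≠ 0 := by
    rintro _ h1 rfl
    rw [abs_zero] at h1
    exact absurd h1 (by positivity)
  have hne2 : ∀ x : ℝ, |x| = Real.goldenRatio / √(1 + Real.goldenRatio ^ 2) → x ≠ 0 := by
    rintro _ h1 rfl
    rw [abs_zero] at h1
    exact absurd h1 (by positivity)
  refine ⟨b, eq_of_sign_injOn b
    (A := Finset.univ.filter fun f => ∃ i : Fin 3, f i = 0 ∧ f (i + 1) ≠ 0 ∧ f (i + 2) ≠ 0)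
    (fun x hx => by simpa only [mem_ofPred_eq, hb] using h x hx) (by rw [hS]; decide)
    (fun x hx => ?_) fun x hx y hy hxy => ?_⟩
  · obtain ⟨i, h0, h1, h2⟩ := hx
    simp only [Finset.mem_filter, Finset.mem_univ, true_and, ne_eq, sign_eq_zero_iff]
    exact ⟨i, h0, hne1 _ h1, hne2 _ h2⟩
  · obtain ⟨i, h0, h1, h2⟩ := hx
    obtain ⟨j, k0, k1, k2⟩ := hy
    have hz : inner ℝ (b i) y = 0 := by rw [← sign_eq_zero_iff, ← hxy, h0, sign_zero]
    have hij : j = i := by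
      have n1 := hne1 _ k1
      have n2 := hne2 _ k2
      have hcases : ∀ j i : Fin 3, j = i ∨ j + 1 = i ∨ j + 2 = i := by decide
      rcases hcases j i with h | h | h
      · exact h
      · rw [h] at n1; exact absurd hz n1
      · rw [h] at n2; exact absurd hz n2
    subst hij
    intro l
    have hcases : ∀ j l : Fin 3, l = j ∨ l = j + 1 ∨ l = j + 2 := by decide
    rcases hcases j l with rfl | rfl | rfl
    · rw [h0, k0]
    · rw [h1, k1]
    · rw [h2, k2]

theorem range_symConfig {m : ℕ} {K : Subgroup SO3} (g : Fin m ≃ K) (f : Fin 2 ≃ poles) (u : E3) :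
    range (symConfig g f u) = range (fun j => rot (g j) u) ∪ poles := by
  ext x
  constructor
  · rintro ⟨j, rfl⟩
    refine Fin.addCases (fun a => ?_) (fun a => ?_) j
    · left; exact ⟨a, by simp [symConfig]⟩
    · right; simp [symConfig]
  · rintro (⟨a, rfl⟩ | hx)
    · exact ⟨Fin.castAdd 2 a, by simp [symConfig]⟩
    · exact ⟨Fin.natAdd m (f.symm ⟨x, hx⟩), by simp [symConfig]⟩

/-! ### Multiple-argument formulas for tanh and the heights for n = 3 and n = 5. -/

theorem tanh_add_mul (x y : ℝ) : Real.tanh (x + y) * (1 + Real.tanh x * Real.tanh y) =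
    Real.tanh x + Real.tanh y := by
  have h1 := (Real.cosh_pos x).ne'
  have h2 := (Real.cosh_pos y).ne'
  have h3 := (Real.cosh_pos (x + y)).ne'
  simp only [Real.tanh_eq_sinh_div_cosh]
  rw [Real.cosh_add] at h3
  rw [Real.sinh_add, Real.cosh_add]
  rw [mul_comm (Real.cosh x)] at h3 ⊢
  field_simp

theorem tanh_two_mul (x : ℝ) : Real.tanh (2 * x) = 2 * Real.tanh x / (1 + Real.tanh x ^ 2) := by
  have := tanh_add_mul x x
  rw [eq_div_iff (by positivity), two_mul x]
  linarith

theorem tanh_three_mul (x : ℝ) : Real.tanh (3 * x) =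
    (3 * Real.tanh x + Real.tanh x ^ 3) / (1 + 3 * Real.tanh x ^ 2) := by
  have h := tanh_add_mul (2 * x) x
  have h1 : 1 + Real.tanh x ^ 2 ≠ 0 := by positivity
  rw [tanh_two_mul, show 2 * x + x = 3 * x by ring] at h
  rw [eq_div_iff (by positivity)]
  field_simp at h
  linarith

theorem tanh_five_mul (x : ℝ) : Real.tanh (5 * x) =
    (5 * Real.tanh x + 10 * Real.tanh x ^ 3 + Real.tanh x ^ 5) /
      (1 + 10 * Real.tanh x ^ 2 + 5 * Real.tanh x ^ 4) := by
  have h := tanh_add_mul (2 * x) (3 * x)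
  have h1 : 1 + Real.tanh x ^ 2 ≠ 0 := by positivity
  have h2 : 1 + 3 * Real.tanh x ^ 2 ≠ 0 := by positivity
  rw [tanh_two_mul, tanh_three_mul, show 2 * x + 3 * x = 5 * x by ring] at h
  rw [eq_div_iff (by positivity)]
  field_simp at h
  linarith

theorem tanh_eq_of_three {z : ℝ} (hz : 0 < z)
    (h : (3 : ℕ) * Real.tanh ((3 : ℕ) * z) - (2 * (3 : ℕ) + 1) * Real.tanh z = 0) :
    Real.tanh z = 1 / 3 := by
  have ht := tanh_pos hz
  push_cast at h
  rw [tanh_three_mul] at h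
  generalize Real.tanh z = t at *
  have h1 : 1 + 3 * t ^ 2 ≠ 0 := by positivity
  field_simp at h
  have h2 : t * ((3 * t - 1) * (3 * t + 1)) = 0 := by nlinarith
  have h3 := (mul_eq_zero.1 h2).resolve_left ht.ne'
  have h4 := (mul_eq_zero.1 h3).resolve_right (by positivity)
  linarith

theorem tanh_eq_of_five {z : ℝ} (hz : 0 < z)
    (h : (5 : ℕ) * Real.tanh ((5 : ℕ) * z) - (2 * (5 : ℕ) + 1) * Real.tanh z = 0) :
    Real.tanh z = 1 / √5 := by
  have ht := tanh_pos hz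
  push_cast at h
  rw [tanh_five_mul] at h
  generalize Real.tanh z = t at *
  have h1 : 1 + 10 * t ^ 2 + 5 * t ^ 4 ≠ 0 := by positivity
  field_simp at h
  have h2 : t * ((5 * t ^ 2 - 1) * (5 * t ^ 2 + 7)) = 0 := by nlinarith
  have h3 := (mul_eq_zero.1 h2).resolve_left ht.ne'
  have h4 := (mul_eq_zero.1 h3).resolve_right (by positivity)
  have h5 : √5 * t = 1 := by
    have : (√5 * t) ^ 2 = 1 := by
      rw [mul_pow, Real.sq_sqrt (by norm_num)]; linarith
    exact (pow_eq_one_iff_of_nonneg (by positivity) two_ne_zero).1 this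
  field_simp
  linarith

/-- The frame is symmetric about the third axis, so that both poles have coordinates of modulus 1/√3
and lie on a diagonal of the cube. -/
theorem isCube_antiprism {S : Set E3} {τ : ℝ} (hτ : τ = 1 ∨ τ = -1) (hS : S.ncard = 8)
    (h : S = antiprismVertices 3 (1 / 3) τ ∪ poles) : IsCube S := by
  have hτ2 : τ ^ 2 = 1 := by rcases hτ with rfl | rfl <;> norm_num
  have h3 : (0 : ℝ) < √3 := by positivity
  have hs3 : √(3 : ℝ) ^ 2 = 3 := Real.sq_sqrt (by norm_num)
  have hs2 : √(2 : ℝ) ^ 2 = 2 := Real.sq_sqrt (by norm_num)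
  have hsq : √(1 - (1 / 3 : ℝ) ^ 2) = 2 * √2 / 3 := by
    rw [show (1 - (1 / 3 : ℝ) ^ 2) = (2 * √2 / 3) ^ 2 by linear_combination (-4 / 9) * hs2,
      Real.sqrt_sq (by positivity)]
  -- A vertex on the side of the pole with coordinates of one sign has exactly one coordinate of the
  -- other sign, and its longitude is opposite to that axis; the vertex at longitude π/6 gives π/6 +
  -- π = 7π/6.
  set α : Fin 3 → ℝ := fun i => 7 * Real.pi / 6 + (i : ℕ) * (2 * Real.pi / 3) with hα
  set v : Fin 3 → E3 := fun i => !₂[√2 / √3 * Real.cos (α i), √2 / √3 * Real.sin (α i), τ / √3]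
    with hv
  have hinner : ∀ i j, inner ℝ (v i) (v j) = 2 / 3 * Real.cos (α i - α j) + 1 / 3 := by
    intro i j
    rw [inner_eq_sum, Real.cos_sub]
    simp [v]
    field_simp
    rw [hs2, hs3, hτ2]
    ring
  have hsame : ∀ i j, Real.cos (α i - α j) = if i = j then 1 else -1 / 2 := by
    have e1 : Real.cos (2 * Real.pi / 3) = -1 / 2 := by
      rw [show 2 * Real.pi / 3 = Real.pi - Real.pi / 3 by ring, Real.cos_pi_sub,
        Real.cos_pi_div_three]; norm_num
    have e2 : Real.cos (2 * (2 * Real.pi / 3)) = -1 / 2 := by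
      rw [Real.cos_two_mul, e1]; norm_num
    intro i j
    rw [show α i - α j = (((i : ℕ) : ℝ) - (j : ℕ)) * (2 * Real.pi / 3) by simp only [hα]; ring]
    fin_cases i <;> fin_cases j <;> norm_num [e1, e2, Real.cos_neg]
  have horth : Orthonormal ℝ v := by
    rw [orthonormal_iff_ite]
    intro i j
    rw [hinner, hsame]
    split_ifs <;> norm_num
  refine isCube_of_subset horth hS fun x hx i => ?_
  rw [h] at hx
  rcases hx with ⟨k, -, rfl⟩ | hx
  · set y : ℝ := (-1) ^ k with hy
    have hy2 : y ^ 2 = 1 := by rw [hy, ← pow_mul, mul_comm, pow_mul]; norm_num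
    set c := Real.cos (α i - (2 * k + 1) * Real.pi / (2 * 3)) with hc
    have hin : inner ℝ (v i) (antiprismPoint 3 (1 / 3) (τ * y) k) = (4 * c + y) / (3 * √3) := by
      rw [inner_eq_sum, antiprismPoint, hsq, hc, Real.cos_sub]
      simp only [v, Matrix.cons_val_zero, Matrix.cons_val_one, Matrix.cons_val, Nat.cast_ofNat]
      field_simp
      linear_combination y * hτ2 + (2 * Real.cos (α i) * Real.cos ((2 * k + 1) * Real.pi / (2 * 3)) +
        2 * Real.sin (α i) * Real.sin ((2 * k + 1) * Real.pi / (2 * 3))) * hs2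
    have hcube : 4 * c ^ 3 - 3 * c = -y := by
      rw [hc, ← Real.cos_three_mul, show 3 * (α i - (2 * k + 1) * Real.pi / (2 * 3)) =
        Real.pi - k * Real.pi + ((i : ℕ) + 1 : ℕ) * (2 * Real.pi) by
          simp only [hα]; push_cast; ring, Real.cos_add_nat_mul_two_pi, Real.cos_pi_sub,
        Real.cos_nat_mul_pi]
    -- The triple-angle equation 4c³ − 3c + y = 0 factors because y² = 1; both roots give 4c + y =
    -- ±3.
    have hfac : (c + y) * (2 * c - y) ^ 2 = 0 := by
      linear_combination hcube + (c + y - 4 * c) * hy2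
    have hval : (4 * c + y) ^ 2 = 3 ^ 2 := by
      rcases mul_eq_zero.1 hfac with h1 | h1
      · rw [show c = -y by linarith]; linear_combination 9 * hy2
      · have := pow_eq_zero_iff two_ne_zero |>.1 h1
        rw [show c = y / 2 by linarith]; linear_combination 9 * hy2
    have habs : |4 * c + y| = 3 := by
      rw [← abs_of_pos (show (0 : ℝ) < 3 by norm_num)]; exact sq_eq_sq_iff_abs_eq_abs _ _ |>.1 hval
    rw [hin, abs_div, habs, abs_of_pos (by positivity)]
    field_simp
  · have habs : |τ| = 1 := by rcases hτ with rfl | rfl <;> simp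
    have hin : |inner ℝ (v i) x| = |τ / √3| := by
      rcases hx with rfl | rfl
      · rw [inner_eq_sum]; simp [v, northPole]
      · rw [inner_eq_sum]; simp [v, northPole]
    rw [hin, abs_div, habs, abs_of_pos h3]

/-- The frame keeps the first axis and turns the orthogonal plane so that the north pole has
coordinates (0, −τ, τφ)/D with D² = 1 + φ². -/
theorem isIcosahedron_antiprism {S : Set E3} {τ : ℝ} (hτ : τ = 1 ∨ τ = -1) (hS : S.ncard = 12)
    (h : S = antiprismVertices 5 (1 / √5) τ ∪ poles) : IsIcosahedron S := by
  have hτ2 : τ ^ 2 = 1 := by rcases hτ with rfl | rfl <;> norm_num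
  have hs5 : √(5 : ℝ) ^ 2 = 5 := Real.sq_sqrt (by norm_num)
  have h5 : (0 : ℝ) < √5 := by positivity
  have hsq : √(1 - (1 / √5 : ℝ) ^ 2) = 2 / √5 := by
    rw [show (1 - (1 / √5 : ℝ) ^ 2) = (2 / √5) ^ 2 by
      field_simp; linear_combination hs5, Real.sqrt_sq (by positivity)]
  have hφ0 := Real.goldenRatio_pos
  have hφ := Real.goldenRatio_sq
  have hφ5 : √5 = 2 * Real.goldenRatio - 1 := by unfold Real.goldenRatio; ring
  set φ := Real.goldenRatio
  set D := √(1 + φ ^ 2) with hD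
  have hD0 : 0 < D := by positivity
  have hD2 : D ^ 2 = φ + 2 := by rw [hD, Real.sq_sqrt (by positivity), hφ]; ring
  have hD5 : D ^ 2 = √5 * φ := by rw [hD2, hφ5]; linear_combination (-2) * hφ
  set v : Fin 3 → E3 := ![!₂[1, 0, 0], !₂[0, φ / D, -τ / D], !₂[0, 1 / D, τ * φ / D]] with hv
  have horth : Orthonormal ℝ v := by
    rw [orthonormal_iff_ite]
    intro i j
    rw [inner_eq_sum]
    fin_cases i <;> fin_cases j <;> simp [v] <;> field_simp
    · rw [hD2, hτ2]; linear_combination hφ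
    · linear_combination (-φ) * hτ2
    · linear_combination (-φ) * hτ2
    · rw [hD2, hτ2]; linear_combination hφ
  refine isIcosahedron_of_subset horth hS fun x hx => ?_
  have hv0 : ∀ x : E3, inner ℝ (v 0) x = x 0 := fun x => by rw [inner_eq_sum]; simp [v]
  have hv1 : ∀ x : E3, inner ℝ (v 1) x = (φ * x 1 - τ * x 2) / D := fun x => by
    rw [inner_eq_sum]; simp [v]; ring
  have hv2 : ∀ x : E3, inner ℝ (v 2) x = (x 1 + τ * φ * x 2) / D := fun x => by
    rw [inner_eq_sum]; simp [v]; ring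
  have sq_abs_eq : ∀ a b : ℝ, 0 ≤ b → a ^ 2 = b ^ 2 → |a| = b := fun a b hb h => by
    rw [← abs_of_nonneg hb]; exact (sq_eq_sq_iff_abs_eq_abs _ _).1 h
  change ∃ i : Fin 3, inner ℝ (v i) x = 0 ∧ |inner ℝ (v (i + 1)) x| = 1 / D ∧
    |inner ℝ (v (i + 2)) x| = φ / D
  clear_value v D φ
  rw [h] at hx
  rcases hx with ⟨k, -, rfl⟩ | hx
  · set y : ℝ := (-1) ^ k with hy
    have hy2 : y ^ 2 = 1 := by rw [hy, ← pow_mul, mul_comm, pow_mul]; norm_num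
    set c := Real.cos ((2 * k + 1) * Real.pi / (2 * 5)) with hc
    set s := Real.sin ((2 * k + 1) * Real.pi / (2 * 5)) with hs
    have hsc : s ^ 2 + c ^ 2 = 1 := Real.sin_sq_add_cos_sq _
    have hp : antiprismPoint 5 (1 / √5) (τ * y) k = !₂[2 / √5 * c, 2 / √5 * s, τ * y / √5] := by
      rw [antiprismPoint, hsq, mul_one_div]; rfl
    rw [hp]
    have i0 : inner ℝ (v 0) !₂[2 / √5 * c, 2 / √5 * s, τ * y / √5] = 2 * c / √5 := by
      rw [hv0]; simp; ring
    have i1 : inner ℝ (v 1) !₂[2 / √5 * c, 2 / √5 * s, τ * y / √5] =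
        (2 * φ * s - y) / (√5 * D) := by
      rw [hv1]; simp; field_simp; linear_combination (-y) * hτ2
    have i2 : inner ℝ (v 2) !₂[2 / √5 * c, 2 / √5 * s, τ * y / √5] =
        (2 * s + φ * y) / (√5 * D) := by
      rw [hv2]; simp; field_simp; linear_combination φ * y * hτ2
    have hfive : 16 * s ^ 5 - 20 * s ^ 3 + 5 * s = y := by
      have e : Real.sin (5 * ((2 * k + 1) * Real.pi / (2 * 5))) = y := by
        rw [show 5 * ((2 * (k : ℝ) + 1) * Real.pi / (2 * 5)) = k * Real.pi + Real.pi / 2 by ring,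
          Real.sin_add_pi_div_two, Real.cos_nat_mul_pi]
      have e5 : ∀ x : ℝ, Real.sin (5 * x) =
          16 * Real.sin x ^ 5 - 20 * Real.sin x ^ 3 + 5 * Real.sin x := fun x => by
        rw [show 5 * x = 2 * x + 3 * x by ring, Real.sin_add, Real.sin_two_mul, Real.cos_two_mul,
          Real.sin_three_mul, Real.cos_three_mul]
        have := Real.cos_sq' x
        linear_combination Real.sin x * (8 * Real.cos x ^ 2 + 8 - 16 * Real.sin x ^ 2) * this
      rw [← e, e5]
    -- The quintic for sin of a fifth of an angle is (s − y)(4s² + 2sy − y²)² = 0, and the golden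
    -- ratio splits the quadratic. The three factors correspond to the three positions of the
    -- vanishing coordinate.
    have hfac : (s - y) * ((2 * s - (φ - 1) * y) * (2 * s + φ * y)) = 0 := by
      have h0 : (s - y) * (4 * s ^ 2 + 2 * s * y - y ^ 2) ^ 2 = 0 := by
        linear_combination hfive + (-20 * s ^ 3 + (5 * s - y) * (y ^ 2 + 1)) * hy2
      rcases mul_eq_zero.1 h0 with h1 | h1
      · rw [h1, zero_mul]
      · have h2 := pow_eq_zero_iff two_ne_zero |>.1 h1
        linear_combination (s - y) * h2 - (s - y) * y ^ 2 * hφ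
    rcases mul_eq_zero.1 hfac with h1 | h1
    · have hsy : s = y := by linarith
      have hc0 : c = 0 := pow_eq_zero_iff two_ne_zero |>.1 (by rw [hsy, hy2] at hsc; linarith)
      refine ⟨0, by rw [i0, hc0]; simp, sq_abs_eq _ _ (by positivity) ?_,
        sq_abs_eq _ _ (by positivity) ?_⟩
      · rw [zero_add, i1, hsy]
        rw [show 2 * φ * y - y = √5 * y by rw [hφ5]; ring]
        field_simp
        exact hy2
      · rw [zero_add, i2, hsy]
        rw [show 2 * y + φ * y = D ^ 2 * y by rw [hD2]; ring, hD5]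
        field_simp
        exact hy2
    · rcases mul_eq_zero.1 h1 with h2 | h2
      · have hs1 : 2 * s = (φ - 1) * y := by linarith
        refine ⟨1, ?_, sq_abs_eq _ _ (by positivity) ?_, sq_abs_eq _ _ (by positivity) ?_⟩
        · rw [i1, show 2 * φ * s - y = 0 by linear_combination φ * hs1 + y * hφ, zero_div]
        · rw [show (1 : Fin 3) + 1 = 2 by decide, i2, hs1,
            show (φ - 1) * y + φ * y = √5 * y by rw [hφ5]; ring]
          field_simp
          exact hy2
        · rw [show (1 : Fin 3) + 2 = 0 by decide, i0]
          have : (2 * c) ^ 2 = D ^ 2 := by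
            rw [hD2]
            linear_combination 4 * hsc - (2 * s + (φ - 1) * y) * hs1 - (φ - 1) ^ 2 * hy2 - hφ
          rw [div_pow, div_pow, this]
          rw [div_eq_div_iff (by positivity) (by positivity)]
          linear_combination (D ^ 2 + √5 * φ) * hD5
      · have hs1 : 2 * s = -φ * y := by linarith
        refine ⟨2, ?_, sq_abs_eq _ _ (by positivity) ?_, sq_abs_eq _ _ (by positivity) ?_⟩
        · rw [i2, h2, zero_div]
        · rw [show (2 : Fin 3) + 1 = 0 by decide, i0]
          have : (2 * c) ^ 2 * D ^ 2 = 5 := by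
            have h4 : (2 * c) ^ 2 = 3 - φ := by
              linear_combination 4 * hsc - (2 * s - φ * y) * hs1 - φ ^ 2 * hy2 - hφ
            rw [hD2, h4]
            linear_combination -hφ
          rw [div_pow, div_pow, div_eq_div_iff (by positivity) (by positivity), this, hs5]
          norm_num
        · rw [show (2 : Fin 3) + 2 = 1 by decide, i1,
            show 2 * φ * s - y = -(√5 * φ) * y by
              rw [← hD5, hD2]; linear_combination φ * hs1 - y * hφ]
          field_simp
          exact hy2
  · have hD1 : |τ / D| = 1 / D := by
      rw [abs_div, abs_of_pos hD0]; rcases hτ with rfl | rfl <;> simp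
    have hD3 : |τ * φ / D| = φ / D := by
      rw [abs_div, abs_mul, abs_of_pos hD0, abs_of_pos hφ0]; rcases hτ with rfl | rfl <;> simp
    refine ⟨0, ?_, ?_, ?_⟩
    · rw [hv0]; rcases hx with rfl | rfl <;> simp [northPole]
    · rw [zero_add, hv1, ← hD1]
      rcases hx with rfl | rfl <;> simp [northPole, abs_div]
    · rw [zero_add, hv2, ← hD3]
      rcases hx with rfl | rfl <;> simp [northPole, abs_div]

/-! ### Assembly of the three families. -/

theorem cos_antiprism_lon {n : ℕ} (hn : 0 < n) (l : ℕ) :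
    Real.cos (n * (2 * ((2 * l + 1) * Real.pi / (2 * n)))) = -1 := by
  have : (n : ℝ) ≠ 0 := by positivity
  rw [show n * (2 * ((2 * (l : ℝ) + 1) * Real.pi / (2 * n))) = Real.pi + l * (2 * Real.pi) by
    field_simp; ring, Real.cos_add_nat_mul_two_pi, Real.cos_pi]

theorem cos_equator_lon {n : ℕ} (hn : 0 < n) (l : ℕ) :
    Real.cos (n * (2 * (l * Real.pi / n))) = 1 := by
  have : (n : ℝ) ≠ 0 := by positivity
  rw [show n * (2 * ((l : ℝ) * Real.pi / n)) = l * (2 * Real.pi) by field_simp,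
    Real.cos_nat_mul_two_pi]

theorem corollary5p2 (n : ℕ) (hn : 2 ≤ n)
    (g : Fin (2 * n) ≃ dihedral n) (f : Fin 2 ≃ poles) :
    -- the family emanating from the anti-prism with poles
    (3 ≤ n →
      ∃ lam z : ℝ, (1 < lam ∧ (antiprismPoly n).eval lam = 0 ∧
          ∀ μ : ℝ, 1 < μ → (antiprismPoly n).eval μ = 0 → μ = lam) ∧
        (0 < z ∧ z < 1 ∧ z ^ 2 = 1 - 1 / lam ^ 2) ∧
        ∀ s ∈ ({1, -1} : Set ℝ), ∀ l : ℕ, l < 2 * n →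
          ∀ (u₀ : E3) (v₀ : Fin (2 * n + 2) → E3),
          u₀ = antiprismPoint n z s l → v₀ = symConfig g f u₀ →
          IsVortexEquilibrium v₀ ∧
          Set.range (fun j : Fin (2 * n) => rot (g j) u₀) =
            antiprismVertices n z (s * (-1) ^ l) ∧
          (n = 3 → IsCube (Set.range v₀)) ∧
          (n = 5 → IsIcosahedron (Set.range v₀)) ∧
          ∃ h₁ > vortexEnergy v₀, ∃ (u : ℝ → ℝ → E3) (T : ℝ → ℝ),
            IsPeriodicFamily (Set.Ioo (vortexEnergy v₀) h₁)
              (fun h t => symConfig g f (u h t)) T ∧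
            TendstoUniformly (fun h t => symConfig g f (u h t)) (fun _ => v₀)
              (𝓝[>] (vortexEnergy v₀)) ∧
            ∀ h ∈ Set.Ioo (vortexEnergy v₀) h₁, ∀ j : Fin (2 * n),
              ∃ ε ∈ ({1, -1} : Set ℤ),
                WindsAround (rot (g j) u₀) (fun t => rot (g j) (u h t)) (T h) ε) ∧
    -- the family converging to the polar collision
    (∀ u₀ ∈ poles,
      (∀ p ∈ poles, {j : Fin (2 * n) | rot (g j) u₀ = p}.ncard = n) ∧
      ∃ (h₁ : ℝ) (u : ℝ → ℝ → E3) (T : ℝ → ℝ),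
        IsPeriodicFamily (Set.Ioi h₁) (fun h t => symConfig g f (u h t)) T ∧
        TendstoUniformly (fun h t => symConfig g f (u h t)) (fun _ => symConfig g f u₀) atTop ∧
        Tendsto T atTop (𝓝 0) ∧
        ∀ h ∈ Set.Ioi h₁,
          (∀ i j : Fin (2 * n), rot (g i) u₀ = rot (g j) u₀ →
            Set.range (fun t => rot (g i) (u h t)) = Set.range (fun t => rot (g j) (u h t))) ∧
          ∃ ε ∈ ({1, -1} : Set ℤ), ∀ j : Fin (2 * n),
            (rot (g j) u₀ = northPole →
              WindsAround northPole (fun t => rot (g j) (u h t)) (T h) ε) ∧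
            (rot (g j) u₀ = -northPole →
              WindsAround northPole (fun t => rot (g j) (u h t)) (T h) (-ε))) ∧
    -- the family converging to the polygonal collisions with poles
    (∀ l : ℕ, l < 2 * n → ∀ u₀ : E3, u₀ = equatorPoint n l →
      Set.range (fun j : Fin (2 * n) => rot (g j) u₀) =
        {x | ∃ k : ℕ, k < n ∧ x = equatorPoint n (l + 2 * k)} ∧
      (∀ k : ℕ, k < n →
        {j : Fin (2 * n) | rot (g j) u₀ = equatorPoint n (l + 2 * k)}.ncard = 2) ∧
      ∃ (h₁ : ℝ) (u : ℝ → ℝ → E3) (T : ℝ → ℝ),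
        IsPeriodicFamily (Set.Ioi h₁) (fun h t => symConfig g f (u h t)) T ∧
        TendstoUniformly (fun h t => symConfig g f (u h t)) (fun _ => symConfig g f u₀) atTop ∧
        Tendsto T atTop (𝓝 0) ∧
        ∀ h ∈ Set.Ioi h₁,
          (∀ i j : Fin (2 * n), rot (g i) u₀ = rot (g j) u₀ →
            Set.range (fun t => rot (g i) (u h t)) = Set.range (fun t => rot (g j) (u h t))) ∧
          ∀ j : Fin (2 * n), ∃ ε ∈ ({1, -1} : Set ℤ),
            WindsAround (rot (g j) u₀) (fun t => rot (g j) (u h t)) (T h) ε) := by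
  have hn0 : 0 < n := by omega
  refine ⟨fun hn3 => ?_, fun u₀ hu₀ => ⟨fun p hp => ncard_rot_eq_pole hn0 g hu₀ hp, ?_⟩,
    fun l _ u₀ hu₀ => ?_⟩
  · obtain ⟨z, hz, h0, hlt, hgt⟩ := exists_antiprism_lat hn3
    -- The point of Mercator latitude z has height tanh z, and tanh² z = 1 − 1/cosh² z, so the root
    -- of the polynomial is cosh z.
    refine ⟨Real.cosh z, Real.tanh z, antiprismPoly_root hz h0 hlt hgt,
      ⟨tanh_pos hz, Real.tanh_lt_one z, ?_⟩, ?_⟩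
    · have := (Real.cosh_pos z).ne'
      rw [Real.tanh_eq_sinh_div_cosh]
      field_simp
      exact Real.sinh_sq z
    · intro σ hσ l _ u₀ v₀ hu hv
      have hσ' : σ = 1 ∨ σ = -1 := hσ
      have hs₀ : σ * z = z ∨ σ * z = -z := by rcases hσ' with rfl | rfl <;> simp
      have hrange := range_rot_antiprismPoint hn0 g z hσ' l
      have hθ := cos_antiprism_lon hn0 l
      rw [← hu] at hrange
      have heq : IsVortexEquilibrium v₀ := by
        rw [hv, hu, antiprismPoint_tanh n z hσ']
        exact isVortexEquilibrium_antiprism hn g f hθ hs₀ h0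
      -- Absence of collisions supplies the count of vertices that turns inclusion into equality for
      -- the cube and the icosahedron.
      have hcard : (range v₀).ncard = 2 * n + 2 := by
        rw [ncard_range_of_injective heq.1.2, Nat.card_fin]
      have hunion : range v₀ = antiprismVertices n (Real.tanh z) (σ * (-1) ^ l) ∪ poles := by
        rw [hv, range_symConfig, hrange]
      refine ⟨heq, hrange, ?_, ?_, ?_⟩
      · rintro rfl
        exact isCube_antiprism (mul_neg_one_pow_eq_or l hσ') hcard
          (by rw [hunion, tanh_eq_of_three hz h0])
      · rintro rfl
        exact isIcosahedron_antiprism (mul_neg_one_pow_eq_or l hσ') hcard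
          (by rw [hunion, tanh_eq_of_five hz h0])
      · rw [hv, hu, antiprismPoint_tanh n z hσ']
        obtain ⟨h₁, hh₁, u, T, H1, H2, H3⟩ := exists_family_antiprism hn g f hθ hz hs₀ hlt hgt
        exact ⟨h₁, hh₁, u, T, H1, H2, fun h hh j => ⟨-1, by simp, H3 h hh j⟩⟩
  · obtain ⟨h₁, u, T, H1, H2, H3, H4⟩ := exists_family_poles hn g f hu₀
    exact ⟨h₁, u, T, H1, H2, H3, fun h hh => ⟨(H4 h hh).1, 1, by simp, (H4 h hh).2⟩⟩
  · subst hu₀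
    refine ⟨range_rot_equatorPoint hn0 g l, fun k hk => ncard_rot_eq_equatorPoint hn0 g l hk, ?_⟩
    obtain ⟨h₁, u, T, H1, H2, H3, H4⟩ := exists_family_equator hn g f (cos_equator_lon hn0 l)
    rw [merc_zero_eq_equatorPoint] at H2 H4
    exact ⟨h₁, u, T, H1, H2, H3, fun h hh => ⟨(H4 h hh).1, fun j => ⟨1, by simp, (H4 h hh).2 j⟩⟩⟩
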